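/- **The $k$-LSM priority queue.** Finitely many threads $1,\dots,T$ work on a sequentially consistent shared memory with garbage collection (every allocation gets a fresh address). Keys come from a linearly ordered set, and $k\ge 0$ is a fixed relaxation parameter. An *item* is a key with an atomic deletion flag. A *block* of level $l$ is a sorted array of pointers to at most $2^l$ items, with a counter `filled`, the only field that changes after construction. Copying or merging blocks builds a new block and drops the deleted items. Shrinking a block lowers `filled` past the deleted items at its end, and continues with a copy of smaller level if $2^{l-1}$ or fewer items remain. * Each thread owns a *DistLSM*, an array of blocks of decreasing level. Other threads only read it: a thread with no items may copy ("spy") the blocks of another thread. * The *shared $k$-LSM* is one pointer `shared`, initially null, to an immutable array of blocks. It is only changed by compare-and-swap (CAS). A thread copies the array that `shared` points to into a private snapshot, modifies the snapshot, and tries to replace, by one CAS, the pointer that it read by a pointer to its snapshot. * `insert(key)` makes a level-$0$ block with a new item and, from the back of the thread's own DistLSM, merges it with the blocks whose level does not exceed the current one, shrinking after each merge. If the resulting level $l$ satisfies $2^{l+1}\le k$, the block is stored in the DistLSM. Otherwise it is inserted into the shared $k$-LSM: take a new snapshot, add the block, consolidate (shrink blocks, merge until levels strictly decrease, drop empty blocks),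 and CAS; if the CAS fails, retry on a new snapshot. * `delete_min` compares the minimum found in the thread's own DistLSM with an item chosen in its snapshot of the shared $k$-LSM by means of pivots, and takes the smaller by a test-and-set of its flag, repeating if the item was already deleted. If a found item is deleted, the structure concerned is consolidated; for the shared $k$-LSM the consolidated snapshot is pushed by CAS if blocks were merged or no block is left (then null is pushed). If both are empty, it spies on a random thread, and repeats if this leaves its DistLSM with a block. An execution starts with the empty queue and idle threads. In each step an adversary picks a thread, which invokes an `insert` or a `delete_min` if it is idle, and otherwise performs one atomic memory operation of its call, starts one round of a loop, or returns from the call. The adversary also picks the results of the random draws. **Lemma.** For every linearly ordered set of keys, every $T$ and every $k$: 1. *`insert` is lock-free:* in every infinite execution in which infinitely many steps are taken by threads that are running an `insert`, infinitely many operations complete. 2. *Inserting only into the thread-local DistLSM is wait-free:* whenever a thread invokes an `insert` in a reachable configuration, there is a finite bound $B$, depending only on that configuration, the thread and the key, such that under every further schedule the thread returns from the `insert` within its first $B$ own steps, unless within these steps the `insert` accesses `shared`. 3. *An `insert` retries only when its CAS fails:* if one and the same `insert` reads `shared` at two different times (to take a snapshot), then it executes a failing CAS on `shared` between them. 4. *A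 CAS failure requires a successful update by another thread:* if a CAS on `shared` by an `insert` fails, then between the last time this thread read `shared` before it (after which it did not return from a call and did not execute another CAS) and the failing CAS, another thread executed a CAS on `shared` that succeeded and changed its value. -/

import Mathlib

namespace KLSM

/-! # Shared memory

Sequentially consistent shared memory with garbage collection: addresses are natural numbers, every
allocation takes a fresh address, and a null pointer is `none`. -/

/-- A reference to an `Item`. The key of an item never changes, so the reference carries it; the
mutable deletion flag is stored in memory at the address `addr`. -/
structure Item (K : Type) where
  addr : ℕ
  key : K

/-- A `Block`: `filled` is the only field that is modified after the construction of the block.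
`items` is the sorted array of item pointers, in decreasing key order. -/
structure Block (K : Type) where
  level : ℕ
  filled : ℕ
  items : List (Item K)

/-- The contents of a `BlockArray`: the pointers `blocks[i]`, each with its pivot index
`k_pivots[i]`; `size` is the length of the list. -/
abbrev BlockArray := List (ℕ × ℕ)

/-- A thread-local `DistLSM`: its array of block pointers and its size. -/
structure DistLSM where
  blocks : ℕ → Option ℕ
  size : ℕ

/-- The memory for `T` threads. `flag`, `block` and `array` are the heaps of items, blocks and block
arrays, followed by the respective allocation counters. `shared` is the pointer of the shared
`k`-LSM; `observed`, `snapshot` and `dist` hold one instance per thread. `snapshot` holds the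
contents of the private block array that the thread works on. -/
structure Mem (K : Type) (T : ℕ) where
  flag : ℕ → Bool
  nextItem : ℕ
  block : ℕ → Block K
  nextBlock : ℕ
  array : ℕ → BlockArray
  nextArray : ℕ
  shared : Option ℕ
  observed : Fin T → Option ℕ
  snapshot : Fin T → Option BlockArray
  dist : Fin T → DistLSM

/-- The atomic operations, indexed by the type of the value they return. -/
inductive Op (K : Type) (T : ℕ) : Type → Type 1
  | newItem (key : K) : Op K T (Item K)
  | flag (it : Item K) : Op K T Bool
  | testAndSet (it : Item K) : Op K T Bool
  | newBlock (level : ℕ) (items : List (Item K)) : Op K T ℕ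
  | level (b : ℕ) : Op K T ℕ
  | filled (b : ℕ) : Op K T ℕ
  | setFilled (b n : ℕ) : Op K T Unit
  | item (b i : ℕ) : Op K T (Option (Item K))
  | distSize (t : Fin T) : Op K T ℕ
  | setDistSize (t : Fin T) (n : ℕ) : Op K T Unit
  | distBlock (t : Fin T) (i : ℕ) : Op K T (Option ℕ)
  | setDistBlock (t : Fin T) (i : ℕ) (b : ℕ) : Op K T Unit
  | newArray (a : BlockArray) : Op K T ℕ
  | loadArray (p : ℕ) : Op K T BlockArray
  | readShared : Op K T (Option ℕ)
  | casShared (expected new : Option ℕ) : Op K T Bool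
  | observed (t : Fin T) : Op K T (Option ℕ)
  | setObserved (t : Fin T) (p : Option ℕ) : Op K T Unit
  | snapshot (t : Fin T) : Op K T (Option BlockArray)
  | setSnapshot (t : Fin T) (a : Option BlockArray) : Op K T Unit
  | rand (n : ℕ) : Op K T ℕ
  | randThread : Op K T (Fin T)

/-- The effect of an atomic operation on memory, and the value that it returns. The numbers `rnd`
and `victim` are the outcomes of the random draws, should the operation be one. -/
def Op.exec {K : Type} {T : ℕ} (rnd : ℕ) (victim : Fin T) (m : Mem K T) :
    {β : Type} → Op K T β → β × Mem K T
  | _, .newItem key =>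
    (⟨m.nextItem, key⟩,
      { m with flag := Function.update m.flag m.nextItem false, nextItem := m.nextItem + 1 })
  | _, .flag it => (m.flag it.addr, m)
  -- the returned value tells whether this operation has set the flag
  | _, .testAndSet it => (!m.flag it.addr, { m with flag := Function.update m.flag it.addr true })
  | _, .newBlock l is =>
    (m.nextBlock,
      { m with
        block := Function.update m.block m.nextBlock ⟨l, is.length, is⟩
        nextBlock := m.nextBlock + 1 })
  | _, .level b => ((m.block b).level, m)
  | _, .filled b => ((m.block b).filled, m)
  | _, .setFilled b n =>
    ((), { m with block := Function.update m.block b { m.block b with filled := n } })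
  | _, .item b i => ((m.block b).items[i]?, m)
  | _, .distSize t => ((m.dist t).size, m)
  | _, .setDistSize t n =>
    ((), { m with dist := Function.update m.dist t { m.dist t with size := n } })
  | _, .distBlock t i => ((m.dist t).blocks i, m)
  | _, .setDistBlock t i b =>
    ((), { m with
      dist := Function.update m.dist t
        { m.dist t with blocks := Function.update (m.dist t).blocks i (some b) } })
  | _, .newArray a =>
    (m.nextArray,
      { m with array := Function.update m.array m.nextArray a, nextArray := m.nextArray + 1 })
  | _, .loadArray p => (m.array p, m)
  | _, .readShared => (m.shared, m)
  | _, .casShared expected new =>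
    if m.shared = expected then (true, { m with shared := new }) else (false, m)
  | _, .observed t => (m.observed t, m)
  | _, .setObserved t p => ((), { m with observed := Function.update m.observed t p })
  | _, .snapshot t => (m.snapshot t, m)
  | _, .setSnapshot t a => ((), { m with snapshot := Function.update m.snapshot t a })
  -- a number below `n`, or `0` if there is none
  | _, .rand n => (if n = 0 then 0 else rnd % n, m)
  | _, .randThread => (victim, m)

/-! # Programs -/

/-- Programs that return an `α`: return a value; perform one atomic operation and go on with its
result; or enter an unrestricted loop, whose body turns the loop state `s` into either a further
loop state (`Sum.inl`, next round) or a result (`Sum.inr`, exit), and go on with the result. -/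
inductive Prog (K : Type) (T : ℕ) : Type → Type 1
  | ret {α : Type} (a : α) : Prog K T α
  | act {α β : Type} (o : Op K T β) (next : β → Prog K T α) : Prog K T α
  | loop {α σ β : Type} (body : σ → Prog K T (σ ⊕ β)) (s : σ) (next : β → Prog K T α) : Prog K T α

/-- Sequential composition. -/
def Prog.bind {K : Type} {T : ℕ} {α γ : Type} : Prog K T α → (α → Prog K T γ) → Prog K T γ
  | .ret a, f => f a
  | .act o next, f => .act o fun b => (next b).bind f
  | .loop body s next, f => .loop body s fun b => (next b).bind f

instance {K : Type} {T : ℕ} : Monad (Prog K T) where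
  pure := Prog.ret
  bind := Prog.bind

/-- The program that performs a single atomic operation. -/
def Op.call {K : Type} {T : ℕ} {β : Type} (o : Op K T β) : Prog K T β := .act o .ret

/-- The loop with initial state `s`. -/
def iter {K : Type} {T : ℕ} {σ β : Type} (s : σ) (body : σ → Prog K T (σ ⊕ β)) : Prog K T β :=
  .loop body s .ret

section Code

variable {K : Type} [LinearOrder K] {T : ℕ}

/-! ## Blocks

The blocks that are built by `append`, `copy` and `merge_in` are invisible to other threads while
they are being built. The list of their items is collected first and then allocated. -/

/-- `Block::append`: add an item at the end, unless it is logically deleted. -/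
def append (acc : List (Item K)) (it : Item K) : Prog K T (List (Item K)) := do
  let deleted ← (Op.flag it).call
  return if deleted then acc else acc ++ [it]

/-- Append the item at index `i` of block `b`. -/
def appendFrom (acc : List (Item K)) (b i : ℕ) : Prog K T (List (Item K)) := do
  match ← (Op.item b i).call with
  | none => return acc
  | some it => append acc it

/-- `Block::copy`: copy block `b` into a new block of level `l`. -/
def copy (b l : ℕ) : Prog K T ℕ := do
  let items ← iter (0, ([] : List (Item K))) fun (i, acc) => do
    let filled ← (Op.filled b).call
    if i < filled then
      let acc ← appendFrom acc b i
      return .inl (i + 1, acc)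
    else
      return .inr acc
  (Op.newBlock l items).call

/-- `Block::merge_in`: two-way merge of the blocks `b₁` and `b₂` into a new block of level `l`. -/
def mergeIn (b₁ b₂ l : ℕ) : Prog K T ℕ := do
  let f₁ ← (Op.filled b₁).call
  let f₂ ← (Op.filled b₂).call
  let items ← iter (0, 0, ([] : List (Item K))) fun (i, j, acc) => do
    if i < f₁ then
      if j < f₂ then
        match ← (Op.item b₁ i).call, ← (Op.item b₂ j).call with
        | some x, some y =>
          if y.key ≤ x.key then
            let acc ← append acc x
            return .inl (i + 1, j, acc)
          else
            let acc ← append acc y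
            return .inl (i, j + 1, acc)
        | none, _ => return .inl (i + 1, j, acc)
        | _, none => return .inl (i, j + 1, acc)
      else
        let acc ← appendFrom acc b₁ i
        return .inl (i + 1, j, acc)
    else if j < f₂ then
      let acc ← appendFrom acc b₂ j
      return .inl (i, j + 1, acc)
    else
      return .inr acc
  (Op.newBlock l items).call

/-- The result of `while (l > 0 && f <= 2^(l-1)) --l`. -/
def fitLevel (f : ℕ) : ℕ → ℕ
  | 0 => 0
  | l + 1 => if f ≤ 2 ^ l then fitLevel f l else l + 1

/-- `Block::shrink`: cut off the logically deleted items at the end of the block; if the block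
needs a smaller level, continue with a copy of that level. -/
def shrink (b : ℕ) : Prog K T ℕ :=
  iter b fun b => do
    let filled ← (Op.filled (K := K) b).call
    let f ← iter filled fun f => do
      if f = 0 then
        return .inr 0
      else
        match ← (Op.item (K := K) b (f - 1)).call with
        | none => return .inl (f - 1)
        | some it =>
          let deleted ← (Op.flag it).call
          return if deleted then .inl (f - 1) else .inr f
    let level ← (Op.level b).call
    let l := fitLevel f level
    if l < level then
      let nb ← copy b l
      return .inl nb
    else
      (Op.setFilled b f).call
      return .inr b

/-! ## Arrays of blocks -/

/-- Merge block `b` with its successors (the blocks `acc`, by decreasing level) for as long as its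
level does not exceed the level of its successor. Returns all blocks and whether a merge occurred
(or `merged`). -/
def mergeSuccessors (b : ℕ) (acc : List ℕ) (merged : Bool) : Prog K T (List ℕ × Bool) :=
  iter (b, acc, merged) fun (b, acc, merged) => do
    match acc with
    | [] => return .inr ([b], merged)
    | s :: rest =>
      let lb ← (Op.level b).call
      let ls ← (Op.level s).call
      if lb ≤ ls then
        let nb ← mergeIn b s (ls + 1)
        let nb ← shrink nb
        return .inl (nb, rest, true)
      else
        return .inr (b :: s :: rest, merged)

/-- Make the levels of a list of blocks strictly decreasing. First pass: from the last (smallest)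
block to the first, shrink the block and merge it with its successors if necessary. Second pass:
remove the empty blocks. The Boolean tells whether a merge occurred. -/
def consolidateBlocks (bs : List ℕ) : Prog K T (List ℕ × Bool) := do
  let (bs, merged) ← iter (bs.reverse, ([] : List ℕ), false) fun (todo, acc, merged) => do
    match todo with
    | [] => return .inr (acc, merged)
    | b :: todo =>
      let b ← shrink b
      let (acc, merged) ← mergeSuccessors b acc merged
      return .inl (todo, acc, merged)
  let bs ← iter (bs, ([] : List ℕ)) fun (todo, acc) => do
    match todo with
    | [] => return .inr acc
    | b :: todo =>
      let filled ← (Op.filled b).call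
      return .inl (todo, if filled = 0 then acc else acc ++ [b])
  return (bs, merged)

/-- The keys stored in block `b`. -/
def blockKeys (b : ℕ) : Prog K T (List K) := do
  let filled ← (Op.filled b).call
  iter (0, ([] : List K)) fun (i, acc) => do
    if i < filled then
      match ← (Op.item b i).call with
      | none => return .inl (i + 1, acc)
      | some it => return .inl (i + 1, acc ++ [it.key])
    else
      return .inr acc

/-- `BlockArray::calculate_pivots`: select one of the `k + 1` smallest keys as pivot, and store for
each block the offset of the first key that is at most the pivot. -/
def calculatePivots (k : ℕ) (bs : List ℕ) : Prog K T BlockArray := do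
  let bks ← iter (bs, ([] : List (ℕ × List K))) fun (todo, acc) => do
    match todo with
    | [] => return .inr acc
    | b :: todo =>
      let keys ← blockKeys b
      return .inl (todo, acc ++ [(b, keys)])
  let sorted := (bks.flatMap fun bk => bk.2).mergeSort
  let r ← (Op.rand (min (k + 1) sorted.length)).call
  match sorted[r]? with
  | none => return bks.map fun bk => (bk.1, 0)
  | some pivot => return bks.map fun bk => (bk.1, (bk.2.takeWhile fun x => pivot < x).length)

/-- `BlockArray::consolidate`. The Boolean tells whether a merge occurred. -/
def consolidate (k : ℕ) (a : BlockArray) : Prog K T (BlockArray × Bool) := do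
  let (bs, merged) ← consolidateBlocks (K := K) (a.map Prod.fst)
  let a ← calculatePivots (K := K) k bs
  return (a, merged)

/-- `BlockArray::insert`: add block `b` at the position that its level demands, and consolidate. -/
def arrayInsert (k : ℕ) (a : BlockArray) (b : ℕ) : Prog K T BlockArray := do
  let lb ← (Op.level b).call
  let a ← iter (([] : BlockArray), a) fun (front, rest) => do
    match rest with
    | [] => return .inr (front ++ [(b, 0)])
    | x :: rest =>
      let lx ← (Op.level x.1).call
      if lb < lx then
        return .inl (front ++ [x], rest)
      else
        return .inr (front ++ (b, 0) :: x :: rest)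
  let (a, _) ← consolidate (K := K) k a
  return a

/-- `BlockArray::find_min`. The result is `none` if no item can be selected because the blocks have
meanwhile been shrunk by other threads. -/
def arrayFindMin (a : BlockArray) : Prog K T (Option (Item K)) := do
  let total ← iter (a, (0 : ℤ)) fun (todo, total) => do
    match todo with
    | [] => return .inr total
    | (b, pivot) :: todo =>
      let filled ← (Op.filled b).call
      return .inl (todo, total + ((filled : ℤ) - pivot))
  let r ← (Op.rand total.toNat).call
  iter (a, (r : ℤ)) fun (todo, r) => do
    match todo with
    | [] => return .inr none
    | (b, pivot) :: todo =>
      let filled ← (Op.filled b).call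
      let range : ℤ := (filled : ℤ) - pivot
      if range ≤ r then
        return .inl (todo, r - range)
      else
        let selected ←
          if r ≠ range - 1 then (do
            match ← (Op.item b (pivot + r.toNat)).call with
            | none => return none
            | some it =>
              let deleted ← (Op.flag it).call
              return if deleted then none else some it)
          else (do return none)
        match selected with
        | some it => return .inr (some it)
        | none =>
          let filled ← (Op.filled b).call
          if filled = 0 then
            return .inr none
          else
            let it ← (Op.item b (filled - 1)).call
            return .inr it

/-! ## The shared `k`-LSM -/

/-- `SharedKLSM::refresh_snapshot`. -/
def refreshSnapshot (t : Fin T) : Prog K T Unit := do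
  let p ← Op.readShared.call
  (Op.setObserved t p).call
  match p with
  | none => (Op.setSnapshot t none).call
  | some p =>
    let a ← (Op.loadArray p).call
    (Op.setSnapshot t (some a)).call

/-- `SharedKLSM::push_snapshot`: one compare-and-swap of `shared` from `observed` to a pointer to
the snapshot. -/
def pushSnapshot (t : Fin T) : Prog K T Bool := do
  let expected ← (Op.observed t).call
  match ← (Op.snapshot t).call with
  | none => (Op.casShared expected none).call
  | some a =>
    let p ← (Op.newArray a).call
    (Op.casShared expected (some p)).call

/-- `SharedKLSM::insert`: insert block `b` into a new snapshot, consolidate and try to push the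
snapshot; retry on a new snapshot if this fails. After a success the snapshot is public, and the
thread gives it up. -/
def sharedInsert (k : ℕ) (t : Fin T) (b : ℕ) : Prog K T Unit :=
  iter () fun _ => do
    refreshSnapshot t
    let snapshot ← (Op.snapshot t).call
    let a ← arrayInsert (K := K) k (snapshot.getD []) b
    (Op.setSnapshot t (some a)).call
    let success ← pushSnapshot t
    if success then
      (Op.setObserved t none).call
      (Op.setSnapshot t none).call
      return .inr ()
    else
      return .inl ()

/-- `SharedKLSM::find_min`. -/
def sharedFindMin (k : ℕ) (t : Fin T) : Prog K T (Option (Item K)) :=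
  iter () fun _ => do
    let shared ← Op.readShared.call
    let observed ← (Op.observed t).call
    if shared ≠ observed then
      refreshSnapshot t
    match ← (Op.snapshot t).call with
    | none => return .inr none
    | some a =>
      let found ← arrayFindMin a
      let live ← match found with
        | none => pure false
        | some it => do
          let deleted ← (Op.flag it).call
          pure !deleted
      if live then
        return .inr found
      else
        let (a, merged) ← consolidate (K := K) k a
        if a.isEmpty then
          (Op.setSnapshot t none).call
          let _ ← pushSnapshot t
          return .inl ()
        else
          (Op.setSnapshot t (some a)).call
          if merged then
            let _ ← pushSnapshot t
            return .inl ()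
          else
            return .inl ()

/-! ## The distributed LSM -/

/-- `DistLSM::insert` in the combined data structure: merge the new item with the blocks of the
thread-local LSM, starting from the back; then either put the resulting block into the
thread-local LSM or, if its level exceeds `log₂ k - 1`, into the shared `k`-LSM. -/
def distInsert (k : ℕ) (t : Fin T) (it : Item K) : Prog K T Unit := do
  let items ← append [] it
  let b ← (Op.newBlock 0 items).call
  let size ← (Op.distSize t).call
  let (i, b) ← iter (size, b) fun (i, b) => do
    if i = 0 then
      return .inr (i, b)
    else
      match ← (Op.distBlock t (i - 1)).call with
      | none => return .inl (i - 1, b)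
      | some b' =>
        let lb' ← (Op.level b').call
        let lb ← (Op.level b).call
        if lb' ≤ lb then
          let b₂ ← mergeIn b' b (lb + 1)
          let b₂ ← shrink b₂
          return .inl (i - 1, b₂)
        else
          return .inr (i, b)
  let lb ← (Op.level b).call
  if k < 2 ^ (lb + 1) then
    sharedInsert (K := K) k t b
    (Op.setDistSize t i).call
  else
    (Op.setDistBlock t i b).call
    (Op.setDistSize t (i + 1)).call

/-- The list of the blocks in the thread-local LSM of thread `t`. -/
def distBlocks (t : Fin T) : Prog K T (List ℕ) := do
  let size ← (Op.distSize t).call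
  iter (0, ([] : List ℕ)) fun (i, acc) => do
    if i < size then
      match ← (Op.distBlock t i).call with
      | none => return .inl (i + 1, acc)
      | some b => return .inl (i + 1, acc ++ [b])
    else
      return .inr acc

/-- `DistLSM::consolidate`: shrink and merge the blocks where needed, make the resulting blocks
available and only then give up the remaining old ones. -/
def distConsolidate (t : Fin T) : Prog K T Unit := do
  let bs ← distBlocks (K := K) t
  let (bs, _) ← consolidateBlocks (K := K) bs
  let size ← iter (0, bs) fun (i, bs) => do
    match bs with
    | [] => return .inr i
    | b :: bs =>
      (Op.setDistBlock t i b).call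
      return .inl (i + 1, bs)
  (Op.setDistSize t size).call

/-- `DistLSM::find_min`: the minimum of the last items of the blocks; if that one is deleted,
consolidate and repeat. -/
def distFindMin (t : Fin T) : Prog K T (Option (Item K)) :=
  iter () fun _ => do
    let bs ← distBlocks (K := K) t
    if bs.isEmpty then
      return .inr none
    else
      let found ← iter (bs, (none : Option (Item K))) fun (todo, best) => do
        match todo with
        | [] => return .inr best
        | b :: todo =>
          let filled ← (Op.filled b).call
          if filled = 0 then
            return .inl (todo, best)
          else
            match best, ← (Op.item b (filled - 1)).call with
            | some x, some y => return .inl (todo, some (if y.key < x.key then y else x))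
            | some x, none => return .inl (todo, some x)
            | none, y => return .inl (todo, y)
      let live ← match found with
        | none => pure false
        | some it => do
          let deleted ← (Op.flag it).call
          pure !deleted
      if live then
        return .inr found
      else
        distConsolidate (K := K) t
        return .inl ()

/-- `DistLSM::spy`: thread `t` copies blocks of the thread-local LSM of thread `victim`. -/
def spy (t victim : Fin T) : Prog K T Bool := do
  iter 0 fun i => do
    let n ← (Op.distSize (K := K) victim).call
    if i < n then
      match ← (Op.distBlock victim i).call with
      | none => return .inl (i + 1)
      | some b =>
        let l ← (Op.level b).call
        let size ← (Op.distSize t).call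
        let fits ←
          if size = 0 then pure true
          else do
            match ← (Op.distBlock t (size - 1)).call with
            | none => pure true
            | some last =>
              let ll ← (Op.level last).call
              pure (decide (l < ll))
        if fits then
          let nb ← copy (K := K) b l
          (Op.setDistBlock t size nb).call
          (Op.setDistSize t (size + 1)).call
          return .inl (i + 1)
        else
          return .inl (i + 1)
    else
      return .inr ()
  let size ← (Op.distSize t).call
  return decide (size ≠ 0)

/-! ## The combined priority queue -/

/-- `KLSM::insert`. -/
def insert (k : ℕ) (t : Fin T) (key : K) : Prog K T Unit := do
  let it ← (Op.newItem key).call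
  distInsert k t it

/-- `KLSM::delete_min`. -/
def deleteMin (k : ℕ) (t : Fin T) : Prog K T (Option K) :=
  iter () fun _ => do
    let taken ← iter () fun _ => do
      let found ← match ← distFindMin t with
        | none => sharedFindMin k t
        | some it => do
          match ← sharedFindMin k t with
          | none => pure (some it)
          | some tmp => pure (some (if tmp.key < it.key then tmp else it))
      match found with
      | none => return .inr none
      | some it =>
        let deleted ← (Op.flag it).call
        if deleted then
          return .inl ()
        else
          let success ← (Op.testAndSet it).call
          return if success then .inr (some it) else .inl ()
    match taken with
    | some it => return .inr (some it.key)
    | none =>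
      let victim ← Op.randThread.call
      let success ← spy (K := K) t victim
      return if success then .inl () else .inr none

end Code

/-! # Executions -/

/-- The calls of the external interface. -/
inductive Call (K : Type)
  | insert (key : K)
  | deleteMin

/-- The type of the value that a call returns. -/
def Call.Ret {K : Type} : Call K → Type
  | .insert _ => Unit
  | .deleteMin => Option K

/-- The program that thread `t` runs for a call. -/
def Call.code {K : Type} [LinearOrder K] {T : ℕ} (k : ℕ) (t : Fin T) :
    (c : Call K) → Prog K T c.Ret
  | .insert key => KLSM.insert k t key
  | .deleteMin => KLSM.deleteMin k t

/-- A thread is idle, or it is running a call and has the program `p` left to execute. -/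
inductive ThreadState (K : Type) (T : ℕ) : Type 1
  | idle
  | running (c : Call K) (p : Prog K T c.Ret)

/-- A configuration: the memory and the state of each thread. -/
structure Config (K : Type) (T : ℕ) : Type 1 where
  mem : Mem K T
  thread : Fin T → ThreadState K T

/-- The empty priority queue, with all threads idle. -/
def Config.start (K : Type) (T : ℕ) : Config K T where
  mem :=
    { flag := fun _ => false
      nextItem := 0
      block := fun _ => ⟨0, 0, []⟩
      nextBlock := 0
      array := fun _ => []
      nextArray := 0
      shared := none
      observed := fun _ => none
      snapshot := fun _ => none
      dist := fun _ => ⟨fun _ => none, 0⟩ }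
  thread := fun _ => .idle

/-- What the adversary fixes for a step: which thread takes it, which call this thread invokes if it
is idle, and the outcome of the random draw if the step is one. -/
structure Choice (K : Type) (T : ℕ) where
  thread : Fin T
  call : Call K
  rnd : ℕ
  victim : Fin T

/-- One step of one thread. An idle thread invokes a call; a running thread performs one atomic
operation, starts one round of a loop, or returns from its call. Every thread can always take a
step. -/
def step {K : Type} [LinearOrder K] {T : ℕ} (k : ℕ) (c : Config K T) (ch : Choice K T) :
    Config K T :=
  match c.thread ch.thread with
  | .idle =>
    { c with thread :=
        Function.update c.thread ch.thread (.running ch.call (ch.call.code k ch.thread)) }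
  | .running _ (.ret _) => { c with thread := Function.update c.thread ch.thread .idle }
  | .running call (.act o next) =>
    let r := o.exec ch.rnd ch.victim c.mem
    { mem := r.2, thread := Function.update c.thread ch.thread (.running call (next r.1)) }
  | .running call (.loop body s next) =>
    let p := (body s).bind fun r =>
      match r with
      | .inl s' => .loop body s' next
      | .inr b => next b
    { c with thread := Function.update c.thread ch.thread (.running call p) }

/-- The configuration after the first `n` steps of the schedule `s`, starting from `c`. -/
def run {K : Type} [LinearOrder K] {T : ℕ} (k : ℕ) (c : Config K T) (s : ℕ → Choice K T) :
    ℕ → Config K T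
  | 0 => c
  | n + 1 => step k (run k c s n) (s n)

/-- The configurations that occur in executions of the `k`-LSM priority queue. -/
def Reachable {K : Type} [LinearOrder K] {T : ℕ} (k : ℕ) (c : Config K T) : Prop :=
  ∃ (s : ℕ → Choice K T) (n : ℕ), run k (Config.start K T) s n = c

/-! ## Events

The following speak about a configuration `c` and the step that thread `t` takes next in it. -/

/-- Thread `t` is running an `insert`. -/
def InInsert {K : Type} {T : ℕ} (c : Config K T) (t : Fin T) : Prop :=
  ∃ key p, c.thread t = .running (.insert key) p

/-- Thread `t` returns from its call: an operation completes. -/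
def Returns {K : Type} {T : ℕ} (c : Config K T) (t : Fin T) : Prop :=
  ∃ call r, c.thread t = .running call (.ret r)

/-- Thread `t` reads the pointer `shared`. -/
def ReadsShared {K : Type} {T : ℕ} (c : Config K T) (t : Fin T) : Prop :=
  ∃ call next, c.thread t = .running call (.act .readShared next)

/-- Thread `t` executes a compare-and-swap on `shared`, with these arguments. -/
def CasShared {K : Type} {T : ℕ} (c : Config K T) (t : Fin T) (expected new : Option ℕ) : Prop :=
  ∃ call next, c.thread t = .running call (.act (.casShared expected new) next)

/-- Thread `t` accesses the shared `k`-LSM. -/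
def AccessesShared {K : Type} {T : ℕ} (c : Config K T) (t : Fin T) : Prop :=
  ReadsShared c t ∨ ∃ expected new, CasShared c t expected new

/-- Thread `t` executes a compare-and-swap on `shared` that fails. -/
def CasFails {K : Type} {T : ℕ} (c : Config K T) (t : Fin T) : Prop :=
  ∃ expected new, CasShared c t expected new ∧ c.mem.shared ≠ expected

/-- Thread `t` executes a compare-and-swap on `shared` that succeeds and changes `shared`. -/
def UpdatesShared {K : Type} {T : ℕ} (c : Config K T) (t : Fin T) : Prop :=
  ∃ expected new, CasShared c t expected new ∧ c.mem.shared = expected ∧ new ≠ expected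

/-! ## Progress -/

/-- `insert` is lock-free: in every infinite execution in which infinitely many steps are taken by
threads that are running an `insert`, infinitely many operations complete. -/
def InsertLockFree (K : Type) [LinearOrder K] (T k : ℕ) : Prop :=
  ∀ s : ℕ → Choice K T,
    (∀ N, ∃ n ≥ N, InInsert (run k (Config.start K T) s n) (s n).thread) →
      ∀ N, ∃ n ≥ N, Returns (run k (Config.start K T) s n) (s n).thread

/-- Inserting only into the thread-local `DistLSM` is wait-free: for every `insert` that an idle
thread `t` invokes in a reachable configuration `c` there is a bound `B` such that, however the
steps of the threads are scheduled from there on, within its first `B` own steps `t` returns from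
the `insert`, unless within these steps the `insert` turns to the shared `k`-LSM. -/
def LocalInsertWaitFree (K : Type) [LinearOrder K] (T k : ℕ) : Prop :=
  ∀ (c : Config K T) (t : Fin T) (key : K), Reachable k c → c.thread t = .idle →
    ∃ B : ℕ, ∀ s : ℕ → Choice K T, (s 0).thread = t → (s 0).call = .insert key →
      ∀ N, B ≤ ((Finset.range N).filter fun i => (s i).thread = t).card →
        ∃ i < N, (s i).thread = t ∧
          (Returns (run k c s i) t ∨ AccessesShared (run k c s i) t)

/-- A retry is a second reading of `shared` (for a new snapshot) within the same `insert`. It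
happens only after a failed compare-and-swap of this `insert` in between. -/
def InsertRetriesOnlyOnCasFailure (K : Type) [LinearOrder K] (T k : ℕ) : Prop :=
  ∀ (s : ℕ → Choice K T) (t : Fin T) (m n : ℕ), m < n →
    (s m).thread = t → InInsert (run k (Config.start K T) s m) t →
    ReadsShared (run k (Config.start K T) s m) t →
    (s n).thread = t → ReadsShared (run k (Config.start K T) s n) t →
    (∀ i, m < i → i < n → (s i).thread = t → ¬ Returns (run k (Config.start K T) s i) t) →
      ∃ i, m < i ∧ i < n ∧ (s i).thread = t ∧ CasFails (run k (Config.start K T) s i) t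

/-- If a compare-and-swap of an `insert` fails, then another thread has successfully updated
`shared` since the `insert` last read it. -/
def InsertCasFailureNeedsUpdate (K : Type) [LinearOrder K] (T k : ℕ) : Prop :=
  ∀ (s : ℕ → Choice K T) (t : Fin T) (n : ℕ),
    (s n).thread = t → InInsert (run k (Config.start K T) s n) t →
    CasFails (run k (Config.start K T) s n) t →
      ∃ m < n, (s m).thread = t ∧ ReadsShared (run k (Config.start K T) s m) t ∧
        (∀ i, m < i → i < n → (s i).thread = t →
          ¬ Returns (run k (Config.start K T) s i) t ∧
          ¬ AccessesShared (run k (Config.start K T) s i) t) ∧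
        ∃ j, m < j ∧ j < n ∧ (s j).thread ≠ t ∧
          UpdatesShared (run k (Config.start K T) s j) (s j).thread

end KLSM

/-! The proof is a rely-guarantee argument. Each thread carries a ghost `Phase` recording what its
current call last did with `shared`, and `Ok` says which operations a thread may perform. An
`insert` reads `shared` only as its first access or directly after a failed CAS, and its CAS expects
exactly the value that it read last. A CAS of a `delete_min` either writes back the value that it
expects or writes one of smaller `meas`. Whatever `Ok` permits to one thread is harmless (`Ext`) to
all others (`Ext.of_other`). Hence the programs can be verified one thread at a time (`insert_safe`,
`deleteMin_safe`), and `Inv.run` turns the result into an invariant of all executions.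

Claims 3 and 4 are then read off the phases. Without a failing CAS the phase stays `seen` or `done`,
where no further read is permitted. A CAS of an `insert` is performed in phase `seen e`, so `shared`
was `e` at its last read; if it differs from `e` now, somebody else has changed it.

For wait-freedom (`insertLocal_bnd`), no other thread writes to the thread's own DistLSM, and the
item arrays of allocated blocks never change. The number of blocks and their capacities at the
invocation therefore bound all loops that precede an access to `shared`.

For lock-freedom, suppose that nothing returns any more. A successful `insert` update leaves its
thread in phase `done` for good, so each thread contributes at most one such update, and from some
time on only `delete_min` changes `shared`. These changes strictly decrease `meas`: a snapshot is
never longer than the array it came from (`Loc`), and it is pushed only after a merge has shortened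
it, or as null. So `shared` is eventually constant. But an `insert` that takes infinitely many steps
without returning starts infinitely many rounds (`Inv.exists_atRound`), each further one after a
failed CAS, whereas a CAS cannot fail once `shared` is constant from the preceding read on. -/

namespace KLSM

/-! # A rely-guarantee logic for one thread -/

section Logic

variable {K : Type} {T : ℕ}

/-- What a call has done with `shared` so far: it is a `delete_min`, whose accesses are not
restricted (`free`), or an `insert` that has not yet accessed `shared` (`start`), whose last access
has read `p` (`seen p`), or whose last access was a failed or successful compare-and-swap. -/
inductive Phase
  | free
  | start
  | seen (p : Option ℕ)
  | failed
  | done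

/-- The phase after an atomic operation that has returned the given value. -/
def Phase.next (ph : Phase) : {β : Type} → Op K T β → β → Phase
  | _, .readShared, v => match ph with
    | .free => .free
    | _ => .seen v
  | _, .casShared _ _, r => match ph with
    | .free => .free
    | _ => if r = true then .done else .failed
  | _, _, _ => ph

/-- The memory, together with the phase of one thread. -/
structure St (K : Type) (T : ℕ) where
  mem : Mem K T
  ph : Phase

/-- The global memory invariant: pointers are valid, and blocks are not filled beyond their
capacity. -/
structure GI (m : Mem K T) : Prop where
  filled : ∀ b, (m.block b).filled ≤ (m.block b).items.length
  dist : ∀ t i b, (m.dist t).blocks i = some b → b < m.nextBlock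
  array : ∀ p, ∀ x ∈ m.array p, x.1 < m.nextBlock
  shared : ∀ p, m.shared = some p → p < m.nextArray
  snapshot : ∀ t a, m.snapshot t = some a → ∀ x ∈ a, x.1 < m.nextBlock

/-- The size of the array that a value of `shared` points to, where null counts less than an empty
array. -/
def meas (m : Mem K T) : Option ℕ → ℕ
  | none => 0
  | some p => 1 + (m.array p).length

/-- The condition under which thread `t` may perform an operation. -/
def Ok (t : Fin T) (s : St K T) : {β : Type} → Op K T β → Prop
  | _, .setFilled b n => n ≤ (s.mem.block b).items.length
  | _, .setDistSize t' _ => t' = t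
  | _, .setDistBlock t' _ b => t' = t ∧ b < s.mem.nextBlock
  | _, .newArray a => ∀ x ∈ a, x.1 < s.mem.nextBlock
  | _, .readShared => s.ph = .free ∨ s.ph = .start ∨ s.ph = .failed
  | _, .casShared e n => (∀ p, n = some p → p < s.mem.nextArray) ∧
      (s.ph = .free ∧ (n = e ∨ meas s.mem n < meas s.mem e) ∨ s.ph = .seen e)
  | _, .setObserved t' _ => t' = t
  | _, .setSnapshot t' a => t' = t ∧ ∀ l, a = some l → ∀ x ∈ l, x.1 < s.mem.nextBlock
  | _, _ => True

/-- The state after an operation of the thread itself. -/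
def St.after (s : St K T) (rnd : ℕ) (v : Fin T) {β : Type} (o : Op K T β) : St K T :=
  ⟨(o.exec rnd v s.mem).2, s.ph.next o (o.exec rnd v s.mem).1⟩

/-- Memory evolves monotonically, and thread `t` writes at most to its `DistLSM`. -/
structure Grow (t : Fin T) (s s' : St K T) : Prop where
  ph : s'.ph = s.ph
  nb : s.mem.nextBlock ≤ s'.mem.nextBlock
  items : ∀ b < s.mem.nextBlock, (s'.mem.block b).items = (s.mem.block b).items
  level : ∀ b < s.mem.nextBlock, (s'.mem.block b).level = (s.mem.block b).level
  na : s.mem.nextArray ≤ s'.mem.nextArray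
  array : ∀ p < s.mem.nextArray, s'.mem.array p = s.mem.array p
  observed : s'.mem.observed t = s.mem.observed t
  snapshot : s'.mem.snapshot t = s.mem.snapshot t
  inv : GI s.mem → GI s'.mem

/-- Memory evolves monotonically, without writes to the local variables of thread `t`. -/
structure Ext (t : Fin T) (s s' : St K T) : Prop extends Grow t s s' where
  dist : s'.mem.dist t = s.mem.dist t

theorem Grow.refl (t : Fin T) (s : St K T) : Grow t s s :=
  ⟨rfl, le_rfl, fun _ _ => rfl, fun _ _ => rfl, le_rfl, fun _ _ => rfl, rfl, rfl, id⟩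

theorem Ext.refl (t : Fin T) (s : St K T) : Ext t s s := ⟨Grow.refl t s, rfl⟩

theorem Grow.trans {t : Fin T} {s₁ s₂ s₃ : St K T} (h : Grow t s₁ s₂) (h' : Grow t s₂ s₃) :
    Grow t s₁ s₃ where
  ph := h'.ph.trans h.ph
  nb := h.nb.trans h'.nb
  items b hb := (h'.items b (hb.trans_le h.nb)).trans (h.items b hb)
  level b hb := (h'.level b (hb.trans_le h.nb)).trans (h.level b hb)
  na := h.na.trans h'.na
  array p hp := (h'.array p (hp.trans_le h.na)).trans (h.array p hp)
  observed := h'.observed.trans h.observed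
  snapshot := h'.snapshot.trans h.snapshot
  inv := h'.inv ∘ h.inv

theorem Ext.trans {t : Fin T} {s₁ s₂ s₃ : St K T} (h : Ext t s₁ s₂) (h' : Ext t s₂ s₃) :
    Ext t s₁ s₃ := ⟨h.toGrow.trans h'.toGrow, h'.dist.trans h.dist⟩

/-- `Ok` demands that every stored pointer is already allocated and that `filled` stays within
capacity. Allocation counters only grow, so old pointers remain valid. -/
theorem GI.after {t : Fin T} {s : St K T} (h : GI s.mem) {β : Type} {o : Op K T β}
    (hok : Ok t s o) (rnd : ℕ) (v : Fin T) : GI (s.after rnd v o).mem := by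
  obtain ⟨h1, h2, h3, h4, h5⟩ := h
  cases o <;> simp only [St.after, Op.exec, Ok] at hok ⊢
  case newBlock l is =>
    refine ⟨fun b => ?_, fun t i b hb => (h2 t i b hb).trans (Nat.lt_succ_self _),
      fun p x hx => (h3 p x hx).trans (Nat.lt_succ_self _), h4,
      fun t a ha x hx => (h5 t a ha x hx).trans (Nat.lt_succ_self _)⟩
    by_cases hb : b = s.mem.nextBlock
    · subst hb; simp
    · simpa [Function.update_of_ne hb] using h1 b
  case setFilled b n =>
    refine ⟨fun b' => ?_, h2, h3, h4, h5⟩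
    by_cases hb : b' = b
    · subst hb; simpa using hok
    · simpa [Function.update_of_ne hb] using h1 b'
  case setDistSize t' n =>
    refine ⟨h1, fun t i b hb => ?_, h3, h4, h5⟩
    by_cases ht : t = t'
    · subst ht; exact h2 t i b (by simpa using hb)
    · exact h2 t i b (by simpa [Function.update_of_ne ht] using hb)
  case setDistBlock t' j b' =>
    refine ⟨h1, fun t i b hb => ?_, h3, h4, h5⟩
    by_cases ht : t = t'
    · subst ht
      by_cases hi : i = j
      · subst hi
        obtain rfl : b' = b := by simpa using hb
        exact hok.2
      · exact h2 t i b (by simpa [Function.update_of_ne hi] using hb)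
    · exact h2 t i b (by simpa [Function.update_of_ne ht] using hb)
  case newArray a =>
    refine ⟨h1, h2, fun p x hx => ?_, fun p hp => (h4 p hp).trans (Nat.lt_succ_self _), h5⟩
    by_cases hp : p = s.mem.nextArray
    · subst hp; exact hok x (by simpa using hx)
    · exact h3 p x (by simpa [Function.update_of_ne hp] using hx)
  case casShared e n =>
    split
    · exact ⟨h1, h2, h3, hok.1, h5⟩
    · exact ⟨h1, h2, h3, h4, h5⟩
  case setSnapshot t' a =>
    refine ⟨h1, h2, h3, h4, fun t l hl => ?_⟩
    by_cases ht : t = t'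
    · subst ht; exact hok.2 l (by simpa using hl)
    · exact h5 t l (by simpa [Function.update_of_ne ht] using hl)
  all_goals exact ⟨h1, h2, h3, h4, h5⟩

/-- An operation of thread `t` is a possible environment step for every other thread. -/
theorem Ext.of_other {t t' : Fin T} {s : St K T} {β : Type} {o : Op K T β} (hok : Ok t s o)
    (ht : t' ≠ t) (rnd : ℕ) (v : Fin T) (ph : Phase) :
    Ext t' ⟨s.mem, ph⟩ ⟨(o.exec rnd v s.mem).2, ph⟩ := by
  have hinv : GI s.mem → GI (o.exec rnd v s.mem).2 := fun h => h.after hok rnd v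
  cases o
  case newBlock l is =>
    refine ⟨⟨rfl, Nat.le_succ _, fun b hb => ?_, fun b hb => ?_, le_rfl, fun _ _ => rfl, rfl, rfl,
      hinv⟩, rfl⟩ <;> simp [Op.exec, Function.update_of_ne hb.ne]
  case setFilled b n =>
    refine ⟨⟨rfl, le_rfl, fun b' hb => ?_, fun b' hb => ?_, le_rfl, fun _ _ => rfl, rfl, rfl,
      hinv⟩, rfl⟩ <;> by_cases h : b' = b <;> simp [Op.exec, h]
  case newArray a =>
    refine ⟨⟨rfl, le_rfl, fun _ _ => rfl, fun _ _ => rfl, Nat.le_succ _, fun p hp => ?_, rfl, rfl,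
      hinv⟩, rfl⟩
    simp [Op.exec, Function.update_of_ne (show p ≠ s.mem.nextArray from hp.ne)]
  case casShared e n =>
    simp only [Op.exec] at hinv ⊢
    split <;> rename_i h
    · rw [if_pos h] at hinv
      exact ⟨⟨rfl, le_rfl, fun _ _ => rfl, fun _ _ => rfl, le_rfl, fun _ _ => rfl, rfl, rfl,
        hinv⟩, rfl⟩
    · exact Ext.refl _ _
  case setDistSize t'' n =>
    refine ⟨⟨rfl, le_rfl, fun _ _ => rfl, fun _ _ => rfl, le_rfl, fun _ _ => rfl, rfl, rfl,
      hinv⟩, ?_⟩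
    simp only [Ok] at hok; simp [Op.exec, hok, Function.update_of_ne ht]
  case setDistBlock t'' n b =>
    refine ⟨⟨rfl, le_rfl, fun _ _ => rfl, fun _ _ => rfl, le_rfl, fun _ _ => rfl, rfl, rfl,
      hinv⟩, ?_⟩
    simp only [Ok] at hok; simp [Op.exec, hok.1, Function.update_of_ne ht]
  case setObserved t'' p =>
    refine ⟨⟨rfl, le_rfl, fun _ _ => rfl, fun _ _ => rfl, le_rfl, fun _ _ => rfl, ?_, rfl,
      hinv⟩, rfl⟩
    simp only [Ok] at hok; simp [Op.exec, hok, Function.update_of_ne ht]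
  case setSnapshot t'' p =>
    refine ⟨⟨rfl, le_rfl, fun _ _ => rfl, fun _ _ => rfl, le_rfl, fun _ _ => rfl, rfl, ?_,
      hinv⟩, rfl⟩
    simp only [Ok] at hok; simp [Op.exec, hok.1, Function.update_of_ne ht]
  all_goals exact ⟨⟨rfl, le_rfl, fun _ _ => rfl, fun _ _ => rfl, le_rfl, fun _ _ => rfl, rfl, rfl,
      hinv⟩, rfl⟩

/-! ## Programs as a monad -/

theorem Prog.bind_ret {α : Type} (p : Prog K T α) : p.bind .ret = p := by
  induction p with
  | ret a => rfl
  | act o next ih => simp only [Prog.bind, ih]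
  | loop body s next _ ih => simp only [Prog.bind, ih]

theorem Prog.bind_assoc {α β γ : Type} (p : Prog K T α) (f : α → Prog K T β) (g : β → Prog K T γ) :
    (p.bind f).bind g = p.bind fun a => (f a).bind g := by
  induction p with
  | ret a => rfl
  | act o next ih => simp only [Prog.bind, ih]
  | loop body s next _ ih => simp only [Prog.bind, ih]

instance : LawfulMonad (Prog K T) := LawfulMonad.mk'
  (id_map := fun x => Prog.bind_ret x)
  (pure_bind := fun _ _ => rfl)
  (bind_assoc := fun x f g => Prog.bind_assoc x f g)

/-- What a loop does after a round. -/
def unroll {α σ β : Type} (body : σ → Prog K T (σ ⊕ β)) (next : β → Prog K T α) :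
    σ ⊕ β → Prog K T α
  | .inl s => .loop body s next
  | .inr b => next b

theorem unroll_eq {α σ β : Type} (body : σ → Prog K T (σ ⊕ β)) (next : β → Prog K T α) :
    unroll body next = fun r => match r with
      | .inl s => .loop body s next
      | .inr b => next b := by
  funext r; cases r <;> rfl

/-- Opening a loop commutes with appending a continuation. This is the loop case of every
composition argument. -/
theorem unroll_bind {α γ σ β : Type} (body : σ → Prog K T (σ ⊕ β)) (next : β → Prog K T α)
    (f : α → Prog K T γ) (s : σ) :
    ((body s).bind (unroll body next)).bind f =
      (body s).bind (unroll body fun b => (next b).bind f) := by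
  rw [Prog.bind_assoc]; congr 1; funext r; cases r <;> rfl

/-! ## Predicates on programs -/

/-- One step of thread `t`, at whatever time it is scheduled, is permitted and leads to `W`; upon
return, `Q` holds. -/
def Step (t : Fin T) {α : Type} (Q : α → St K T → Prop) (W : Prog K T α → St K T → Prop) :
    Prog K T α → St K T → Prop
  | .ret a, s => ∀ s', Ext t s s' → Q a s'
  | .act o next, s => ∀ s', Ext t s s' → Ok t s' o ∧
      ∀ rnd v, W (next (o.exec rnd v s'.mem).1) (s'.after rnd v o)
  | .loop body s₀ next, s => W ((body s₀).bind (unroll body next)) s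

/-- All operations of the program are permitted, and if it returns then `Q` holds. -/
def Safe (t : Fin T) {α : Type} (Q : α → St K T → Prop) (p : Prog K T α) (s : St K T) : Prop :=
  ∃ R : Prog K T α → St K T → Prop, (∀ p s, R p s → Step t Q R p s) ∧ R p s

/-- All operations of the program are permitted, and it returns, with `Q`. -/
def Ter (t : Fin T) {α : Type} (Q : α → St K T → Prop) (p : Prog K T α) (s : St K T) : Prop :=
  ∀ R : Prog K T α → St K T → Prop, (∀ p s, Step t Q R p s → R p s) → R p s

/-- All operations of the program are permitted, and after at most `n` steps, `Q` holds and the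
program is about to return. -/
def Bnd (t : Fin T) {α : Type} (Q : α → St K T → Prop) : ℕ → Prog K T α → St K T → Prop
  | 0 => Step t Q fun _ _ => False
  | n + 1 => Step t Q (Bnd t Q n)

variable {t : Fin T} {α β σ : Type} {Q Q' : α → St K T → Prop}

theorem Step.mono {W W' : Prog K T α → St K T → Prop} (hQ : ∀ a s, Q a s → Q' a s)
    (hW : ∀ p s, W p s → W' p s) {p : Prog K T α} {s : St K T} (h : Step t Q W p s) :
    Step t Q' W' p s := by
  cases p with
  | ret a => exact fun s' E => hQ _ _ (h s' E)
  | act o next => exact fun s' E => ⟨(h s' E).1, fun rnd v => hW _ _ ((h s' E).2 rnd v)⟩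
  | loop body s₀ next => exact hW _ _ h

/-- Returns and operations are already quantified over all environment delays, so transitivity of
`Ext` suffices for them. Opening a loop does not touch memory and is not quantified; only there must
the delay be passed on to the successor, by `hE`. -/
theorem Step.ext {W W' : Prog K T α → St K T → Prop} {p : Prog K T α} {s s' : St K T}
    (hW : ∀ p s, W p s → W' p s) (hE : ∀ p s s', W p s → Ext t s s' → W' p s')
    (h : Step t Q W p s) (E : Ext t s s') :
    Step t Q W' p s' := by
  cases p with
  | ret a => exact fun s'' E' => h s'' (E.trans E')
  | act o next =>
    exact fun s'' E' => ⟨(h s'' (E.trans E')).1, fun r v => hW _ _ ((h s'' (E.trans E')).2 r v)⟩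
  | loop body s₀ next => exact hE _ _ _ h E

/-- `Safe` is the greatest fixed point of `Step t Q` and `Ter` the least one; the fold and unfold
lemmas are the two halves of Knaster–Tarski for each. -/
theorem Safe.unfold {p : Prog K T α} {s : St K T} (h : Safe t Q p s) :
    Step t Q (Safe t Q) p s := by
  obtain ⟨R, hR, h⟩ := h
  exact (hR p s h).mono (fun _ _ => id) fun p s h => ⟨R, hR, h⟩

theorem Safe.fold {p : Prog K T α} {s : St K T} (h : Step t Q (Safe t Q) p s) : Safe t Q p s :=
  ⟨Step t Q (Safe t Q), fun _ _ h => h.mono (fun _ _ => id) fun _ _ h => h.unfold, h⟩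

theorem Ter.fold {p : Prog K T α} {s : St K T} (h : Step t Q (Ter t Q) p s) : Ter t Q p s :=
  fun R hR => hR p s (h.mono (fun _ _ => id) fun _ _ h => h R hR)

theorem Ter.unfold {p : Prog K T α} {s : St K T} (h : Ter t Q p s) : Step t Q (Ter t Q) p s :=
  h _ fun _ _ h => h.mono (fun _ _ => id) fun _ _ h => Ter.fold h

theorem Bnd.fold {n : ℕ} {p : Prog K T α} {s : St K T} (h : Step t Q (Bnd t Q n) p s) :
    Bnd t Q (n + 1) p s := h

theorem Ter.safe {p : Prog K T α} {s : St K T} (h : Ter t Q p s) : Safe t Q p s :=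
  ⟨Ter t Q, fun _ _ h => h.unfold, h⟩

theorem Bnd.ter {n : ℕ} {p : Prog K T α} {s : St K T} (h : Bnd t Q n p s) : Ter t Q p s := by
  induction n generalizing p s with
  | zero => exact Ter.fold (h.mono (fun _ _ => id) fun _ _ h => h.elim)
  | succ n ih => exact Ter.fold (Step.mono (fun _ _ => id) (fun _ _ h => ih h) h)

theorem Safe.mono {p : Prog K T α} {s : St K T} (h : Safe t Q p s)
    (hQ : ∀ a s, Q a s → Q' a s) : Safe t Q' p s := by
  obtain ⟨R, hR, h⟩ := h
  exact ⟨R, fun p s h => (hR p s h).mono hQ fun _ _ => id, h⟩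

theorem Ter.mono {p : Prog K T α} {s : St K T} (h : Ter t Q p s)
    (hQ : ∀ a s, Q a s → Q' a s) : Ter t Q' p s :=
  fun R hR => h R fun p s h => hR p s (h.mono hQ fun _ _ => id)

theorem Bnd.mono {n m : ℕ} {p : Prog K T α} {s : St K T} (h : Bnd t Q n p s) (hn : n ≤ m)
    (hQ : ∀ a s, Q a s → Q' a s) : Bnd t Q' m p s := by
  induction n generalizing m p s with
  | zero =>
    cases m with
    | zero => exact Step.mono hQ (fun _ _ => id) h
    | succ m => exact Step.mono hQ (fun _ _ h => h.elim) h
  | succ n ih =>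
    obtain ⟨m, rfl⟩ : ∃ m', m = m' + 1 := ⟨m - 1, by omega⟩
    exact Step.mono hQ (fun _ _ h => ih h (by omega)) h

theorem Safe.ext {p : Prog K T α} {s s' : St K T} (h : Safe t Q p s) (E : Ext t s s') :
    Safe t Q p s' :=
  ⟨fun p s' => ∃ s, Safe t Q p s ∧ Ext t s s', fun _ _ ⟨_, h, E⟩ =>
    h.unfold.ext (fun _ s h => ⟨s, h, Ext.refl t s⟩) (fun _ s _ h E => ⟨s, h, E⟩) E, s, h, E⟩

theorem Ter.ext {p : Prog K T α} {s s' : St K T} (h : Ter t Q p s) (E : Ext t s s') :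
    Ter t Q p s' :=
  h (fun q r => ∀ r', Ext t r r' → Ter t Q q r')
    (fun _ _ h _ E => Ter.fold (h.ext (fun _ s h => h s (Ext.refl t s)) (fun _ _ s' h E => h s' E) E))
    s' E

theorem Bnd.ext {n : ℕ} {p : Prog K T α} {s s' : St K T} (h : Bnd t Q n p s) (E : Ext t s s') :
    Bnd t Q n p s' := by
  induction n generalizing p s s' with
  | zero => exact Step.ext (fun _ _ => id) (fun _ _ _ h _ => h) h E
  | succ n ih => exact Step.ext (fun _ _ => id) (fun _ _ _ h E => ih h E) h E

theorem Ter.pure {a : α} {s : St K T} (h : ∀ s', Ext t s s' → Q a s') :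
    Ter t Q (Pure.pure a) s := Ter.fold h

theorem Safe.pure {a : α} {s : St K T} (h : ∀ s', Ext t s s' → Q a s') :
    Safe t Q (Pure.pure a) s := Safe.fold h

theorem Bnd.pure {n : ℕ} {a : α} {s : St K T} (h : ∀ s', Ext t s s' → Q a s') :
    Bnd t Q n (Pure.pure a) s := by
  cases n <;> exact h

/-! ## Sequential composition -/

variable {P : β → St K T → Prop}

theorem Step.bind {W₁ : Prog K T β → St K T → Prop} {W : Prog K T α → St K T → Prop}
    {f : β → Prog K T α} (hW : ∀ p s, W₁ p s → W (p.bind f) s)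
    (hf : ∀ a s, P a s → Step t Q W (f a) s) {p : Prog K T β} {s : St K T}
    (h : Step t P W₁ p s) : Step t Q W (p.bind f) s := by
  cases p with
  | ret a => exact hf a s (h s (Ext.refl t s))
  | act o next => exact fun s' E => ⟨(h s' E).1, fun rnd v => hW _ _ ((h s' E).2 rnd v)⟩
  | loop body s₀ next =>
    have := hW _ _ h
    rwa [unroll_bind] at this

theorem Ter.bind {p : Prog K T β} {s : St K T} {f : β → Prog K T α} (h : Ter t P p s)
    (hf : ∀ a s', P a s' → Ter t Q (f a) s') : Ter t Q (p >>= f) s :=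
  h (fun p s => Ter t Q (p.bind f) s)
    fun _ _ h => Ter.fold (h.bind (fun _ _ h => h) fun a s h => (hf a s h).unfold)

theorem Safe.bind {p : Prog K T β} {s : St K T} {f : β → Prog K T α} (h : Safe t P p s)
    (hf : ∀ a s', P a s' → Safe t Q (f a) s') : Safe t Q (p >>= f) s := by
  refine ⟨fun p s => Safe t Q p s ∨ ∃ p₀, p = p₀.bind f ∧ Safe t P p₀ s, ?_, .inr ⟨p, rfl, h⟩⟩
  rintro p s (h | ⟨p₀, rfl, h⟩)
  · exact h.unfold.mono (fun _ _ => id) fun _ _ => .inl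
  · exact h.unfold.bind (fun p s h => .inr ⟨p, rfl, h⟩) fun a s h =>
      (hf a s h).unfold.mono (fun _ _ => id) fun _ _ => .inl

/-- The bounds simply add up, because the return of the first program is absorbed by `Prog.bind` and
costs no step. -/
theorem Bnd.bind {m n : ℕ} {p : Prog K T β} {s : St K T} {f : β → Prog K T α} (h : Bnd t P m p s)
    (hf : ∀ a s', P a s' → Bnd t Q n (f a) s') : Bnd t Q (m + n) (p >>= f) s := by
  induction m generalizing p s with
  | zero =>
    rw [Nat.zero_add]
    cases n with
    | zero => exact Step.bind (fun _ _ h => h.elim) hf h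
    | succ n => exact Step.bind (fun _ _ h => h.elim) hf h
  | succ m ih =>
    rw [Nat.succ_add]
    exact Step.bind (fun _ _ h => ih h)
      (fun a s h => Bnd.mono (m := m + n + 1) (hf a s h) (by omega) fun _ _ => id) h

/-! ## Loops -/

/-- What a round of a loop with invariant `I` has to achieve. -/
@[reducible] def Round (I : σ → St K T → Prop) (Q : α → St K T → Prop) : σ ⊕ α → St K T → Prop
  | .inl x, s => I x s
  | .inr a, s => Q a s

/-- A returned value may have to wait for the environment, so a postcondition can always be taken
closed under `Ext`. Loops need this: the exit value of a round becomes the return value of the loop,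
which must survive a further delay. -/
theorem Step.stable {W : Prog K T α → St K T → Prop} {p : Prog K T α} {s : St K T}
    (h : Step t Q W p s) : Step t (fun a s => ∀ s', Ext t s s' → Q a s') W p s := by
  cases p with
  | ret a => exact fun s' E s'' E' => h s'' (E.trans E')
  | act o next => exact h
  | loop body s₀ next => exact h

theorem Ter.stable {p : Prog K T α} {s : St K T} (h : Ter t Q p s) :
    Ter t (fun a s => ∀ s', Ext t s s' → Q a s') p s :=
  fun R hR => h R fun p s h => hR p s h.stable

theorem Safe.stable {p : Prog K T α} {s : St K T} (h : Safe t Q p s) :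
    Safe t (fun a s => ∀ s', Ext t s s' → Q a s') p s := by
  obtain ⟨R, hR, h⟩ := h
  exact ⟨R, fun p s h => (hR p s h).stable, h⟩

theorem Bnd.stable {n : ℕ} {p : Prog K T α} {s : St K T} (h : Bnd t Q n p s) :
    Bnd t (fun a s => ∀ s', Ext t s s' → Q a s') n p s := by
  induction n generalizing p s with
  | zero => exact Step.stable h
  | succ n ih => exact Step.mono (fun _ _ => id) (fun _ _ h => ih h) (Step.stable h)

/-- Coinduction: the witness relation consists of the loop heads where `I` holds and of the
partially executed rounds. No variant is needed. -/
theorem Safe.iter {body : σ → Prog K T (σ ⊕ α)} (I : σ → St K T → Prop)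
    (hb : ∀ x s, I x s → Safe t (Round I Q) (body x) s) {x : σ} {s : St K T} (h : I x s) :
    Safe t Q (KLSM.iter x body) s := by
  refine ⟨fun p s => (∃ x, p = KLSM.iter x body ∧ I x s) ∨
    (∃ p₀, p = p₀.bind (unroll body .ret) ∧
      Safe t (fun r s => ∀ s', Ext t s s' → Round I Q r s') p₀ s), ?_, .inl ⟨x, rfl, h⟩⟩
  rintro p s (⟨x, rfl, h⟩ | ⟨p₀, rfl, h⟩)
  · exact .inr ⟨body x, rfl, (hb x s h).stable⟩
  · refine h.unfold.bind (fun p s h => .inr ⟨p, rfl, h⟩) ?_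
    rintro (x | a) s h
    · exact .inr ⟨body x, rfl, (hb x s (h s (Ext.refl t s))).stable⟩
    · exact h

theorem Ter.iter {body : σ → Prog K T (σ ⊕ α)} (I : ℕ → σ → St K T → Prop)
    (hb : ∀ j x s, I j x s → Ter t (Round (fun x s => ∃ i < j, I i x s) Q) (body x) s)
    {j : ℕ} {x : σ} {s : St K T} (h : I j x s) : Ter t Q (KLSM.iter x body) s := by
  induction j using Nat.strong_induction_on generalizing x s with
  | _ j ih =>
    refine Ter.fold (Ter.bind (hb j x s h).stable ?_)
    rintro (x | a) s h
    · obtain ⟨i, hi, h⟩ := h s (Ext.refl t s)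
      exact ih i hi h
    · exact Ter.pure h

/-- The index `j` is a strictly decreasing variant, so there are at most `j + 1` rounds, each with
`n` steps and one more for opening the round. -/
theorem Bnd.iter {n : ℕ} {body : σ → Prog K T (σ ⊕ α)} (I : ℕ → σ → St K T → Prop)
    (hb : ∀ j x s, I j x s → Bnd t (Round (fun x s => ∃ i < j, I i x s) Q) n (body x) s)
    {j : ℕ} {x : σ} {s : St K T} (h : I j x s) :
    Bnd t Q ((n + 1) * (j + 1)) (KLSM.iter x body) s := by
  induction j using Nat.strong_induction_on generalizing x s with
  | _ j ih =>
    rw [show (n + 1) * (j + 1) = n + (n + 1) * j + 1 by ring]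
    refine Bnd.fold (Bnd.bind (hb j x s h).stable ?_)
    rintro (x | a) s h
    · obtain ⟨i, hi, h⟩ := h s (Ext.refl t s)
      exact (ih i hi h).mono (Nat.mul_le_mul_left _ hi) fun _ _ => id
    · exact Bnd.pure h

/-! ## Operations -/

variable {W : Prog K T α → St K T → Prop} {s : St K T}

theorem Step.newItem {key : K} {f : Item K → Prog K T α}
    (h : ∀ s', Ext t s s' → ∀ it, W (f it) s') : Step t Q W ((Op.newItem key).call >>= f) s :=
  fun s' E => ⟨trivial, fun rnd v => h (s'.after rnd v (Op.newItem key)) (E.trans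
    ⟨⟨rfl, le_rfl, fun _ _ => rfl, fun _ _ => rfl, le_rfl, fun _ _ => rfl, rfl, rfl,
      fun h => h.after (t := t) (s := s') (o := Op.newItem key) trivial rnd v⟩, rfl⟩) _⟩

theorem Step.flag {it : Item K} {f : Bool → Prog K T α}
    (h : ∀ s', Ext t s s' → ∀ d, W (f d) s') : Step t Q W ((Op.flag it).call >>= f) s :=
  fun s' E => ⟨trivial, fun _ _ => h s' E _⟩

theorem Step.testAndSet {it : Item K} {f : Bool → Prog K T α}
    (h : ∀ s', Ext t s s' → ∀ d, W (f d) s') : Step t Q W ((Op.testAndSet it).call >>= f) s :=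
  fun s' E => ⟨trivial, fun rnd v => h (s'.after rnd v (Op.testAndSet it)) (E.trans
    ⟨⟨rfl, le_rfl, fun _ _ => rfl, fun _ _ => rfl, le_rfl, fun _ _ => rfl, rfl, rfl,
      fun h => h.after (t := t) (s := s') (o := Op.testAndSet it) trivial rnd v⟩, rfl⟩) _⟩

theorem Step.newBlock {l : ℕ} {is : List (Item K)} {f : ℕ → Prog K T α}
    (h : ∀ s', Ext t s s' → ∀ b < s'.mem.nextBlock, (s'.mem.block b).level = l →
      (s'.mem.block b).items = is → W (f b) s') :
    Step t Q W ((Op.newBlock l is).call >>= f) s :=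
  fun s' E => ⟨trivial, fun rnd v => h (s'.after rnd v (Op.newBlock l is)) (E.trans
    ⟨⟨rfl, Nat.le_succ _,
      fun _ hb => congrArg Block.items (Function.update_of_ne (Nat.ne_of_lt hb) _ s'.mem.block),
      fun _ hb => congrArg Block.level (Function.update_of_ne (Nat.ne_of_lt hb) _ s'.mem.block),
      le_rfl, fun _ _ => rfl, rfl, rfl,
      fun h => h.after (t := t) (s := s') (o := Op.newBlock l is) trivial rnd v⟩, rfl⟩) _
    (Nat.lt_succ_self _) (congrArg Block.level (Function.update_self _ _ s'.mem.block))
    (congrArg Block.items (Function.update_self _ _ s'.mem.block))⟩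

theorem Step.level {b : ℕ} {f : ℕ → Prog K T α}
    (h : ∀ s', Ext t s s' → W (f (s'.mem.block b).level) s') :
    Step t Q W ((Op.level b).call >>= f) s :=
  fun s' E => ⟨trivial, fun _ _ => h s' E⟩

theorem Step.filled {b : ℕ} {f : ℕ → Prog K T α}
    (h : ∀ s', Ext t s s' → W (f (s'.mem.block b).filled) s') :
    Step t Q W ((Op.filled b).call >>= f) s :=
  fun s' E => ⟨trivial, fun _ _ => h s' E⟩

theorem Step.setFilled {b n : ℕ} {f : Unit → Prog K T α}
    (hn : ∀ s', Ext t s s' → n ≤ (s'.mem.block b).items.length)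
    (h : ∀ s', Ext t s s' → W (f ()) s') : Step t Q W ((Op.setFilled b n).call >>= f) s :=
  fun s' E => ⟨hn s' E, fun rnd v => h (s'.after rnd v (Op.setFilled b n)) (E.trans
    ⟨⟨rfl, le_rfl,
      fun b' _ => by by_cases h : b' = b <;> simp [St.after, Op.exec, h],
      fun b' _ => by by_cases h : b' = b <;> simp [St.after, Op.exec, h],
      le_rfl, fun _ _ => rfl, rfl, rfl,
      fun h => h.after (t := t) (s := s') (o := Op.setFilled b n) (hn s' E) rnd v⟩, rfl⟩)⟩

theorem Step.item {b i : ℕ} {f : Option (Item K) → Prog K T α}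
    (h : ∀ s', Ext t s s' → ∀ it, W (f it) s') : Step t Q W ((Op.item b i).call >>= f) s :=
  fun s' E => ⟨trivial, fun _ _ => h s' E _⟩

theorem Step.distSize {t' : Fin T} {f : ℕ → Prog K T α}
    (h : ∀ s', Ext t s s' → W (f (s'.mem.dist t').size) s') :
    Step t Q W ((Op.distSize t').call >>= f) s :=
  fun s' E => ⟨trivial, fun _ _ => h s' E⟩

/-- A write to the thread's own DistLSM is not an `Ext` step, so only `Grow` is handed on. -/
theorem Step.setDistSize {n : ℕ} {f : Unit → Prog K T α}
    (h : ∀ s', Grow t s s' → W (f ()) s') : Step t Q W ((Op.setDistSize t n).call >>= f) s :=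
  fun s' E => ⟨rfl, fun rnd v => h (s'.after rnd v (Op.setDistSize t n)) (E.toGrow.trans
    ⟨rfl, le_rfl, fun _ _ => rfl, fun _ _ => rfl, le_rfl, fun _ _ => rfl, rfl, rfl,
      fun h => h.after (t := t) (s := s') (o := Op.setDistSize t n) rfl rnd v⟩)⟩

theorem Step.distBlock {t' : Fin T} {i : ℕ} {f : Option ℕ → Prog K T α}
    (h : ∀ s', Ext t s s' → W (f ((s'.mem.dist t').blocks i)) s') :
    Step t Q W ((Op.distBlock t' i).call >>= f) s :=
  fun s' E => ⟨trivial, fun _ _ => h s' E⟩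

theorem Step.setDistBlock {i b : ℕ} {f : Unit → Prog K T α} (hb : b < s.mem.nextBlock)
    (h : ∀ s', Grow t s s' → W (f ()) s') : Step t Q W ((Op.setDistBlock t i b).call >>= f) s :=
  fun s' E => ⟨⟨rfl, hb.trans_le E.nb⟩, fun rnd v => h (s'.after rnd v (Op.setDistBlock t i b)) (E.toGrow.trans
    ⟨rfl, le_rfl, fun _ _ => rfl, fun _ _ => rfl, le_rfl, fun _ _ => rfl, rfl, rfl,
      fun h => h.after (t := t) (s := s') (o := Op.setDistBlock t i b) ⟨rfl, hb.trans_le E.nb⟩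
        rnd v⟩)⟩

theorem Step.newArray {a : BlockArray} {f : ℕ → Prog K T α} (ha : ∀ x ∈ a, x.1 < s.mem.nextBlock)
    (h : ∀ s', Ext t s s' → ∀ p < s'.mem.nextArray, s'.mem.array p = a → W (f p) s') :
    Step t Q W ((Op.newArray a).call >>= f) s :=
  fun s' E => have ha' : ∀ x ∈ a, x.1 < s'.mem.nextBlock := fun x hx => (ha x hx).trans_le E.nb
  ⟨ha', fun rnd v => h (s'.after rnd v (Op.newArray a)) (E.trans
    ⟨⟨rfl, le_rfl, fun _ _ => rfl, fun _ _ => rfl, Nat.le_succ _,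
      fun _ hp => Function.update_of_ne (Nat.ne_of_lt hp) _ s'.mem.array, rfl, rfl,
      fun h => h.after (t := t) (s := s') (o := Op.newArray a) ha' rnd v⟩, rfl⟩) _
    (Nat.lt_succ_self _) (Function.update_self _ _ s'.mem.array)⟩

theorem Step.loadArray {p : ℕ} {f : BlockArray → Prog K T α}
    (h : ∀ s', Ext t s s' → W (f (s'.mem.array p)) s') :
    Step t Q W ((Op.loadArray p).call >>= f) s :=
  fun s' E => ⟨trivial, fun _ _ => h s' E⟩

theorem Step.observed {t' : Fin T} {f : Option ℕ → Prog K T α}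
    (h : ∀ s', Ext t s s' → W (f (s'.mem.observed t')) s') :
    Step t Q W ((Op.observed t').call >>= f) s :=
  fun s' E => ⟨trivial, fun _ _ => h s' E⟩

theorem Step.snapshot {t' : Fin T} {f : Option BlockArray → Prog K T α}
    (h : ∀ s', Ext t s s' → W (f (s'.mem.snapshot t')) s') :
    Step t Q W ((Op.snapshot t').call >>= f) s :=
  fun s' E => ⟨trivial, fun _ _ => h s' E⟩

theorem Step.rand {n : ℕ} {f : ℕ → Prog K T α}
    (h : ∀ s', Ext t s s' → ∀ r, W (f r) s') : Step t Q W ((Op.rand n).call >>= f) s :=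
  fun s' E => ⟨trivial, fun _ _ => h s' E _⟩

theorem Step.randThread {f : Fin T → Prog K T α}
    (h : ∀ s', Ext t s s' → ∀ v, W (f v) s') : Step t Q W (Op.randThread.call >>= f) s :=
  fun s' E => ⟨trivial, fun _ _ => h s' E _⟩

end Logic

/-! ### Step bounds for building, copying and merging blocks -/

section Routines

variable {K : Type} {T : ℕ} {t : Fin T}

theorem append_bnd (acc : List (Item K)) (it : Item K) (s : St K T) :
    Bnd t (fun r s' => Ext t s s' ∧ r.length ≤ acc.length + 1) 1 (append acc it) s := by
  unfold append
  refine Bnd.fold (Step.flag fun s₁ E₁ d => Bnd.pure fun s₂ E₂ => ⟨E₁.trans E₂, ?_⟩)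
  split <;> simp

theorem appendFrom_bnd (acc : List (Item K)) (b i : ℕ) (s : St K T) :
    Bnd t (fun r s' => Ext t s s' ∧ r.length ≤ acc.length + 1) 2 (appendFrom acc b i) s := by
  unfold appendFrom
  refine Bnd.fold (Step.item fun s₁ E₁ it => ?_)
  cases it with
  | none => exact Bnd.pure fun s₂ E₂ => ⟨E₁.trans E₂, by omega⟩
  | some it => exact (append_bnd acc it s₁).mono le_rfl fun r s' h => ⟨E₁.trans h.1, h.2⟩

theorem newBlock_bnd (l : ℕ) (is : List (Item K)) (s : St K T) :
    Bnd t (fun r s' => Ext t s s' ∧ r < s'.mem.nextBlock ∧ (s'.mem.block r).level = l ∧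
      (s'.mem.block r).items = is) 1 (Op.newBlock l is).call s := by
  rw [← bind_pure (Op.newBlock l is).call]
  refine Bnd.fold (Step.newBlock fun s₁ E₁ b hb hl hi => Bnd.pure fun s₂ E₂ => ?_)
  exact ⟨E₁.trans E₂, hb.trans_le E₂.nb, (E₂.level b hb).trans hl, (E₂.items b hb).trans hi⟩

/-- Block `b` is allocated, has level `l`, and its array has at most `n` entries. -/
structure IsBlock (b l n : ℕ) (s : St K T) : Prop where
  lt : b < s.mem.nextBlock
  level : (s.mem.block b).level = l
  length : (s.mem.block b).items.length ≤ n

theorem IsBlock.grow {b l n : ℕ} {s s' : St K T} (h : IsBlock b l n s) (E : Grow t s s') :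
    IsBlock b l n s' :=
  ⟨h.lt.trans_le E.nb, (E.level b h.lt).trans h.level, (E.items b h.lt).symm ▸ h.length⟩

theorem IsBlock.mono {b l n m : ℕ} {s : St K T} (h : IsBlock b l n s) (hm : n ≤ m) :
    IsBlock b l m s := ⟨h.lt, h.level, h.length.trans hm⟩

theorem IsBlock.filled {b l n : ℕ} {s : St K T} (h : IsBlock b l n s) (G : GI s.mem) :
    (s.mem.block b).filled ≤ n := (G.filled b).trans h.length

/-- `filled` is read anew in every round and other threads may change it meanwhile, but it never
exceeds the length of the immutable item array. The capacity `m` therefore bounds the rounds, and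
`N` depends on `n` alone. -/
theorem copy_bnd (n : ℕ) : ∃ N, ∀ m ≤ n, ∀ (b l' l : ℕ) (s : St K T), GI s.mem →
    IsBlock b l' m s →
    Bnd t (fun r s' => Ext t s s' ∧ IsBlock r l m s') N (copy b l) s := by
  refine ⟨4 * (n + 1) + 1, fun m hm b l' l s G hb => ?_⟩
  unfold copy
  refine Bnd.mono (n := 4 * (m + 1) + 1) ?_ (by omega) fun _ _ => id
  refine Bnd.bind (P := fun r s' => Ext t s s' ∧ r.length ≤ m) (Bnd.iter (n := 3)
    (fun j x s' => Ext t s s' ∧ x.2.length ≤ x.1 ∧ x.1 + j = m) ?_ (j := m)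
    ⟨Ext.refl t s, le_rfl, Nat.zero_add m⟩) ?_
  · rintro j ⟨i, acc⟩ s₁ ⟨E₁, h₁, h₂⟩
    dsimp only at h₁ h₂ ⊢
    refine Bnd.fold (Step.filled fun s₂ E₂ => ?_)
    have E := E₁.trans E₂
    split
    · have := (hb.grow E.toGrow).filled (E.inv G)
      refine (appendFrom_bnd acc b i s₂).bind fun r s₃ h => Bnd.pure (n := 0) fun s₄ E₄ => ?_
      exact ⟨j - 1, by omega, (E.trans h.1).trans E₄, by dsimp only; omega, by dsimp only; omega⟩
    · exact Bnd.pure fun s₃ E₃ => ⟨E.trans E₃, by omega⟩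
  · rintro r s₁ ⟨E₁, h₁⟩
    exact (newBlock_bnd l r s₁).mono le_rfl fun _ _ h =>
      ⟨E₁.trans h.1, h.2.1, h.2.2.1, h.2.2.2 ▸ h₁⟩

theorem mergeIn_bnd [LinearOrder K] (n : ℕ) : ∃ N, ∀ n₁ n₂, n₁ + n₂ ≤ n →
    ∀ (b₁ b₂ l₁ l₂ l : ℕ) (s : St K T), GI s.mem → IsBlock b₁ l₁ n₁ s → IsBlock b₂ l₂ n₂ s →
    Bnd t (fun r s' => Ext t s s' ∧ IsBlock r l (n₁ + n₂) s') N (mergeIn b₁ b₂ l) s := by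
  -- A round costs at most three operations (two item reads and a flag read) and its opening. The
  -- three extra steps are the two reads of `filled` and the allocation.
  refine ⟨4 * (n + 1) + 1 + 1 + 1, fun n₁ n₂ hn b₁ b₂ l₁ l₂ l s G hb₁ hb₂ => ?_⟩
  unfold mergeIn
  refine Bnd.mono (n := 4 * (n₁ + n₂ + 1) + 1 + 1 + 1) ?_ (by omega) fun _ _ => id
  refine Bnd.fold (Step.filled fun s₁ E₁ => Bnd.fold (Step.filled fun s₂ E₂ => ?_))
  have hf₁ := (hb₁.grow E₁.toGrow).filled (E₁.inv G)
  have hf₂ := (hb₂.grow (E₁.trans E₂).toGrow).filled ((E₁.trans E₂).inv G)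
  generalize (s₁.mem.block b₁).filled = f₁ at hf₁ ⊢
  generalize (s₂.mem.block b₂).filled = f₂ at hf₂ ⊢
  have E₀ := E₁.trans E₂
  -- The variant `j` dominates the number of entries not yet visited, and each visited entry adds at
  -- most one item to the result.
  let I : ℕ → ℕ × ℕ × List (Item K) → St K T → Prop := fun j x s' =>
    Ext t s s' ∧ x.2.2.length ≤ x.1 + x.2.1 ∧ x.1 + x.2.1 + j ≤ n₁ + n₂ ∧
      x.1 ≤ f₁ ∧ x.2.1 ≤ f₂ ∧ (f₁ - x.1) + (f₂ - x.2.1) ≤ j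
  refine Bnd.bind (P := fun r s' => Ext t s s' ∧ r.length ≤ n₁ + n₂) (Bnd.iter (n := 3)
I ?_ (j := n₁ + n₂)
    ⟨E₀, by simp, by simp, by simp, by simp, by simp; omega⟩) ?_
  · rintro j' ⟨i, j, acc⟩ s₃ ⟨E₃, h⟩
    dsimp only at h ⊢
    have fin : ∀ (r : List (Item K)) (i' j₁ : ℕ) (s₄ s₅ : St K T), Ext t s s₄ → Ext t s₄ s₅ →
        r.length ≤ acc.length + 1 → i' + j₁ = i + j + 1 → i' ≤ f₁ → j₁ ≤ f₂ →
        ∃ i < j', I i (i', j₁, r) s₅ := by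
      intro r i' j₁ s₄ s₅ E₄ E₅ hr hij hi hj
      exact ⟨j' - 1, by omega, E₄.trans E₅, by dsimp only; omega⟩
    split
    · split
      · refine Bnd.fold (Step.item fun s₄ E₄ it₁ => Bnd.fold (Step.item fun s₅ E₅ it₂ => ?_))
        have E := (E₃.trans E₄).trans E₅
        rcases it₁ with _ | x
        · exact Bnd.pure fun s₆ E₆ => fin _ _ _ _ _ E E₆ (by omega) (by omega) (by omega) (by omega)
        rcases it₂ with _ | y
        · exact Bnd.pure fun s₆ E₆ => fin _ _ _ _ _ E E₆ (by omega) (by omega) (by omega) (by omega)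
        dsimp only
        split
        · refine (append_bnd acc x s₅).bind fun r s₆ h => Bnd.pure (n := 0) fun s₇ E₇ => ?_
          exact fin _ _ _ _ _ (E.trans h.1) E₇ h.2 (by omega) (by omega) (by omega)
        · refine (append_bnd acc y s₅).bind fun r s₆ h => Bnd.pure (n := 0) fun s₇ E₇ => ?_
          exact fin _ _ _ _ _ (E.trans h.1) E₇ h.2 (by omega) (by omega) (by omega)
      · refine (appendFrom_bnd acc b₁ i s₃).bind fun r s₆ h => Bnd.pure (n := 1) fun s₇ E₇ => ?_
        exact fin _ _ _ _ _ (E₃.trans h.1) E₇ h.2 (by omega) (by omega) (by omega)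
    · split
      · refine (appendFrom_bnd acc b₂ j s₃).bind fun r s₆ h => Bnd.pure (n := 1) fun s₇ E₇ => ?_
        exact fin _ _ _ _ _ (E₃.trans h.1) E₇ h.2 (by omega) (by omega) (by omega)
      · exact Bnd.pure fun s₄ E₄ => ⟨E₃.trans E₄, by omega⟩
  · rintro r s₁ ⟨E₁, h₁⟩
    exact (newBlock_bnd l r s₁).mono le_rfl fun _ _ h =>
      ⟨E₁.trans h.1, h.2.1, h.2.2.1, h.2.2.2 ▸ h₁⟩

end Routines

/-! ### Shrinking, consolidating and inserting into block arrays -/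

section Routines

variable {K : Type} {T : ℕ} {t : Fin T}

/-- The level is the variant of the outer loop, since it goes on only with a copy of strictly
smaller level. Neither level nor capacity bound gets worse, which keeps repeated merging and
shrinking bounded in `insertLocal_bnd`. -/
theorem shrink_bnd (n L : ℕ) : ∃ N, ∀ m ≤ n, ∀ (b l : ℕ) (s : St K T), GI s.mem →
    IsBlock b l m s → l ≤ L →
    Bnd t (fun r s' => Ext t s s' ∧ ∃ l' ≤ l, IsBlock r l' m s') N (shrink b) s := by
  obtain ⟨N, hN⟩ := copy_bnd (K := K) (t := t) n
  refine ⟨(3 * (n + 1) + (N + 1 + 1) + 1 + 1) * (L + 1), fun m hm b L' s G hb hl => ?_⟩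
  unfold shrink
  refine (Bnd.iter (fun j b s' => Ext t s s' ∧ IsBlock b j m s' ∧ j ≤ L') ?_
    ⟨Ext.refl t s, hb, le_rfl⟩).mono (Nat.mul_le_mul_left _ (Nat.succ_le_succ hl)) fun _ _ => id
  clear hb b
  rintro l b s₁ ⟨E₁, hb, le_rfl⟩
  refine Bnd.fold (Step.filled fun s₂ E₂ => ?_)
  replace hb := hb.grow E₂.toGrow
  have E := E₁.trans E₂
  have hf := (E.inv G).filled b
  have hn := hb.length
  generalize (s₂.mem.block b).filled = f₀ at hf ⊢
  refine Bnd.bind (m := 3 * (n + 1))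
    (P := fun f s' => Ext t s₂ s' ∧ f ≤ (s₂.mem.block b).items.length)
    (Bnd.mono (m := 3 * (n + 1)) (Bnd.iter (n := 2)
      (fun j f s' => Ext t s₂ s' ∧ f ≤ (s₂.mem.block b).items.length ∧ f = j) ?_ (j := f₀)
      ⟨Ext.refl t s₂, hf, rfl⟩) (by omega) fun _ _ => id) ?_
  · rintro j f s₃ ⟨E₃, h₁, rfl⟩
    split
    · exact Bnd.pure fun s₄ E₄ => ⟨E₃.trans E₄, Nat.zero_le _⟩
    · refine Bnd.fold (Step.item fun s₄ E₄ it => ?_)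
      cases it with
      | none => exact Bnd.pure fun s₅ E₅ =>
          ⟨f - 1, by omega, (E₃.trans E₄).trans E₅, by omega, rfl⟩
      | some it =>
        refine Bnd.fold (Step.flag fun s₅ E₅ d => ?_)
        refine Bnd.pure fun s₆ E₆ => ?_
        split
        · exact ⟨f - 1, by omega, ((E₃.trans E₄).trans E₅).trans E₆, by omega, rfl⟩
        · exact ⟨((E₃.trans E₄).trans E₅).trans E₆, h₁⟩
  · rintro f s₃ ⟨E₃, hf⟩
    refine Bnd.fold (Step.level fun s₄ E₄ => ?_)
    have E' := E₃.trans E₄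
    have hb' := hb.grow E'.toGrow
    rw [hb'.level]
    dsimp only
    split
    · rename_i h
      refine (hN m hm b l _ s₄ ((E.trans E').inv G) hb').bind (n := 1) fun r s₅ h₅ =>
        Bnd.pure fun s₆ E₆ => ?_
      exact ⟨_, h, ((E.trans E').trans h₅.1).trans E₆, h₅.2.grow E₆.toGrow, by omega⟩
    · refine Bnd.fold (Step.setFilled (fun s₅ E₅ => ?_) fun s₅ E₅ => Bnd.pure fun s₆ E₆ => ?_)
      · rwa [(E'.trans E₅).items b hb.lt]
      · have E'' := (E'.trans E₅).trans E₆
        exact ⟨E.trans E'', l, le_rfl, hb.grow E''.toGrow⟩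

theorem IsBlock.of_lt {b : ℕ} {s : St K T} (h : b < s.mem.nextBlock) :
    IsBlock b (s.mem.block b).level (s.mem.block b).items.length s := ⟨h, rfl, le_rfl⟩

/-- For mere termination the bound may depend on the current state, so the block's present level and
array length serve as parameters. -/
theorem shrink_ter {b : ℕ} {s : St K T} (G : GI s.mem) (hb : b < s.mem.nextBlock) :
    Ter t (fun r s' => Ext t s s' ∧ r < s'.mem.nextBlock) (shrink b) s := by
  obtain ⟨N, hN⟩ := shrink_bnd (K := K) (t := t) _ _
  exact (hN _ le_rfl b _ s G (.of_lt hb) le_rfl).ter.mono fun _ _ ⟨h, _, _, h'⟩ => ⟨h, h'.lt⟩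

theorem copy_ter {b l : ℕ} {s : St K T} (G : GI s.mem) (hb : b < s.mem.nextBlock) :
    Ter t (fun r s' => Ext t s s' ∧ r < s'.mem.nextBlock) (copy b l) s := by
  obtain ⟨N, hN⟩ := copy_bnd (K := K) (t := t) _
  exact (hN _ le_rfl b _ l s G (.of_lt hb)).ter.mono fun _ _ ⟨h, h'⟩ => ⟨h, h'.lt⟩

/-- All blocks in a list are allocated. -/
def Alloc (bs : List ℕ) (s : St K T) : Prop := ∀ b ∈ bs, b < s.mem.nextBlock

theorem Alloc.grow {bs : List ℕ} {s s' : St K T} (h : Alloc bs s) (E : Grow t s s') :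
    Alloc bs s' := fun b hb => (h b hb).trans_le E.nb

theorem Alloc.cons {b : ℕ} {bs : List ℕ} {s : St K T} (hb : b < s.mem.nextBlock)
    (h : Alloc bs s) : Alloc (b :: bs) s := List.forall_mem_cons.2 ⟨hb, h⟩

theorem Alloc.head {b : ℕ} {bs : List ℕ} {s : St K T} (h : Alloc (b :: bs) s) :
    b < s.mem.nextBlock := h b List.mem_cons_self

theorem Alloc.tail {b : ℕ} {bs : List ℕ} {s : St K T} (h : Alloc (b :: bs) s) :
    Alloc bs s := fun x hx => h x (List.mem_cons_of_mem _ hx)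

theorem Alloc.nil {s : St K T} : Alloc [] s := fun _ h => absurd h List.not_mem_nil

theorem blockKeys_ter (b : ℕ) (s : St K T) :
    Ter t (fun _ s' => Ext t s s') (blockKeys (K := K) b) s := by
  unfold blockKeys
  refine Ter.fold (Step.filled fun s₁ E₁ => ?_)
  generalize (s₁.mem.block b).filled = f
  refine Ter.iter (fun j x s' => Ext t s s' ∧ f - x.1 = j) ?_ ⟨E₁, rfl⟩
  rintro _ ⟨i, acc⟩ s₂ ⟨E₂, rfl⟩
  dsimp only
  split
  · refine Ter.fold (Step.item fun s₃ E₃ it => ?_)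
    cases it with
    | none => exact Ter.pure fun s₄ E₄ => ⟨_, by omega, (E₂.trans E₃).trans E₄, rfl⟩
    | some it => exact Ter.pure fun s₄ E₄ => ⟨_, by omega, (E₂.trans E₃).trans E₄, rfl⟩
  · exact Ter.pure fun s₃ E₃ => E₂.trans E₃

variable [LinearOrder K]

theorem mergeIn_ter {b₁ b₂ l : ℕ} {s : St K T} (G : GI s.mem) (h₁ : b₁ < s.mem.nextBlock)
    (h₂ : b₂ < s.mem.nextBlock) :
    Ter t (fun r s' => Ext t s s' ∧ r < s'.mem.nextBlock) (mergeIn b₁ b₂ l) s := by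
  obtain ⟨N, hN⟩ := mergeIn_bnd (K := K) (t := t) _
  exact (hN _ _ le_rfl b₁ b₂ _ _ l s G (.of_lt h₁) (.of_lt h₂)).ter.mono fun _ _ ⟨h, h'⟩ => ⟨h, h'.lt⟩

/-- Every merge uses up one successor without creating an additional block. Hence a newly raised
merge flag certifies a strictly shorter list, the source of the decrease of `meas` in `delete_min`.
-/
theorem mergeSuccessors_ter {b : ℕ} {acc : List ℕ} {merged : Bool} {s : St K T} (G : GI s.mem)
    (hb : b < s.mem.nextBlock) (ha : Alloc acc s) :
    Ter t (fun r s' => Ext t s s' ∧ Alloc r.1 s' ∧ r.1.length ≤ acc.length + 1 ∧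
      (r.2 = true → merged = true ∨ r.1.length < acc.length + 1))
      (mergeSuccessors b acc merged) s := by
  unfold mergeSuccessors
  refine Ter.iter (fun j x s' => Ext t s s' ∧ x.1 < s'.mem.nextBlock ∧ Alloc x.2.1 s' ∧
    x.2.1.length = j ∧ j ≤ acc.length ∧ (x.2.2 = true → merged = true ∨ j < acc.length))
    ?_ (j := acc.length) ⟨Ext.refl t s, hb, ha, rfl, le_rfl, .inl⟩
  rintro _ ⟨b, _ | ⟨c, rest⟩, m⟩ s₁ ⟨E₁, hb, ha, rfl, hl, hm⟩
  · exact Ter.pure fun s₂ E₂ => ⟨E₁.trans E₂, Alloc.cons (hb.trans_le E₂.nb) Alloc.nil,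
      by simp, fun h => (hm h).imp id fun h => Nat.succ_lt_succ h⟩
  · dsimp only at *
    refine Ter.fold (Step.level fun s₂ E₂ => Ter.fold (Step.level fun s₃ E₃ => ?_))
    have E := E₂.trans E₃
    split
    · refine (mergeIn_ter ((E₁.trans E).inv G) (hb.trans_le E.nb)
        (ha.head.trans_le E.nb)).bind fun r s₄ ⟨E₄, hr⟩ => ?_
      replace E := E.trans E₄
      refine (shrink_ter ((E₁.trans E).inv G) hr).bind fun r s₅ ⟨E₅, hr⟩ =>
        Ter.pure fun s₆ E₆ => ?_
      replace E := (E.trans E₅).trans E₆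
      exact ⟨rest.length, by simp, E₁.trans E, hr.trans_le E₆.nb, ha.tail.grow E.toGrow, rfl,
        by simp at hl; omega, fun _ => .inr (by simp at hl; omega)⟩
    · exact Ter.pure fun s₄ E₄ => ⟨(E₁.trans E).trans E₄,
        Alloc.cons (hb.trans_le (E.trans E₄).nb) (ha.grow (E.trans E₄).toGrow),
        by simpa using hl, fun h => (hm h).imp id fun h => by simpa using h⟩

theorem consolidateBlocks_ter {bs : List ℕ} {s : St K T} (G : GI s.mem) (ha : Alloc bs s) :
    Ter t (fun r s' => Ext t s s' ∧ Alloc r.1 s' ∧ r.1.length ≤ bs.length ∧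
      (r.2 = true → r.1.length < bs.length)) (consolidateBlocks (K := K) bs) s := by
  unfold consolidateBlocks
  -- The first pass is controlled by the number of blocks still to do plus those already
  -- accumulated: it never grows, and is below `bs.length` once a merge has occurred.
  refine Ter.bind (P := fun r s' => Ext t s s' ∧ Alloc r.1 s' ∧ r.1.length ≤ bs.length ∧
      (r.2 = true → r.1.length < bs.length)) (Ter.iter (fun j x s' => Ext t s s' ∧
    Alloc x.1 s' ∧ Alloc x.2.1 s' ∧ x.1.length = j ∧ j + x.2.1.length ≤ bs.length ∧
    (x.2.2 = true → j + x.2.1.length < bs.length)) ?_ (j := bs.length)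
    ⟨Ext.refl t s, fun b hb => ha b (List.mem_reverse.1 hb), Alloc.nil, by simp, by simp,
      by simp⟩) ?_
  · rintro _ ⟨_ | ⟨b, todo⟩, acc, m⟩ s₁ ⟨E₁, hb, ha, rfl, hl, hm⟩
    · exact Ter.pure fun s₂ E₂ => ⟨E₁.trans E₂, ha.grow E₂.toGrow, by simpa using hl,
        by simpa using hm⟩
    · dsimp only [List.length_cons] at *
      refine (shrink_ter (E₁.inv G) hb.head).bind fun r s₂ ⟨E₂, hr⟩ => ?_
      refine (mergeSuccessors_ter (merged := m) ((E₁.trans E₂).inv G) hr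
        (ha.grow E₂.toGrow)).bind ?_
      rintro ⟨acc', m'⟩ s₃ ⟨E₃, ha', hl', hm'⟩
      refine Ter.pure fun s₄ E₄ => ⟨todo.length, by simp, ((E₁.trans E₂).trans E₃).trans E₄,
        hb.tail.grow ((E₂.trans E₃).trans E₄).toGrow, ha'.grow E₄.toGrow, rfl, ?_, fun h => ?_⟩
      · dsimp only at *; omega
      · dsimp only at *
        rcases hm' h with h | h
        · have := hm h; omega
        · omega
  · rintro ⟨bs', m⟩ s₁ ⟨E₁, ha', hl, hm⟩
    dsimp only at *
    refine Ter.bind (P := fun r s' => Ext t s s' ∧ Alloc r s' ∧ r.length ≤ bs'.length)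
      (Ter.iter (fun j x s' => Ext t s s' ∧ Alloc x.1 s' ∧ Alloc x.2 s' ∧ x.1.length = j ∧
        j + x.2.length ≤ bs'.length) ?_ (j := bs'.length)
        ⟨E₁, ha', Alloc.nil, rfl, by simp⟩) ?_
    · rintro _ ⟨_ | ⟨b, todo⟩, acc⟩ s₂ ⟨E₂, hb, ha, rfl, hl⟩
      · exact Ter.pure fun s₃ E₃ => ⟨E₂.trans E₃, ha.grow E₃.toGrow, by simpa using hl⟩
      · dsimp only [List.length_cons] at *
        refine Ter.fold (Step.filled fun s₃ E₃ => Ter.pure fun s₄ E₄ => ?_)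
        have E := E₃.trans E₄
        refine ⟨todo.length, by simp, E₂.trans E, hb.tail.grow E.toGrow, ?_, rfl, ?_⟩
        · dsimp only
          split
          · exact ha.grow E.toGrow
          · intro x hx
            rcases List.mem_append.1 hx with hx | hx
            · exact ha.grow E.toGrow x hx
            · rw [List.mem_singleton.1 hx]; exact hb.head.trans_le E.nb
        · dsimp only
          split
          · omega
          · rw [List.length_append, List.length_singleton]; omega
    · rintro r s₂ ⟨E₂, hr, hl'⟩
      exact Ter.pure fun s₃ E₃ => ⟨E₂.trans E₃, hr.grow E₃.toGrow, hl'.trans hl,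
        fun h => hl'.trans_lt (hm h)⟩

theorem calculatePivots_ter {k : ℕ} {bs : List ℕ} {s : St K T} (ha : Alloc bs s) :
    Ter t (fun r s' => Ext t s s' ∧ r.length = bs.length ∧ ∀ x ∈ r, x.1 < s'.mem.nextBlock)
      (calculatePivots (K := K) k bs) s := by
  unfold calculatePivots
  refine Ter.bind (P := fun r s' => Ext t s s' ∧ r.length = bs.length ∧
    ∀ x ∈ r, x.1 < s'.mem.nextBlock) (Ter.iter (fun j x s' => Ext t s s' ∧ Alloc x.1 s' ∧
      (∀ y ∈ x.2, y.1 < s'.mem.nextBlock) ∧ x.1.length = j ∧ j + x.2.length = bs.length) ?_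
      (j := bs.length) ⟨Ext.refl t s, ha, by simp, rfl, rfl⟩) ?_
  · rintro _ ⟨_ | ⟨b, todo⟩, acc⟩ s₁ ⟨E₁, hb, ha, rfl, hl⟩
    · exact Ter.pure fun s₂ E₂ => ⟨E₁.trans E₂, by simpa using hl,
        fun y hy => (ha y hy).trans_le E₂.nb⟩
    · dsimp only [List.length_cons] at *
      refine (blockKeys_ter b s₁).bind fun ks s₂ E₂ => Ter.pure fun s₃ E₃ => ?_
      have E := E₂.trans E₃
      refine ⟨todo.length, by simp, E₁.trans E, hb.tail.grow E.toGrow, ?_, rfl, ?_⟩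
      · intro y hy
        rcases List.mem_append.1 hy with hy | hy
        · exact (ha y hy).trans_le E.nb
        · rw [List.mem_singleton.1 hy]; exact hb.head.trans_le E.nb
      · simp; omega
  · rintro bks s₁ ⟨E₁, hl, ha⟩
    refine Ter.fold (Step.rand fun s₂ E₂ r => ?_)
    split
    all_goals
      refine Ter.pure fun s₃ E₃ => ⟨(E₁.trans E₂).trans E₃, by simpa using hl, ?_⟩
      simp only [List.mem_map]
      rintro _ ⟨x, hx, rfl⟩
      exact (ha x hx).trans_le (E₂.trans E₃).nb

/-- Choosing pivots keeps the number of blocks, so the length estimates are those of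
`consolidateBlocks_ter`. -/
theorem consolidate_ter {k : ℕ} {a : BlockArray} {s : St K T} (G : GI s.mem)
    (ha : ∀ x ∈ a, x.1 < s.mem.nextBlock) :
    Ter t (fun r s' => Ext t s s' ∧ (∀ x ∈ r.1, x.1 < s'.mem.nextBlock) ∧
      r.1.length ≤ a.length ∧ (r.2 = true → r.1.length < a.length))
      (consolidate (K := K) k a) s := by
  unfold consolidate
  refine (consolidateBlocks_ter G (bs := a.map Prod.fst) (by simpa [Alloc] using ha)).bind ?_
  rintro ⟨bs, m⟩ s₁ ⟨E₁, h₁, h₂, h₃⟩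
  refine (calculatePivots_ter (k := k) h₁).bind fun r s₂ ⟨E₂, h₄, h₅⟩ => Ter.pure fun s₃ E₃ => ?_
  rw [List.length_map] at h₂ h₃
  exact ⟨(E₁.trans E₂).trans E₃, fun x hx => (h₅ x hx).trans_le E₃.nb, h₄ ▸ h₂, h₄ ▸ h₃⟩

theorem arrayInsert_ter {k b : ℕ} {a : BlockArray} {s : St K T} (G : GI s.mem)
    (ha : ∀ x ∈ a, x.1 < s.mem.nextBlock) (hb : b < s.mem.nextBlock) :
    Ter t (fun r s' => Ext t s s' ∧ ∀ x ∈ r, x.1 < s'.mem.nextBlock)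
      (arrayInsert (K := K) k a b) s := by
  unfold arrayInsert
  refine Ter.fold (Step.level fun s₁ E₁ => ?_)
  refine Ter.bind (P := fun r s' => Ext t s s' ∧ ∀ x ∈ r, x.1 < s.mem.nextBlock)
    (Ter.iter (fun j x s' => Ext t s s' ∧ (∀ y ∈ x.1, y.1 < s.mem.nextBlock) ∧
      (∀ y ∈ x.2, y.1 < s.mem.nextBlock) ∧ x.2.length = j) ?_ ⟨E₁, by simp, ha, rfl⟩) ?_
  · rintro _ ⟨front, _ | ⟨x, rest⟩⟩ s₂ ⟨E₂, h₁, h₂, rfl⟩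
    · refine Ter.pure fun s₃ E₃ => ⟨E₂.trans E₃, ?_⟩
      simp only [List.forall_mem_append, List.forall_mem_cons]
      exact ⟨h₁, hb, by simp⟩
    · dsimp only at *
      rw [List.forall_mem_cons] at h₂
      refine Ter.fold (Step.level fun s₃ E₃ => ?_)
      split
      · refine Ter.pure fun s₄ E₄ => ⟨rest.length, by simp, (E₂.trans E₃).trans E₄, ?_, h₂.2, rfl⟩
        simp only [List.forall_mem_append, List.forall_mem_cons]
        exact ⟨h₁, h₂.1, by simp⟩
      · refine Ter.pure fun s₄ E₄ => ⟨(E₂.trans E₃).trans E₄, ?_⟩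
        simp only [List.forall_mem_append, List.forall_mem_cons]
        exact ⟨h₁, hb, h₂⟩
  · rintro r s₂ ⟨E₂, hr⟩
    refine (consolidate_ter (E₂.inv G) fun x hx => (hr x hx).trans_le E₂.nb).bind ?_
    rintro ⟨r', m⟩ s₃ ⟨E₃, h₃, -⟩
    exact Ter.pure fun s₄ E₄ => ⟨(E₂.trans E₃).trans E₄, fun x hx => (h₃ x hx).trans_le E₄.nb⟩

end Routines

/-! ### Snapshots, compare-and-swap, and the verification of `insert` -/

section SharedRoutines

variable {K : Type} {T : ℕ} {t : Fin T}

/-- Memory evolves monotonically; the local variables of a thread may change. -/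
structure Mono (s s' : St K T) : Prop where
  nb : s.mem.nextBlock ≤ s'.mem.nextBlock
  na : s.mem.nextArray ≤ s'.mem.nextArray
  array : ∀ p < s.mem.nextArray, s'.mem.array p = s.mem.array p
  inv : GI s.mem → GI s'.mem

theorem Mono.refl (s : St K T) : Mono s s := ⟨le_rfl, le_rfl, fun _ _ => rfl, id⟩

theorem Mono.trans {s₁ s₂ s₃ : St K T} (h : Mono s₁ s₂) (h' : Mono s₂ s₃) : Mono s₁ s₃ :=
  ⟨h.nb.trans h'.nb, h.na.trans h'.na,
    fun p hp => (h'.array p (hp.trans_le h.na)).trans (h.array p hp), h'.inv ∘ h.inv⟩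

theorem Grow.mono {s s' : St K T} (h : Grow t s s') : Mono s s' := ⟨h.nb, h.na, h.array, h.inv⟩

/-- The snapshot of thread `t` is not longer than the array that it was copied from. -/
def Loc (t : Fin T) (s : St K T) : Prop :=
  ∀ a, s.mem.snapshot t = some a →
    ∃ p, s.mem.observed t = some p ∧ p < s.mem.nextArray ∧ a.length ≤ (s.mem.array p).length

theorem Loc.grow {s s' : St K T} (h : Loc t s) (E : Grow t s s') : Loc t s' := by
  intro a ha
  obtain ⟨p, hp, hp', hl⟩ := h a (E.snapshot ▸ ha)
  exact ⟨p, E.observed ▸ hp, hp'.trans_le E.na, (E.array p hp').symm ▸ hl⟩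

variable {α : Type} {Q : α → St K T → Prop} {W : Prog K T α → St K T → Prop} {s : St K T}

theorem Step.setObserved {p : Option ℕ} {f : Unit → Prog K T α}
    (h : ∀ s', Mono s s' → s'.ph = s.ph → s'.mem.observed t = p →
      s'.mem.snapshot t = s.mem.snapshot t → W (f ()) s') :
    Step t Q W ((Op.setObserved t p).call >>= f) s :=
  fun s' E => ⟨rfl, fun rnd v => h (s'.after rnd v (Op.setObserved t p)) (E.mono.trans
    ⟨le_rfl, le_rfl, fun _ _ => rfl,
      fun h => h.after (t := t) (s := s') (o := Op.setObserved t p) rfl rnd v⟩) E.ph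
    (Function.update_self _ _ s'.mem.observed) E.snapshot⟩

theorem Step.setSnapshot {a : Option BlockArray} {f : Unit → Prog K T α}
    (ha : ∀ l, a = some l → ∀ x ∈ l, x.1 < s.mem.nextBlock)
    (h : ∀ s', Mono s s' → s'.ph = s.ph → s'.mem.snapshot t = a →
      s'.mem.observed t = s.mem.observed t → W (f ()) s') :
    Step t Q W ((Op.setSnapshot t a).call >>= f) s :=
  fun s' E =>
  have ha' : ∀ l, a = some l → ∀ x ∈ l, x.1 < s'.mem.nextBlock :=
    fun l hl x hx => (ha l hl x hx).trans_le E.nb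
  ⟨⟨rfl, ha'⟩, fun rnd v => h (s'.after rnd v (Op.setSnapshot t a)) (E.mono.trans
    ⟨le_rfl, le_rfl, fun _ _ => rfl,
      fun h => h.after (t := t) (s := s') (o := Op.setSnapshot t a) ⟨rfl, ha'⟩ rnd v⟩) E.ph
    (Function.update_self _ _ s'.mem.snapshot) E.observed⟩

theorem Step.readShared {f : Option ℕ → Prog K T α}
    (hp : s.ph = .free ∨ s.ph = .start ∨ s.ph = .failed)
    (h : ∀ s', Mono s s' → s'.mem.observed t = s.mem.observed t →
      s'.mem.snapshot t = s.mem.snapshot t → (s.ph = .free → s'.ph = .free) →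
      (s.ph ≠ .free → s'.ph = .seen s'.mem.shared) → W (f s'.mem.shared) s') :
    Step t Q W (Op.readShared.call >>= f) s :=
  fun s' E => ⟨by simpa only [Ok, E.ph] using hp, fun rnd v => h (s'.after rnd v Op.readShared) (E.mono.trans
    ⟨le_rfl, le_rfl, fun _ _ => rfl, id⟩) E.observed E.snapshot
    (fun h => by simp [St.after, Phase.next, E.ph, h])
    fun h => by
      simp only [St.after, Phase.next, E.ph, Op.exec]⟩

theorem Step.casShared {e n : Option ℕ} {f : Bool → Prog K T α}
    (hok : ∀ s', Ext t s s' → Ok t s' (Op.casShared e n))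
    (h : ∀ s', Mono s s' → s'.mem.observed t = s.mem.observed t →
      s'.mem.snapshot t = s.mem.snapshot t → ∀ r, (s.ph = .free → s'.ph = .free) →
      (s.ph ≠ .free → s'.ph = if r = true then .done else .failed) → W (f r) s') :
    Step t Q W ((Op.casShared e n).call >>= f) s := by
  refine fun s' E => ⟨hok s' E, fun rnd v => h (s'.after rnd v (Op.casShared e n)) (E.mono.trans
    ⟨?_, ?_, ?_,
      fun h => h.after (t := t) (s := s') (o := Op.casShared e n) (hok s' E) rnd v⟩) ?_ ?_ _
    (fun h => by simp [St.after, Phase.next, E.ph, h])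
    fun h => ?_⟩
  pick_goal 6
  · simp only [St.after, Phase.next, E.ph]
  all_goals
    simp only [St.after, Op.exec]
    split
  all_goals first | exact le_rfl | exact fun _ _ => rfl | exact E.observed | exact E.snapshot

/-- The array is loaded some time after its address was read, but allocated arrays are immutable, so
the snapshot is still the array at the observed address and `Loc` holds with equal lengths.
`observed` is set to the value just read, which is what a later CAS must expect. -/
theorem refreshSnapshot_ter (G : GI s.mem) (hp : s.ph = .free ∨ s.ph = .start ∨ s.ph = .failed) :
    Ter t (fun _ s' => Mono s s' ∧ Loc t s' ∧ (s.ph = .free → s'.ph = .free) ∧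
      (s.ph ≠ .free → s'.ph = .seen (s'.mem.observed t))) (refreshSnapshot t) s := by
  unfold refreshSnapshot
  refine Ter.fold (Step.readShared hp fun s₁ M₁ ho₁ hs₁ hf₁ hn₁ => ?_)
  have G₁ := M₁.inv G
  have hsh := G₁.shared
  generalize s₁.mem.shared = p at hsh hn₁ ⊢
  refine Ter.fold (Step.setObserved fun s₂ M₂ hp₂ ho₂ hs₂ => ?_)
  have M := M₁.trans M₂
  rcases p with _ | p
  · dsimp only
    rw [← bind_pure (Op.setSnapshot t none).call]
    refine Ter.fold (Step.setSnapshot (by simp) fun s₃ M₃ hp₃ hs₃ ho₃ => Ter.pure fun s₄ E => ?_)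
    refine ⟨(M.trans M₃).trans E.mono, ?_, ?_, ?_⟩
    · exact Loc.grow (fun a ha => by simp [hs₃] at ha) E.toGrow
    · rw [E.ph, hp₃, hp₂]; exact hf₁
    · rw [E.ph, hp₃, hp₂, E.observed, ho₃, ho₂]; exact hn₁
  · have hlt : p < s₂.mem.nextArray := (hsh p rfl).trans_le M₂.na
    refine Ter.fold (Step.loadArray fun s₃ E₃ => ?_)
    rw [← bind_pure (Op.setSnapshot t _).call]
    refine Ter.fold (Step.setSnapshot ?_ fun s₄ M₄ hp₄ hs₄ ho₄ => Ter.pure fun s₅ E => ?_)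
    · rintro _ ⟨⟩
      exact (E₃.inv (M.inv G)).array p
    refine ⟨((M.trans E₃.mono).trans M₄).trans E.mono, ?_, ?_, ?_⟩
    · refine Loc.grow (fun a ha => ⟨p, ?_, (hlt.trans_le E₃.na).trans_le M₄.na, ?_⟩) E.toGrow
      · rw [ho₄, E₃.observed, ho₂]
      · rw [hs₄, Option.some.injEq] at ha
        rw [← ha, M₄.array p (hlt.trans_le E₃.na)]
    · rw [E.ph, hp₄, E₃.ph, hp₂]; exact hf₁
    · rw [E.ph, hp₄, E₃.ph, hp₂, E.observed, ho₄, E₃.observed, ho₂]; exact hn₁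

/-- `push_snapshot` in an `insert`. -/
theorem pushSnapshot_ter_insert (G : GI s.mem) (hp : s.ph = .seen (s.mem.observed t)) :
    Ter t (fun r s' => Mono s s' ∧ s'.ph = if r = true then .done else .failed)
      (pushSnapshot t) s := by
  unfold pushSnapshot
  refine Ter.fold (Step.observed fun s₁ E₁ => Ter.fold (Step.snapshot fun s₂ E₂ => ?_))
  have E := E₁.trans E₂
  have ha := (E.inv G).snapshot t
  have hp₂ : s₂.ph = .seen (s₁.mem.observed t) := by rw [E.ph, hp, E₁.observed]
  have hne : s₂.ph ≠ .free := by rw [hp₂]; exact nofun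
  generalize s₂.mem.snapshot t = a at ha ⊢
  rcases a with _ | a
  · dsimp only
    rw [← bind_pure (Op.casShared _ _).call]
    refine Ter.fold (Step.casShared (fun s₃ E₃ => ⟨by simp, .inr ?_⟩)
      fun s₃ M₃ _ _ r _ hr => Ter.pure fun s₄ E₄ => ?_)
    · rw [E₃.ph, hp₂]
    · exact ⟨(E.mono.trans M₃).trans E₄.mono, by rw [E₄.ph, hr hne]⟩
  · refine Ter.fold (Step.newArray (ha a rfl) fun s₃ E₃ p hlt _ => ?_)
    rw [← bind_pure (Op.casShared _ _).call]
    refine Ter.fold (Step.casShared (fun s₄ E₄ => ⟨?_, .inr ?_⟩)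
      fun s₄ M₄ _ _ r _ hr => Ter.pure fun s₅ E₅ => ?_)
    · rintro _ ⟨⟩; exact hlt.trans_le E₄.na
    · rw [E₄.ph, E₃.ph, hp₂]
    · exact ⟨((E.trans E₃).mono.trans M₄).trans E₅.mono, by rw [E₅.ph, hr (by rwa [E₃.ph])]⟩

/-- The invariant of `delete_min`. -/
structure Del (t : Fin T) (s : St K T) : Prop where
  inv : GI s.mem
  loc : Loc t s
  ph : s.ph = .free

theorem Del.grow {s s' : St K T} (h : Del t s) (E : Grow t s s') : Del t s' :=
  ⟨E.inv h.inv, h.loc.grow E, E.ph.trans h.ph⟩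

/-- `push_snapshot` in a `delete_min`. -/
theorem pushSnapshot_ter_deleteMin (h : Del t s) (hs : ∀ a, s.mem.snapshot t = some a →
    ∃ p, s.mem.observed t = some p ∧ a.length < (s.mem.array p).length) :
    Ter t (fun _ s' => Del t s') (pushSnapshot t) s := by
  have main : ∀ s' s'' : St K T, Ext t s s' → Mono s' s'' →
      s''.mem.observed t = s'.mem.observed t → s''.mem.snapshot t = s'.mem.snapshot t →
      (s'.ph = .free → s''.ph = .free) → Del t s'' := by
    intro s' s'' E M ho hs hf
    have h' := h.grow E.toGrow
    refine ⟨M.inv h'.inv, fun a ha => ?_, hf h'.ph⟩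
    obtain ⟨p, hp, hlt, hl⟩ := h'.loc a (hs ▸ ha)
    exact ⟨p, ho ▸ hp, hlt.trans_le M.na, (M.array p hlt).symm ▸ hl⟩
  unfold pushSnapshot
  refine Ter.fold (Step.observed fun s₁ E₁ => Ter.fold (Step.snapshot fun s₂ E₂ => ?_))
  have E := E₁.trans E₂
  have hsn := E.snapshot
  have ha := (E.inv h.inv).snapshot t
  generalize s₂.mem.snapshot t = a at ha hsn ⊢
  rcases a with _ | a
  · dsimp only
    rw [← bind_pure (Op.casShared _ _).call]
    refine Ter.fold (Step.casShared (fun s₃ E₃ => ⟨by simp, .inl ⟨?_, ?_⟩⟩)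
      fun s₃ M₃ ho hs r hr _ => Ter.pure fun s₄ E₄ => (main s₂ s₃ E M₃ ho hs hr).grow E₄.toGrow)
    · rw [E₃.ph, E.ph, h.ph]
    -- Null has the least measure: pushing it either changes nothing or strictly decreases `meas`,
    -- even when it replaces an empty array.
    · rcases s₁.mem.observed t with _ | p
      · exact .inl rfl
      · right; simp only [meas]; omega
  · obtain ⟨q, hq, hl⟩ := hs a hsn.symm
    obtain ⟨q', hq', hlt, -⟩ := h.loc a hsn.symm
    obtain rfl : q = q' := Option.some.inj (hq.symm.trans hq')
    refine Ter.fold (Step.newArray (ha a rfl) fun s₃ E₃ p hp hpa => ?_)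
    rw [← bind_pure (Op.casShared _ _).call]
    refine Ter.fold (Step.casShared (fun s₄ E₄ => ⟨?_, .inl ⟨?_, .inr ?_⟩⟩)
      fun s₄ M₄ ho hs r hr _ => Ter.pure fun s₅ E₅ =>
        (main s₃ s₄ (E.trans E₃) M₄ ho hs hr).grow E₅.toGrow)
    · rintro _ ⟨⟩; exact hp.trans_le E₄.na
    · rw [E₄.ph, E₃.ph, E.ph, h.ph]
    · rw [E₁.observed, hq]
      simp only [meas]
      rw [E₄.array p hp, hpa, ((E.trans E₃).trans E₄).array q hlt]
      omega

theorem storeLocal_bnd {i b : ℕ} (hb : b < s.mem.nextBlock) :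
    Bnd t (fun _ s' => Grow t s s') 2
      (do (Op.setDistBlock t i b).call; (Op.setDistSize t (i + 1)).call : Prog K T Unit) s := by
  refine Bnd.fold (Step.setDistBlock hb fun s₁ E₁ => ?_)
  rw [← bind_pure (Op.setDistSize t _).call]
  exact Bnd.fold (Step.setDistSize fun s₂ E₂ => Bnd.pure fun s₃ E₃ =>
    (E₁.trans E₂).trans E₃.toGrow)

variable [LinearOrder K]

/-- One round of the loop of `SharedKLSM::insert`. -/
def sharedInsertRound (k : ℕ) (t : Fin T) (b : ℕ) : Prog K T (Unit ⊕ Unit) := do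
  refreshSnapshot t
  let snapshot ← (Op.snapshot t).call
  let a ← arrayInsert (K := K) k (snapshot.getD []) b
  (Op.setSnapshot t (some a)).call
  let success ← pushSnapshot t
  if success then
    (Op.setObserved t none).call
    (Op.setSnapshot t none).call
    return .inr ()
  else
    return .inl ()

/-- A single round always terminates; only the number of rounds is out of control. Adding a block
may violate `Loc`. After a success `Loc` holds vacuously because the snapshot is given up; after a
failure it is not claimed, as the next round takes a new snapshot. -/
theorem sharedInsertRound_ter {k b : ℕ} (G : GI s.mem) (hb : b < s.mem.nextBlock)
    (hp : s.ph = .start ∨ s.ph = .failed) :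
    Ter t (Round (fun _ s' => Mono s s' ∧ s'.ph = .failed)
      (fun _ s' => s'.ph = .done ∧ Loc t s')) (sharedInsertRound k t b) s := by
  unfold sharedInsertRound
  have hne : s.ph ≠ .free := by rcases hp with h | h <;> rw [h] <;> exact nofun
  refine (refreshSnapshot_ter G (.inr hp)).bind fun _ s₁ ⟨M₁, _, _, hp₁⟩ => ?_
  replace hp₁ := hp₁ hne
  refine Ter.fold (Step.snapshot fun s₂ E₂ => ?_)
  have M := M₁.trans E₂.mono
  have ha : ∀ x ∈ (s₂.mem.snapshot t).getD [], x.1 < s₂.mem.nextBlock := by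
    have := (M.inv G).snapshot t
    cases h : s₂.mem.snapshot t with
    | none => simp
    | some a => exact this a h
  refine (arrayInsert_ter (k := k) (M.inv G) ha (hb.trans_le M.nb)).bind fun a s₃ ⟨E₃, ha⟩ => ?_
  refine Ter.fold (Step.setSnapshot (by rintro _ ⟨⟩; exact ha) fun s₄ M₄ hp₄ _ ho₄ => ?_)
  replace M := (M.trans E₃.mono).trans M₄
  refine (pushSnapshot_ter_insert (t := t) (M.inv G) ?_).bind fun r s₅ ⟨M₅, hp₅⟩ => ?_
  · rw [hp₄, E₃.ph, E₂.ph, hp₁, ho₄, E₃.observed, E₂.observed]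
  replace M := M.trans M₅
  cases r
  · exact Ter.pure fun s₆ E₆ => ⟨M.trans E₆.mono, by simp [E₆.ph, hp₅]⟩
  · refine Ter.fold (Step.setObserved fun s₆ M₆ hp₆ ho₆ hs₆ => ?_)
    refine Ter.fold (Step.setSnapshot (by simp) fun s₇ M₇ hp₇ hs₇ ho₇ => Ter.pure fun s₈ E₈ => ?_)
    exact ⟨by simp [E₈.ph, hp₇, hp₆, hp₅],
      Loc.grow (fun a ha => by simp [hs₇] at ha) E₈.toGrow⟩

theorem sharedInsert_safe {k b : ℕ} (G : GI s.mem) (hb : b < s.mem.nextBlock)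
    (hp : s.ph = .start ∨ s.ph = .failed) :
    Safe t (fun _ s' => Loc t s') (sharedInsert (K := K) k t b) s :=
  Safe.iter (fun _ s' => Mono s s' ∧ (s'.ph = .start ∨ s'.ph = .failed))
    (fun _ _ ⟨M, hp⟩ => (sharedInsertRound_ter (M.inv G) (hb.trans_le M.nb) hp).safe.mono
      fun r _ h => match r, h with
        | .inl _, h => ⟨M.trans h.1, .inr h.2⟩
        | .inr _, h => h.2) ⟨Mono.refl s, hp⟩

/-- The part of `KLSM::insert` before the resulting block is stored. Returns its position in the
`DistLSM`, its address and its level. -/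
def insertLocal (t : Fin T) (key : K) : Prog K T (ℕ × ℕ × ℕ) := do
  let it ← (Op.newItem key).call
  let items ← append [] it
  let b ← (Op.newBlock 0 items).call
  let size ← (Op.distSize t).call
  let (i, b) ← iter (size, b) fun (i, b) => do
    if i = 0 then
      return .inr (i, b)
    else
      match ← (Op.distBlock t (i - 1)).call with
      | none => return .inl (i - 1, b)
      | some b' =>
        let lb' ← (Op.level b').call
        let lb ← (Op.level b).call
        if lb' ≤ lb then
          let b₂ ← mergeIn b' b (lb + 1)
          let b₂ ← shrink b₂
          return .inl (i - 1, b₂)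
        else
          return .inr (i, b)
  let lb ← (Op.level b).call
  return (i, b, lb)

/-- The part of `KLSM::insert` that stores the resulting block. -/
def insertStore (k : ℕ) (t : Fin T) (x : ℕ × ℕ × ℕ) : Prog K T Unit :=
  if k < 2 ^ (x.2.2 + 1) then do
    sharedInsert (K := K) k t x.2.1
    (Op.setDistSize t x.1).call
  else do
    (Op.setDistBlock t x.1 x.2.1).call
    (Op.setDistSize t (x.1 + 1)).call

/-- Separates the part with a step bound fixed at the invocation from the one that may have to
retry. -/
theorem insert_eq (k : ℕ) (t : Fin T) (key : K) :
    insert k t key = (insertLocal t key).bind (insertStore k t) := by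
  change _ = insertLocal t key >>= insertStore k t
  unfold insert distInsert insertLocal
  simp only [bind_assoc, pure_bind, insertStore]

/-- After passing `d` of the `n` blocks, the current block has level at most `d` and capacity at
most `1 + d * M`: a merge adds one to the level and at most `M` to the capacity, and shrinking
increases neither. All merges and shrinks thus have uniform step bounds `N₁` and `N₂`. -/
theorem insertLocal_bnd (t : Fin T) (key : K) (n M : ℕ) : ∃ N, ∀ s : St K T, GI s.mem →
    (s.mem.dist t).size = n → (∀ i < n, ∀ b, (s.mem.dist t).blocks i = some b →
      (s.mem.block b).items.length ≤ M) →
    Bnd t (fun r s' => Ext t s s' ∧ r.2.1 < s'.mem.nextBlock) N (insertLocal t key) s := by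
  obtain ⟨N₁, hN₁⟩ := mergeIn_bnd (K := K) (t := t) (1 + (n + 1) * M)
  obtain ⟨N₂, hN₂⟩ := shrink_bnd (K := K) (t := t) (1 + (n + 1) * M) (n + 1)
  refine ⟨(1 + (1 + ((N₁ + N₂ + 1 + 1 + 1 + 1) * (n + 1) + (0 + 1)) + 1)) + 1,
    fun s G hn hM => ?_⟩
  unfold insertLocal
  refine Bnd.fold (Step.newItem fun s₁ E₁ it => ?_)
  rw [show ∀ x, 1 + (1 + x + 1) = 1 + (1 + (x + 1)) by intro; omega]
  refine (append_bnd [] it s₁).bind fun items s₂ ⟨E₂, hl⟩ => ?_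
  refine (newBlock_bnd 0 items s₂).bind fun b s₃ ⟨E₃, hb, hlv, hi⟩ => ?_
  refine Bnd.fold (Step.distSize fun s₄ E₄ => ?_)
  have E := ((E₁.trans E₂).trans E₃).trans E₄
  -- Other threads cannot write to this DistLSM, so its size is still the initial one.
  rw [E.dist, hn]
  refine Bnd.bind (P := fun r s' => Ext t s s' ∧ r.2 < s'.mem.nextBlock) (Bnd.iter
    (fun j x s' => Ext t s s' ∧ x.1 = j ∧ j ≤ n ∧
      ∃ l ≤ n - j, IsBlock x.2 l (1 + (n - j) * M) s') ?_ (j := n) ⟨E, rfl, le_rfl, 0, by simp,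
      IsBlock.grow ⟨hb, hlv, by simpa [hi] using hl⟩ E₄.toGrow⟩) ?_
  · rintro _ ⟨i, b⟩ s₁ ⟨E₁, rfl, hi, l, hl, hb⟩
    dsimp only at *
    split
    · exact Bnd.pure fun s₂ E₂ => ⟨E₁.trans E₂, (hb.grow E₂.toGrow).lt⟩
    rename_i hi0
    obtain ⟨i, rfl⟩ := Nat.exists_eq_succ_of_ne_zero hi0
    obtain ⟨d, rfl⟩ := Nat.exists_eq_add_of_le hi
    rw [show i.succ + d - i.succ = d by omega] at *
    rw [Nat.succ_sub_one]
    have hle : 1 + d * M ≤ 1 + (d + 1) * M := by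
      have := Nat.mul_le_mul_right M (show d ≤ d + 1 by omega); omega
    have next : ∀ (b l : ℕ) (s₂ s₃ : St K T), Ext t s s₂ → Ext t s₂ s₃ → l ≤ d + 1 →
        IsBlock b l (1 + (d + 1) * M) s₂ → ∃ i' < i.succ, Ext t s s₃ ∧ i = i' ∧
        i' ≤ i.succ + d ∧ ∃ l ≤ i.succ + d - i', IsBlock b l (1 + (i.succ + d - i') * M) s₃ := by
      intro b l s₂ s₃ E₂ E₃ hl hb
      refine ⟨i, Nat.lt_succ_self i, E₂.trans E₃, rfl, by omega, l, by omega, ?_⟩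
      rw [show i.succ + d - i = d + 1 by omega]
      exact hb.grow E₃.toGrow
    refine Bnd.fold (Step.distBlock fun s₂ E₂ => ?_)
    have E := E₁.trans E₂
    cases h : (s₂.mem.dist t).blocks i with
    | none =>
      exact Bnd.pure fun s₃ E₃ => next b l s₂ s₃ E E₃ (by omega) ((hb.grow E₂.toGrow).mono hle)
    | some b' =>
      have hb' : IsBlock b' (s₂.mem.block b').level M s₂ := by
        rw [E.dist] at h
        have hlt := G.dist t i b' h
        exact ⟨hlt.trans_le E.nb, rfl, (E.items b' hlt).symm ▸ hM i (by omega) b' h⟩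
      refine Bnd.fold (Step.level fun s₃ E₃ => Bnd.fold (Step.level fun s₄ E₄ => ?_))
      have E' := E₃.trans E₄
      rw [(hb.grow (E₂.trans E').toGrow).level]
      have hlt : 1 + (d + 1) * M ≤ 1 + (i.succ + d + 1) * M := by
        have := Nat.mul_le_mul_right M (show d + 1 ≤ i.succ + d + 1 by omega); omega
      have hM' : M + (1 + d * M) = 1 + (d + 1) * M := by ring
      split
      · refine (hN₁ M (1 + d * M) (hM' ▸ hlt) b' b _ l (l + 1) s₄ ((E.trans E').inv G)
          (hb'.grow E'.toGrow) (hb.grow (E₂.trans E').toGrow)).bind fun r s₅ ⟨E₅, hr⟩ => ?_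
        rw [hM'] at hr
        refine (hN₂ _ hlt r (l + 1) s₅ (((E.trans E').trans E₅).inv G) hr
          (by omega)).bind (n := 0) fun r s₆ ⟨E₆, l', hl', hr⟩ => Bnd.pure fun s₇ E₇ => ?_
        exact next r l' s₆ s₇ (((E.trans E').trans E₅).trans E₆) E₇ (by omega) hr
      · exact Bnd.pure fun s₅ E₅ => ⟨(E.trans E').trans E₅,
          (hb.grow ((E₂.trans E').trans E₅).toGrow).lt⟩
  · rintro ⟨i, b⟩ s₅ ⟨E₅, hb⟩
    exact Bnd.fold (Step.level fun s₆ E₆ => Bnd.pure fun s₇ E₇ =>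
      ⟨(E₅.trans E₆).trans E₇, hb.trans_le (E₆.trans E₇).nb⟩)

theorem insertLocal_ter {key : K} (G : GI s.mem) :
    Ter t (fun r s' => Ext t s s' ∧ r.2.1 < s'.mem.nextBlock) (insertLocal t key) s := by
  obtain ⟨N, hN⟩ := insertLocal_bnd t key (s.mem.dist t).size
    -- Any common upper bound for the capacities will do; their sum is convenient.
    (∑ i ∈ Finset.range (s.mem.dist t).size, match (s.mem.dist t).blocks i with
      | none => 0
      | some b => (s.mem.block b).items.length)
  refine (hN s G rfl fun i hi b hb => ?_).ter
  refine le_trans (le_of_eq ?_) (Finset.single_le_sum (fun _ _ => Nat.zero_le _)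
    (Finset.mem_range.2 hi))
  simp only [hb]

/-- `Loc` must hold at the return because a later `delete_min` of the same thread relies on it. The
local branch leaves the snapshot alone, and the shared branch ends with none. -/
theorem insert_safe {k : ℕ} {key : K} (G : GI s.mem) (hl : Loc t s) (hp : s.ph = .start) :
    Safe t (fun _ s' => Loc t s') (insert k t key) s := by
  rw [insert_eq]
  refine (insertLocal_ter G).safe.bind fun x s₁ ⟨E₁, hb⟩ => ?_
  unfold insertStore
  split
  · refine (sharedInsert_safe (E₁.inv G) hb (.inl (E₁.ph.trans hp))).bind fun _ s₂ h => ?_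
    rw [← bind_pure (Op.setDistSize t _).call]
    exact Safe.fold (Step.setDistSize fun s₃ E₃ => Safe.pure fun s₄ E₄ =>
      h.grow (E₃.trans E₄.toGrow))
  · exact (storeLocal_bnd hb).ter.safe.mono fun _ _ E₂ => hl.grow (E₁.toGrow.trans E₂)

end SharedRoutines

/-! ### Safety of `delete_min` -/

section DeleteMin

variable {K : Type} {T : ℕ} {t : Fin T} {s : St K T}

/-- No progress is claimed for `delete_min`, so safety suffices for its loops and no variants are
needed. -/
theorem distBlocks_safe (G : GI s.mem) :
    Safe t (fun r s' => Ext t s s' ∧ Alloc r s') (distBlocks (K := K) t) s := by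
  unfold distBlocks
  refine Safe.fold (Step.distSize fun s₁ E₁ => ?_)
  refine Safe.iter (fun x s' => Ext t s s' ∧ Alloc x.2 s') ?_ ⟨E₁, Alloc.nil⟩
  rintro ⟨i, acc⟩ s₂ ⟨E₂, ha⟩
  dsimp only at *
  split
  · refine Safe.fold (Step.distBlock fun s₃ E₃ => ?_)
    have hd := ((E₂.trans E₃).inv G).dist t i
    cases h : (s₃.mem.dist t).blocks i with
    | none => exact Safe.pure fun s₄ E₄ =>
        ⟨(E₂.trans E₃).trans E₄, ha.grow (E₃.trans E₄).toGrow⟩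
    | some b =>
      refine Safe.pure fun s₄ E₄ => ⟨(E₂.trans E₃).trans E₄, ?_⟩
      simp only [Alloc, List.forall_mem_append, List.forall_mem_singleton]
      exact ⟨ha.grow (E₃.trans E₄).toGrow, (hd b h).trans_le E₄.nb⟩
  · exact Safe.pure fun s₃ E₃ => ⟨E₂.trans E₃, ha.grow E₃.toGrow⟩

theorem arrayFindMin_safe (a : BlockArray) :
    Safe t (fun _ s' => Ext t s s') (arrayFindMin (K := K) a) s := by
  unfold arrayFindMin
  refine Safe.bind (P := fun _ s' => Ext t s s')
    (Safe.iter (fun _ s' => Ext t s s') ?_ (Ext.refl t s)) ?_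
  · rintro ⟨_ | ⟨⟨b, pivot⟩, todo⟩, total⟩ s₁ E₁
    · exact Safe.pure fun s₂ E₂ => E₁.trans E₂
    · exact Safe.fold (Step.filled fun s₂ E₂ => Safe.pure fun s₃ E₃ => (E₁.trans E₂).trans E₃)
  · intro total s₁ E₁
    refine Safe.fold (Step.rand fun s₂ E₂ r => ?_)
    refine Safe.iter (fun _ s' => Ext t s s') ?_ (E₁.trans E₂)
    rintro ⟨_ | ⟨⟨b, pivot⟩, todo⟩, r⟩ s₃ E₃
    · exact Safe.pure fun s₄ E₄ => E₃.trans E₄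
    · refine Safe.fold (Step.filled fun s₄ E₄ => ?_)
      -- `jp` is the join point of the `do` block, the common continuation of its branches. It is
      -- verified once for all values passed to it; the same pattern recurs below.
      extract_lets range jp
      have E := E₃.trans E₄
      split
      · exact Safe.pure fun s₅ E₅ => E.trans E₅
      have hjp : ∀ selected s', Ext t s s' →
          Safe t (Round (fun _ s' => Ext t s s') fun _ s' => Ext t s s') (jp selected) s' := by
        rintro (_ | it) s' E
        · refine Safe.fold (Step.filled fun s₄ E₄ => ?_)
          split
          · exact Safe.pure fun s₅ E₅ => (E.trans E₄).trans E₅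
          · exact Safe.fold (Step.item fun s₅ E₅ it => Safe.pure fun s₆ E₆ =>
              ((E.trans E₄).trans E₅).trans E₆)
        · exact Safe.pure fun s₅ E₅ => E.trans E₅
      split
      · simp only [bind_assoc]
        refine Safe.fold (Step.item fun s₅ E₅ it => ?_)
        cases it with
        | none => exact hjp none _ (E.trans E₅)
        | some it =>
          simp only [bind_assoc]
          exact Safe.fold (Step.flag fun s₆ E₆ d =>
            hjp (if d = true then none else some it) _ ((E.trans E₅).trans E₆))
      · exact hjp none _ E

theorem spy_safe (G : GI s.mem) (v : Fin T) :
    Safe t (fun _ s' => Grow t s s') (spy (K := K) t v) s := by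
  unfold spy
  refine Safe.bind (P := fun _ s' => Grow t s s') (Safe.iter (fun _ s' => Grow t s s') ?_
    (Grow.refl t s)) ?_
  · intro i s₁ E₁
    refine Safe.fold (Step.distSize fun s₂ E₂ => ?_)
    replace E₂ := E₁.trans E₂.toGrow
    split
    · refine Safe.fold (Step.distBlock fun s₃ E₃ => ?_)
      replace E₃ := E₂.trans E₃.toGrow
      have hd := (E₃.inv G).dist v i
      cases h : (s₃.mem.dist v).blocks i with
      | none => exact Safe.pure fun s₄ E₄ => E₃.trans E₄.toGrow
      | some b =>
        refine Safe.fold (Step.level fun s₄ E₄ => Safe.fold (Step.distSize fun s₅ E₅ => ?_))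
        have E := E₄.trans E₅
        -- The victim may replace its blocks meanwhile, but an address once allocated stays valid,
        -- so copying from `b` remains legitimate.
        have hb := (hd b h).trans_le E.nb
        replace E := E₃.trans E.toGrow
        extract_lets jp
        have hjp : ∀ fits s', Ext t s₅ s' →
            Safe t (Round (fun _ s' => Grow t s s') fun _ s' => Grow t s s') (jp fits) s' := by
          rintro (_ | _) s' E'
          · exact Safe.pure fun s₆ E₆ => E.trans (E'.trans E₆).toGrow
          · refine (copy_ter ((E.trans E'.toGrow).inv G) (hb.trans_le E'.nb)).safe.bind
              fun r s₆ ⟨E₆, hr⟩ => ?_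
            exact Safe.fold (Step.setDistBlock hr fun s₇ E₇ => Safe.fold
              (Step.setDistSize fun s₈ E₈ => Safe.pure fun s₉ E₉ =>
                (E.trans (E'.trans E₆).toGrow).trans ((E₇.trans E₈).trans E₉.toGrow)))
        split
        · exact hjp true _ (Ext.refl t s₅)
        · refine Safe.fold (Step.distBlock fun s₆ E₆ => ?_)
          split
          · exact hjp true _ E₆
          · exact Safe.fold (Step.level fun s₇ E₇ => hjp _ _ (E₆.trans E₇))
    · exact Safe.pure fun s₃ E₃ => E₂.trans E₃.toGrow
  · intro _ s₁ E₁
    exact Safe.fold (Step.distSize fun s₂ E₂ => Safe.pure fun s₃ E₃ =>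
      E₁.trans (E₂.trans E₃).toGrow)

variable [LinearOrder K]

theorem distConsolidate_safe (G : GI s.mem) :
    Safe t (fun _ s' => Grow t s s') (distConsolidate (K := K) t) s := by
  unfold distConsolidate
  refine (distBlocks_safe G).bind fun bs s₁ ⟨E₁, ha⟩ => ?_
  refine (consolidateBlocks_ter (E₁.inv G) ha).safe.bind ?_
  rintro ⟨bs', m⟩ s₂ ⟨E₂, ha, -⟩
  refine Safe.bind (P := fun _ s' => Grow t s s') (Safe.iter (fun x s' => Grow t s s' ∧
    Alloc x.2 s') ?_ ⟨(E₁.trans E₂).toGrow, ha⟩) ?_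
  · rintro ⟨i, _ | ⟨b, bs⟩⟩ s₃ ⟨E₃, ha⟩
    · exact Safe.pure fun s₄ E₄ => E₃.trans E₄.toGrow
    · exact Safe.fold (Step.setDistBlock ha.head fun s₄ E₄ => Safe.pure fun s₅ E₅ =>
        ⟨(E₃.trans E₄).trans E₅.toGrow, ha.tail.grow (E₄.trans E₅.toGrow)⟩)
  · intro n s₃ E₃
    rw [← bind_pure (Op.setDistSize t _).call]
    exact Safe.fold (Step.setDistSize fun s₄ E₄ => Safe.pure fun s₅ E₅ =>
      (E₃.trans E₄).trans E₅.toGrow)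

theorem distFindMin_safe (G : GI s.mem) :
    Safe t (fun _ s' => Grow t s s') (distFindMin (K := K) t) s := by
  unfold distFindMin
  refine Safe.iter (fun _ s' => Grow t s s') ?_ (Grow.refl t s)
  rintro _ s₁ E₁
  refine (distBlocks_safe (E₁.inv G)).bind fun bs s₂ ⟨E₂, ha⟩ => ?_
  replace E₂ := E₁.trans E₂.toGrow
  split
  · exact Safe.pure fun s₃ E₃ => E₂.trans E₃.toGrow
  refine Safe.bind (P := fun _ s' => Grow t s s') (Safe.iter (fun _ s' => Grow t s s') ?_ E₂) ?_
  · rintro ⟨_ | ⟨b, todo⟩, best⟩ s₃ E₃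
    · exact Safe.pure fun s₄ E₄ => E₃.trans E₄.toGrow
    · refine Safe.fold (Step.filled fun s₄ E₄ => ?_)
      split
      · exact Safe.pure fun s₅ E₅ => E₃.trans (E₄.trans E₅).toGrow
      · refine Safe.fold (Step.item fun s₅ E₅ it => ?_)
        have E := E₃.trans (E₄.trans E₅).toGrow
        split <;> exact Safe.pure fun s₆ E₆ => E.trans E₆.toGrow
  · intro found s₃ E₃
    extract_lets jp
    have hjp : ∀ live s', Grow t s s' →
        Safe t (Round (fun _ s' => Grow t s s') fun _ s' => Grow t s s') (jp live) s' := by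
      rintro (_ | _) s' E
      · exact (distConsolidate_safe (E.inv G)).bind fun _ s₄ E₄ => Safe.pure fun s₅ E₅ =>
          (E.trans E₄).trans E₅.toGrow
      · exact Safe.pure fun s₅ E₅ => E.trans E₅.toGrow
    cases found with
    | none => exact hjp false _ E₃
    | some it => exact Safe.fold (Step.flag fun s₄ E₄ d => hjp _ _ (E₃.trans E₄.toGrow))

theorem sharedFindMin_safe {k : ℕ} (D : Del t s) :
    Safe t (fun _ s' => Del t s') (sharedFindMin (K := K) k t) s := by
  unfold sharedFindMin
  refine Safe.iter (fun _ s' => Del t s') ?_ D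
  clear D
  intro _ s D
  refine Safe.fold (Step.readShared (.inl D.ph) fun s₁ M₁ ho₁ hs₁ hf₁ _ => ?_)
  have D₁ : Del t s₁ := by
    refine ⟨M₁.inv D.inv, fun a ha => ?_, hf₁ D.ph⟩
    obtain ⟨p, hp, hlt, hl⟩ := D.loc a (hs₁ ▸ ha)
    exact ⟨p, ho₁ ▸ hp, hlt.trans_le M₁.na, (M₁.array p hlt).symm ▸ hl⟩
  refine Safe.fold (Step.observed fun s₂ E₂ => ?_)
  have D₂ := D₁.grow E₂.toGrow
  extract_lets jp
  have hjp : ∀ u s', Del t s' →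
      Safe t (Round (fun _ s' => Del t s') fun _ s' => Del t s') (jp u) s' := by
    clear * -
    intro _ s D
    refine Safe.fold (Step.snapshot fun s₁ E₁ => ?_)
    replace D := D.grow E₁.toGrow
    cases hs : s₁.mem.snapshot t with
    | none => exact Safe.pure fun s₂ E₂ => D.grow E₂.toGrow
    | some a =>
      refine (arrayFindMin_safe a).bind fun found s₂ E₂ => ?_
      extract_lets jp
      have hjp : ∀ live s', Ext t s₁ s' →
          Safe t (Round (fun _ s' => Del t s') fun _ s' => Del t s') (jp live) s' := by
        rintro (_ | _) s' E
        · have D' := D.grow E.toGrow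
          have hs' := E.snapshot.trans hs
          refine (consolidate_ter D'.inv (D'.inv.snapshot t a hs')).safe.bind ?_
          rintro ⟨a', m⟩ s₃ ⟨E₃, ha, hl, hm⟩
          -- `Loc` compares the snapshot with the array at the observed address; combined with the
          -- estimates for `consolidate`, it compares the array to be pushed with the one to be
          -- replaced.
          obtain ⟨p, hp, hlt, hlp⟩ := D'.loc a hs'
          replace D' := D'.grow E₃.toGrow
          rw [← E₃.array p hlt] at hlp
          rw [← E₃.observed] at hp
          replace hlt := hlt.trans_le E₃.na
          dsimp only at *
          split
          · refine Safe.fold (Step.setSnapshot (by simp) fun s₄ M₄ hp₄ hs₄ ho₄ => ?_)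
            -- The snapshot is now null, so `Loc` and the length condition for pushing are vacuous.
            refine (pushSnapshot_ter_deleteMin ⟨M₄.inv D'.inv, fun a ha => ?_, hp₄.trans D'.ph⟩
              fun a ha => ?_).safe.bind fun _ s₅ D₅ => Safe.pure fun s₆ E₆ => D₅.grow E₆.toGrow
            · simp [hs₄] at ha
            · simp [hs₄] at ha
          · refine Safe.fold (Step.setSnapshot (by rintro _ ⟨⟩; exact ha)
              fun s₄ M₄ hp₄ hs₄ ho₄ => ?_)
            have D₄ : Del t s₄ := by
              refine ⟨M₄.inv D'.inv, fun a ha => ?_, hp₄.trans D'.ph⟩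
              rw [hs₄, Option.some.injEq] at ha
              exact ⟨p, ho₄.trans hp, hlt.trans_le M₄.na, by
                rw [← ha, M₄.array p hlt]; exact hl.trans hlp⟩
            split
            · rename_i hm'
              refine (pushSnapshot_ter_deleteMin D₄ fun a ha => ?_).safe.bind
                fun _ s₅ D₅ => Safe.pure fun s₆ E₆ => D₅.grow E₆.toGrow
              rw [hs₄, Option.some.injEq] at ha
              -- The merge flag makes the consolidated array strictly shorter than the snapshot,
              -- hence than the observed array.
              exact ⟨p, ho₄.trans hp, by
                rw [← ha, M₄.array p hlt]; exact (hm hm').trans_le hlp⟩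
            · exact Safe.pure fun s₅ E₅ => D₄.grow E₅.toGrow
        · exact Safe.pure fun s₃ E₃ => D.grow (E.trans E₃).toGrow
      cases found with
      | none => exact hjp false _ E₂
      | some it => exact Safe.fold (Step.flag fun s₃ E₃ d => hjp _ _ (E₂.trans E₃))
  split
  · exact (refreshSnapshot_ter D₂.inv (.inl D₂.ph)).safe.bind fun _ s₃ ⟨M₃, hl, hf, _⟩ =>
      hjp () _ ⟨M₃.inv D₂.inv, hl, hf D₂.ph⟩
  · exact hjp () _ D₂

theorem deleteMin_safe {k : ℕ} (D : Del t s) :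
    Safe t (fun _ s' => Loc t s') (deleteMin (K := K) k t) s := by
  unfold deleteMin
  refine (Safe.iter (Q := fun _ s' => Del t s') (fun _ s' => Del t s') ?_ D).mono
    fun _ _ h => h.loc
  clear D
  intro _ s D
  refine Safe.bind (P := fun _ s' => Del t s') (Safe.iter (fun _ s' => Del t s') ?_ D) ?_
  · clear D
    intro _ s D
    refine (distFindMin_safe D.inv).bind fun r s₁ E₁ => ?_
    replace D := D.grow E₁
    extract_lets jp
    have hjp : ∀ found s', Del t s' →
        Safe t (Round (fun _ s' => Del t s') fun _ s' => Del t s') (jp found) s' := by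
      rintro (_ | it) s D
      · exact Safe.pure fun s₁ E₁ => D.grow E₁.toGrow
      · refine Safe.fold (Step.flag fun s₁ E₁ d => ?_)
        replace D := D.grow E₁.toGrow
        split
        · exact Safe.pure fun s₁ E₁ => D.grow E₁.toGrow
        · refine Safe.fold (Step.testAndSet fun s₂ E₂ d => Safe.pure fun s₃ E₃ => ?_)
          replace D := D.grow (E₂.trans E₃).toGrow
          cases d <;> exact D
    cases r with
    | none => exact (sharedFindMin_safe D).bind fun r s₂ D₂ => hjp _ _ D₂
    | some it =>
      refine (sharedFindMin_safe D).bind fun r s₂ D₂ => ?_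
      cases r with
      | none => exact hjp (some it) _ D₂
      | some tmp => exact hjp (some (if tmp.key < it.key then tmp else it)) _ D₂
  · intro taken s₁ D₁
    cases taken with
    | some it => exact Safe.pure fun s₂ E₂ => D₁.grow E₂.toGrow
    | none =>
      refine Safe.fold (Step.randThread fun s₂ E₂ v => ?_)
      replace D₁ := D₁.grow E₂.toGrow
      refine (spy_safe D₁.inv v).bind fun r s₃ E₃ => Safe.pure fun s₄ E₄ => ?_
      replace D₁ := D₁.grow (E₃.trans E₄.toGrow)
      cases r <;> exact D₁

end DeleteMin

/-! ### From single threads to executions -/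

section System

variable {K : Type} {T k : ℕ}

/-- The invariant of a thread. -/
def ThreadOk (t : Fin T) : ThreadState K T → St K T → Prop
  | .idle, s => Loc t s ∧ s.ph = .free
  | .running call p, s => Safe t (fun _ s' => Loc t s') p s ∧ (s.ph = .free ↔ call = .deleteMin)

theorem ThreadOk.ext {t : Fin T} {x : ThreadState K T} {s s' : St K T} (h : ThreadOk t x s)
    (E : Ext t s s') : ThreadOk t x s' := by
  cases x with
  | idle => exact ⟨h.1.grow E.toGrow, E.ph.trans h.2⟩
  | running call p => exact ⟨h.1.ext E, E.ph ▸ h.2⟩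

/-- The invariant of configurations. -/
structure Inv (c : Config K T) (φ : Fin T → Phase) : Prop where
  mem : GI c.mem
  thread : ∀ t, ThreadOk t (c.thread t) ⟨c.mem, φ t⟩

theorem Phase.next_eq_free {ph : Phase} {β : Type} {o : Op K T β} {v : β} :
    ph.next o v = .free ↔ ph = .free := by
  cases o <;> simp only [Phase.next] <;> cases ph <;> simp
  all_goals split <;> simp

theorem Inv.start : Inv (Config.start K T) fun _ => .free where
  mem := ⟨fun _ => le_rfl, by simp [Config.start], by simp [Config.start],
    by simp [Config.start], by simp [Config.start]⟩
  thread _ := ⟨by simp [Loc, Config.start], rfl⟩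

/-- The steps of thread `t` at the times in `[i, n)`. -/
def ownSteps (s : ℕ → Choice K T) (t : Fin T) (i n : ℕ) : ℕ :=
  ((Finset.Ico i n).filter fun m => (s m).thread = t).card

theorem ownSteps_next {s : ℕ → Choice K T} {t : Fin T} {i n : ℕ} (h : 0 < ownSteps s t i n) : ∃ j, i ≤ j ∧ j < n ∧
    (s j).thread = t ∧ (∀ m, i ≤ m → m < j → (s m).thread ≠ t) ∧
      ownSteps s t i n = ownSteps s t (j + 1) n + 1 := by
  induction hd : n - i generalizing i with
  | zero => simp [ownSteps, Finset.Ico_eq_empty_of_le (show n ≤ i by omega)] at h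
  | succ d ih =>
    have hI : Finset.Ico i n = Insert.insert i (Finset.Ico (i + 1) n) := by
      ext; simp; omega
    by_cases ht : (s i).thread = t
    · refine ⟨i, le_rfl, by omega, ht, fun m _ _ => by omega, ?_⟩
      rw [ownSteps, hI, Finset.filter_insert, if_pos ht, Finset.card_insert_of_notMem (by simp)]
      rfl
    · have hI' : ownSteps s t i n = ownSteps s t (i + 1) n := by
        rw [ownSteps, hI, Finset.filter_insert, if_neg ht]; rfl
      obtain ⟨j, h₁, h₂, h₃, h₄, h₅⟩ := ih (hI' ▸ h) (by omega)
      refine ⟨j, by omega, h₂, h₃, fun m hm hm' => ?_, hI' ▸ h₅⟩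
      rcases Nat.eq_or_lt_of_le hm with rfl | hm
      · exact ht
      · exact h₄ m hm hm'

theorem exists_next {s : ℕ → Choice K T} {t : Fin T} (hs : ∀ N, ∃ n ≥ N, (s n).thread = t) (i : ℕ) :
    ∃ j, i ≤ j ∧ (s j).thread = t ∧ ∀ m, i ≤ m → m < j → (s m).thread ≠ t := by
  classical
  have h := hs i
  exact ⟨Nat.find h, (Nat.find_spec h).1, (Nat.find_spec h).2,
    fun m hm hlt heq => Nat.find_min h hlt ⟨hm, heq⟩⟩

variable [LinearOrder K]

/-- The phases of all threads after a step. -/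
def phaseStep (c : Config K T) (φ : Fin T → Phase) (ch : Choice K T) : Fin T → Phase :=
  match c.thread ch.thread with
  | .idle => Function.update φ ch.thread (match ch.call with
    | .insert _ => .start
    | .deleteMin => .free)
  | .running _ (.ret _) => Function.update φ ch.thread .free
  | .running _ (.act o _) => Function.update φ ch.thread
      ((φ ch.thread).next o (o.exec ch.rnd ch.victim c.mem).1)
  | .running _ (.loop _ _ _) => φ

/-- The phases of all threads after the first `n` steps of a schedule. -/
def phases (k : ℕ) (c : Config K T) (φ : Fin T → Phase) (s : ℕ → Choice K T) :
    ℕ → Fin T → Phase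
  | 0 => φ
  | n + 1 => phaseStep (run k c s n) (phases k c φ s n) (s n)

/-- The safety of the acting thread makes its operation `Ok`, and `Ext.of_other` turns this
guarantee into the rely of `t`. -/
theorem Inv.step_other {c : Config K T} {φ : Fin T → Phase} (h : Inv c φ) {ch : Choice K T}
    {t : Fin T} (ht : ch.thread ≠ t) :
    (step k c ch).thread t = c.thread t ∧
      Ext t ⟨c.mem, φ t⟩ ⟨(step k c ch).mem, phaseStep c φ ch t⟩ := by
  have hok := h.thread ch.thread
  unfold step phaseStep
  rcases hth : c.thread ch.thread with _ | ⟨call, p⟩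
  · simp only [Function.update_of_ne ht.symm]
    exact ⟨trivial, Ext.refl _ _⟩
  rw [hth] at hok
  cases p with
  | ret a =>
    simp only [Function.update_of_ne ht.symm]
    exact ⟨trivial, Ext.refl _ _⟩
  | act o next =>
    simp only [Function.update_of_ne ht.symm]
    exact ⟨trivial, Ext.of_other (hok.1.unfold _ (Ext.refl _ _)).1 ht.symm _ _ _⟩
  | loop body s next =>
    simp only [Function.update_of_ne ht.symm]
    exact ⟨trivial, Ext.refl _ _⟩

theorem Inv.step {c : Config K T} {φ : Fin T → Phase} (h : Inv c φ) (ch : Choice K T) :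
    Inv (step k c ch) (phaseStep c φ ch) := by
  suffices hs : GI (KLSM.step k c ch).mem ∧ ThreadOk ch.thread ((KLSM.step k c ch).thread ch.thread)
      ⟨(KLSM.step k c ch).mem, phaseStep c φ ch ch.thread⟩ by
    refine ⟨hs.1, fun t => ?_⟩
    by_cases ht : ch.thread = t
    · exact ht ▸ hs.2
    · obtain ⟨h₁, h₂⟩ := h.step_other (k := k) ht
      exact h₁ ▸ (h.thread t).ext h₂
  have hok := h.thread ch.thread
  unfold KLSM.step phaseStep
  rcases hth : c.thread ch.thread with _ | ⟨call, p⟩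
  · rw [hth] at hok
    simp only [Function.update_self]
    refine ⟨h.mem, ?_⟩
    cases hc : ch.call with
    | insert key => exact ⟨insert_safe h.mem hok.1 rfl, by simp⟩
    | deleteMin => exact ⟨deleteMin_safe ⟨h.mem, hok.1, rfl⟩, by simp⟩
  rw [hth] at hok
  cases p with
  | ret a =>
    simp only [Function.update_self]
    have hl : Loc ch.thread ⟨c.mem, φ ch.thread⟩ := hok.1.unfold _ (Ext.refl _ _)
    exact ⟨h.mem, hl, rfl⟩
  | act o next =>
    simp only [Function.update_self]
    obtain ⟨h₁, h₂⟩ := hok.1.unfold _ (Ext.refl _ _)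
    exact ⟨h.mem.after (t := ch.thread) (s := ⟨c.mem, φ ch.thread⟩) h₁ _ _, h₂ _ _,
      Phase.next_eq_free.trans hok.2⟩
  | loop body s next =>
    simp only [Function.update_self]
    have := hok.1.unfold
    rw [Step, unroll_eq] at this
    exact ⟨h.mem, this, hok.2⟩

theorem Inv.run {c : Config K T} {φ : Fin T → Phase} (h : Inv c φ) (s : ℕ → Choice K T) (n : ℕ) :
    Inv (run k c s n) (phases k c φ s n) := by
  induction n with
  | zero => exact h
  | succ n ih => exact ih.step (s n)

/-- The view of thread `t` after the first `n` steps of a schedule. -/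
def view (k : ℕ) (c : Config K T) (φ : Fin T → Phase) (s : ℕ → Choice K T) (t : Fin T) (n : ℕ) :
    St K T := ⟨(run k c s n).mem, phases k c φ s n t⟩

variable {c : Config K T} {φ : Fin T → Phase} {s : ℕ → Choice K T} {t : Fin T}

theorem Inv.run_other (h : Inv c φ) {i j : ℕ} (hij : i ≤ j)
    (hs : ∀ m, i ≤ m → m < j → (s m).thread ≠ t) :
    (KLSM.run k c s j).thread t = (KLSM.run k c s i).thread t ∧
      Ext t (view k c φ s t i) (view k c φ s t j) := by
  induction j, hij using Nat.le_induction with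
  | base => exact ⟨rfl, Ext.refl _ _⟩
  | succ j hij ih =>
    obtain ⟨h₁, h₂⟩ := ih fun m hm hm' => hs m hm (by omega)
    obtain ⟨h₃, h₄⟩ := (h.run s j).step_other (k := k) (hs j hij (by omega))
    exact ⟨h₃.trans h₁, h₂.trans h₄⟩

theorem step_idle {ch : Choice K T} (h : c.thread ch.thread = .idle) :
    (step k c ch).thread ch.thread = .running ch.call (ch.call.code k ch.thread) ∧
      (step k c ch).mem = c.mem := by
  unfold step; rw [h]; simp

theorem step_ret {ch : Choice K T} {call : Call K} {a : call.Ret}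
    (h : c.thread ch.thread = .running call (.ret a)) :
    (step k c ch).thread ch.thread = .idle ∧ phaseStep c φ ch ch.thread = .free := by
  unfold step phaseStep; rw [h]; simp

theorem step_act {ch : Choice K T} {call : Call K} {β : Type} {o : Op K T β}
    {next : β → Prog K T call.Ret} (h : c.thread ch.thread = .running call (.act o next)) :
    (step k c ch).thread ch.thread = .running call (next (o.exec ch.rnd ch.victim c.mem).1) ∧
      (⟨(step k c ch).mem, phaseStep c φ ch ch.thread⟩ : St K T) =
        St.after ⟨c.mem, φ ch.thread⟩ ch.rnd ch.victim o := by
  unfold step phaseStep; rw [h]; simp [St.after]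

theorem step_loop {ch : Choice K T} {call : Call K} {σ β : Type} {body : σ → Prog K T (σ ⊕ β)}
    {x : σ} {next : β → Prog K T call.Ret}
    (h : c.thread ch.thread = .running call (.loop body x next)) :
    (step k c ch).thread ch.thread = .running call ((body x).bind (unroll body next)) ∧
      (⟨(step k c ch).mem, phaseStep c φ ch ch.thread⟩ : St K T) = ⟨c.mem, φ ch.thread⟩ := by
  unfold step phaseStep; rw [h, unroll_eq]; simp

variable {α : Type} {Q : α → St K T → Prop}

/-- Carries a step bound over to schedules: of `n + r` own steps before `N`, the program uses at
most `n`, and `r` are left for its continuation. Steps of others between two own steps are absorbed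
by `Ext`. -/
theorem Inv.run_bnd (h : Inv c φ) {call : Call K} {f : α → Prog K T call.Ret} {n : ℕ}
    {p : Prog K T α} {i N r : ℕ} (hb : Bnd t Q n p (view k c φ s t i))
    (hp : (KLSM.run k c s i).thread t = .running call (p.bind f)) (hi : i ≤ N)
    (hN : n + r ≤ ownSteps s t i N) :
    ∃ j, i ≤ j ∧ j ≤ N ∧ r ≤ ownSteps s t j N ∧
      ∃ a, (KLSM.run k c s j).thread t = .running call (f a) ∧ Q a (view k c φ s t j) := by
  induction n generalizing p i with
  | zero =>
    cases p with
    | ret a => exact ⟨i, le_rfl, hi, by omega, a, hp, hb _ (Ext.refl _ _)⟩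
    | act o next => exact ((hb _ (Ext.refl _ _)).2 0 t).elim
    | loop body x next => exact False.elim hb
  | succ n ih =>
    cases p with
    | ret a => exact ⟨i, le_rfl, hi, by omega, a, hp, hb _ (Ext.refl _ _)⟩
    | act o next =>
      obtain ⟨j, hij, hj, rfl, hlt, hc⟩ := ownSteps_next (s := s) (show 0 < ownSteps s t i N by omega)
      obtain ⟨h₁, h₂⟩ := h.run_other hij hlt (k := k)
      obtain ⟨h₃, h₄⟩ := step_act (k := k) (φ := phases k c φ s j) (h₁.trans hp)
      have hb' := (hb _ h₂).2 (s j).rnd (s j).victim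
      obtain ⟨j', h₅⟩ := ih (i := j + 1)
        (by rw [show view k c φ s (s j).thread (j + 1) = _ from h₄]; exact hb') h₃ hj (by omega)
      exact ⟨j', by omega, h₅.2⟩
    | loop body x next =>
      obtain ⟨j, hij, hj, rfl, hlt, hc⟩ := ownSteps_next (s := s) (show 0 < ownSteps s t i N by omega)
      obtain ⟨h₁, h₂⟩ := h.run_other hij hlt (k := k)
      obtain ⟨h₃, h₄⟩ := step_loop (k := k) (φ := phases k c φ s j) (h₁.trans hp)
      have hb' := Bnd.ext (n := n) hb h₂
      obtain ⟨j', h₅⟩ := ih (i := j + 1)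
        (by rw [show view k c φ s (s j).thread (j + 1) = _ from h₄]; exact hb') (by rw [unroll_bind]; exact h₃) hj (by omega)
      exact ⟨j', by omega, h₅.2⟩

theorem Inv.run_ter (h : Inv c φ) (hs : ∀ N, ∃ n ≥ N, (s n).thread = t) {call : Call K}
    {f : α → Prog K T call.Ret} {p : Prog K T α} {i : ℕ} (hb : Ter t Q p (view k c φ s t i))
    (hp : (KLSM.run k c s i).thread t = .running call (p.bind f)) :
    ∃ j ≥ i, ∃ a, (KLSM.run k c s j).thread t = .running call (f a) ∧
      Q a (view k c φ s t j) := by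
  -- Induction over `Ter` with a motive ranging over all times `i`, as the time of the thread's next
  -- step is up to the scheduler.
  refine hb (fun p s₀ => ∀ i, Ext t s₀ (view k c φ s t i) →
    (KLSM.run k c s i).thread t = .running call (p.bind f) →
    ∃ j ≥ i, ∃ a, (KLSM.run k c s j).thread t = .running call (f a) ∧ Q a (view k c φ s t j))
    ?_ i (Ext.refl _ _) hp
  clear hb hp i p
  intro p s₀ hb i E hp
  cases p with
  | ret a => exact ⟨i, le_rfl, a, hp, hb _ E⟩
  | act o next =>
    obtain ⟨j, hij, rfl, hlt⟩ := exists_next hs i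
    obtain ⟨h₁, h₂⟩ := h.run_other hij hlt (k := k)
    obtain ⟨h₃, h₄⟩ := step_act (k := k) (φ := phases k c φ s j) (h₁.trans hp)
    have hb' := (hb _ (E.trans h₂)).2 (s j).rnd (s j).victim
    obtain ⟨j', hj', h₅⟩ := hb' (j + 1) (h₄ ▸ Ext.refl _ _) h₃
    exact ⟨j', by omega, h₅⟩
  | loop body x next =>
    obtain ⟨j, hij, rfl, hlt⟩ := exists_next hs i
    obtain ⟨h₁, h₂⟩ := h.run_other hij hlt (k := k)
    obtain ⟨h₃, h₄⟩ := step_loop (k := k) (φ := phases k c φ s j) (h₁.trans hp)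
    have E' := E.trans h₂
    obtain ⟨j', hj', h₅⟩ := hb (j + 1)
      (by rw [show view k c φ s (s j).thread (j + 1) = view k c φ s (s j).thread j from h₄]; exact E')
      (by rw [unroll_bind]; exact h₃)
    exact ⟨j', by omega, h₅⟩

end System

/-! ### Wait-freedom, retries and failures of compare-and-swap -/

section Main

variable {K : Type} {T k : ℕ}

/-- The operation accesses `shared`. -/
def Op.IsAccess : {β : Type} → Op K T β → Prop
  | _, .readShared => True
  | _, .casShared _ _ => True
  | _, _ => False

theorem AccessesShared.isAccess {c : Config K T} {t : Fin T} {call : Call K} {β : Type}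
    {o : Op K T β} {next : β → Prog K T call.Ret} (h : AccessesShared c t)
    (hp : c.thread t = .running call (.act o next)) : o.IsAccess := by
  -- The two descriptions of the thread's state involve operations with possibly different result
  -- types. Transporting a predicate avoids a dependent elimination of their equality.
  let f : ThreadState K T → Prop
    | .running _ (.act o _) => o.IsAccess
    | _ => False
  suffices hf : f (c.thread t) by rwa [hp] at hf
  rcases h with ⟨_, _, h⟩ | ⟨_, _, _, _, h⟩ <;> rw [h] <;> trivial

/-- The only operation that writes to the heap of arrays does so at a fresh address, hence not at
`q`. -/
theorem meas_after {t : Fin T} {s : St K T} {β : Type} {o : Op K T β}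
    (hok : Ok t s o) (rnd : ℕ) (v : Fin T) {q : Option ℕ}
    (hq : ∀ p, q = some p → p < s.mem.nextArray) :
    meas (o.exec rnd v s.mem).2 q = meas s.mem q := by
  rcases q with _ | p
  · rfl
  cases o
  case newArray a =>
    simp [Op.exec, meas, Function.update_of_ne (Nat.ne_of_lt (hq p rfl))]
  case casShared e n =>
    simp only [Op.exec]
    split <;> rfl
  all_goals rfl

variable {c : Config K T} {φ : Fin T → Phase} {s : ℕ → Choice K T} {t : Fin T}

theorem casShared_ne {e n : Option ℕ} (h : ReadsShared c t) (h' : CasShared c t e n) : False := by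
  obtain ⟨_, _, h⟩ := h
  obtain ⟨_, _, h'⟩ := h'
  let f : ThreadState K T → Prop
    | .running _ (.act o _) => match o with
      | .readShared => True
      | _ => False
    | _ => False
  suffices hf : f (c.thread t) by rwa [h'] at hf
  rw [h]; trivial

theorem UpdatesShared.accesses {t : Fin T} (h : UpdatesShared c t) : AccessesShared c t :=
  let ⟨e, n, h, _⟩ := h
  .inr ⟨e, n, h⟩

theorem InInsert.of_eq {c c' : Config K T} (h : InInsert c t) (he : c'.thread t = c.thread t) :
    InInsert c' t := let ⟨key, p, h⟩ := h; ⟨key, p, he.trans h⟩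

theorem Inv.ne_free (h : Inv c φ) (hi : InInsert c t) : φ t ≠ .free := by
  obtain ⟨key, p, hp⟩ := hi
  have hok := h.thread t
  rw [hp] at hok
  exact fun h => by simpa using hok.2.1 h

variable [LinearOrder K]

/-- What a step of an `insert` may do, in terms of the phase. -/
theorem Inv.insert_step (h : Inv c φ) {ch : Choice K T} (ht : ch.thread = t) (hi : InInsert c t)
    (hr : ¬ Returns c t) : InInsert (KLSM.step k c ch) t ∧
      ((ReadsShared c t ∧ (φ t = .start ∨ φ t = .failed) ∧
          phaseStep c φ ch t = .seen c.mem.shared ∧ (KLSM.step k c ch).mem = c.mem) ∨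
        (∃ e n, CasShared c t e n ∧ φ t = .seen e ∧ c.mem.shared = e ∧
          phaseStep c φ ch t = .done) ∨
        (∃ e n, CasShared c t e n ∧ φ t = .seen e ∧ c.mem.shared ≠ e ∧
          phaseStep c φ ch t = .failed) ∨
        (¬ AccessesShared c t ∧ phaseStep c φ ch t = φ t)) := by
  subst ht
  obtain ⟨key, p, hp⟩ := hi
  have hok := h.thread ch.thread
  rw [hp] at hok
  have hne : φ ch.thread ≠ .free := fun h => by simpa using hok.2.1 h
  cases p with
  | ret a => exact (hr ⟨_, _, hp⟩).elim
  | loop body x next =>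
    refine ⟨⟨key, _, (step_loop (k := k) hp (φ := φ)).1⟩, .inr (.inr (.inr ⟨?_, ?_⟩))⟩
    · rintro (⟨_, _, h⟩ | ⟨_, _, _, _, h⟩) <;> rw [hp] at h <;> cases h
    · exact congrArg St.ph (step_loop (k := k) hp (φ := φ)).2
  | act o next =>
    obtain ⟨h₁, h₂⟩ := step_act (k := k) hp (φ := φ)
    have hph := congrArg St.ph h₂
    have hmem := congrArg St.mem h₂
    refine ⟨⟨key, _, h₁⟩, ?_⟩
    have hok' := (hok.1.unfold _ (Ext.refl _ _)).1
    clear h₁ h₂ hok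
    cases o
    case readShared =>
      refine .inl ⟨⟨_, _, hp⟩, ?_, ?_, hmem⟩
      · exact hok'.resolve_left hne
      · simpa [St.after, Phase.next, hne, Op.exec] using hph
    case casShared e n =>
      have hs : φ ch.thread = .seen e := hok'.2.resolve_left fun h => hne h.1
      simp only [St.after, Phase.next, hs, Op.exec] at hph
      by_cases he : c.mem.shared = e
      · exact .inr (.inl ⟨e, n, ⟨_, _, hp⟩, hs, he, by simpa [he] using hph⟩)
      · exact .inr (.inr (.inl ⟨e, n, ⟨_, _, hp⟩, hs, he, by simpa [he] using hph⟩))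
    all_goals
      exact .inr (.inr (.inr ⟨fun h => h.isAccess hp, hph⟩))

theorem thread_step_other {ch : Choice K T} (ht : ch.thread ≠ t) :
    (KLSM.step k c ch).thread t = c.thread t ∧ phaseStep c φ ch t = φ t := by
  unfold KLSM.step phaseStep
  rcases c.thread ch.thread with _ | ⟨call, p⟩
  · simp [Function.update_of_ne (Ne.symm ht)]
  · cases p <;> simp [Function.update_of_ne (Ne.symm ht)]

theorem step_shared {ch : Choice K T} (h : (KLSM.step k c ch).mem.shared ≠ c.mem.shared) :
    UpdatesShared c ch.thread := by
  rcases hp : c.thread ch.thread with _ | ⟨call, p⟩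
  · exact (h (by rw [(step_idle hp).2])).elim
  cases p with
  | ret a => exact (h (by simp [KLSM.step, hp])).elim
  | loop body x next => exact (h (by simp [KLSM.step, hp])).elim
  | act o next =>
    simp only [KLSM.step, hp] at h
    cases o
    case casShared e n =>
      simp only [Op.exec] at h
      split at h
      · rename_i he
        exact ⟨e, n, ⟨_, _, hp⟩, he, fun hn => h (hn.trans he.symm)⟩
      · exact (h rfl).elim
    all_goals exact (h rfl).elim

/-- While an `insert` neither reads `shared` again nor fails, its phase remains `seen` or `done`. -/
theorem Inv.seen_or_done (h : Inv c φ) {i j : ℕ} (hij : i ≤ j) {v : Option ℕ}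
    (hi : InInsert (KLSM.run k c s i) t)
    (hp : phases k c φ s i t = .seen v ∨ phases k c φ s i t = .done)
    (hr : ∀ m, i ≤ m → m < j → (s m).thread = t → ¬ Returns (KLSM.run k c s m) t)
    (hf : ∀ m, i ≤ m → m < j → (s m).thread = t → phases k c φ s m t = .seen v →
      ¬ CasFails (KLSM.run k c s m) t) :
    InInsert (KLSM.run k c s j) t ∧
      (phases k c φ s j t = .seen v ∨ phases k c φ s j t = .done) ∧
      (phases k c φ s i t = .done → phases k c φ s j t = .done) := by
  induction j, hij using Nat.le_induction with
  | base => exact ⟨hi, hp, id⟩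
  | succ j hij ih =>
    obtain ⟨h₁, h₂, h₃⟩ := ih (fun m hm hm' => hr m hm (by omega)) fun m hm hm' =>
      hf m hm (by omega)
    by_cases ht : (s j).thread = t
    · obtain ⟨h₄, h₅⟩ := (h.run s j).insert_step (k := k) ht h₁ (hr j hij (by omega) ht)
      refine ⟨h₄, ?_⟩
      simp only [phases]
      rcases h₅ with ⟨-, h₅, -⟩ | ⟨e, n, -, h₅, -, h₆⟩ | ⟨e, n, h₅, h₇, h₆, -⟩ | ⟨-, h₅⟩
      · rcases h₂ with h₂ | h₂ <;> simp [h₂] at h₅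
      · exact ⟨.inr h₆, fun _ => h₆⟩
      · rcases h₂ with h₂ | h₂
        · exact (hf j hij (by omega) ht h₂ ⟨e, n, h₅, h₆⟩).elim
        · rw [h₂] at h₇; cases h₇
      · rw [h₅]; exact ⟨h₂, h₃⟩
    · obtain ⟨h₄, h₅⟩ := thread_step_other (k := k) (c := KLSM.run k c s j)
        (φ := phases k c φ s j) ht
      refine ⟨h₁.of_eq h₄, ?_⟩
      simp only [phases, h₅]
      exact ⟨h₂, h₃⟩

/-- The first read sets the phase to `seen v`. Without a failing CAS it is `seen v` or `done` at the
second read, but `Ok` permits an `insert` to read only in phase `start` or `failed`. -/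
theorem insertRetriesOnlyOnCasFailure : InsertRetriesOnlyOnCasFailure K T k := by
  intro s t m n hmn ht hi hrd ht' hrd' hr
  have h := Inv.start (K := K) (T := T)
  by_contra hc
  push Not at hc
  have hnr : ¬ Returns (run k (Config.start K T) s m) t := by
    rintro ⟨_, _, h₁⟩
    obtain ⟨_, _, h₂⟩ := hrd
    rw [h₁] at h₂; cases h₂
  have hacc {m : ℕ} : ReadsShared (run k (Config.start K T) s m) t →
      AccessesShared (run k (Config.start K T) s m) t := .inl
  obtain ⟨h₁, h₂⟩ := (h.run s m).insert_step (k := k) ht hi hnr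
  have key : ∃ v, phases k (Config.start K T) (fun _ => .free) s (m + 1) t = .seen v ∨
      phases k (Config.start K T) (fun _ => .free) s (m + 1) t = .done := by
    rcases h₂ with ⟨-, -, h₂, -⟩ | ⟨e, _, h₂, -⟩ | ⟨_, _, h₂, -⟩ | ⟨h₂, -⟩
    · exact ⟨_, .inl h₂⟩
    · exact (casShared_ne hrd h₂).elim
    · exact (casShared_ne hrd h₂).elim
    · exact (h₂ (hacc hrd)).elim
  obtain ⟨v, key⟩ := key
  obtain ⟨h₃, h₄, -⟩ := h.seen_or_done (show m + 1 ≤ n by omega) h₁ key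
    (fun i hi hi' => hr i (by omega) hi') fun i hi hi' ht _ => hc i (by omega) hi' ht
  have hok := (h.run (k := k) s n).thread t
  obtain ⟨call, next, hp⟩ := hrd'
  rw [hp] at hok
  have := (hok.1.unfold _ (Ext.refl _ _)).1
  simp only [Ok] at this
  rcases h₄ with h₄ | h₄ <;> simp [h₄] at this

/-- An `insert` in phase `seen p` has read `p` and since then has not accessed `shared`. -/
theorem exists_read_of_seen {n : ℕ} {p : Option ℕ}
    (hp : phases k (Config.start K T) (fun _ => .free) s n t = .seen p) :
    ∃ m < n, (s m).thread = t ∧ ReadsShared (run k (Config.start K T) s m) t ∧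
      (run k (Config.start K T) s (m + 1)).mem.shared = p ∧
      ∀ i, m < i → i < n → (s i).thread = t →
        ¬ Returns (run k (Config.start K T) s i) t ∧
          ¬ AccessesShared (run k (Config.start K T) s i) t := by
  have h := Inv.start (K := K) (T := T)
  induction n with
  | zero => cases hp
  | succ n ih =>
    have extend (hp' : phases k (Config.start K T) (fun _ => .free) s n t = .seen p)
        (hn : (s n).thread = t → ¬ Returns (run k (Config.start K T) s n) t ∧
          ¬ AccessesShared (run k (Config.start K T) s n) t) :
        ∃ m < n + 1, (s m).thread = t ∧ ReadsShared (run k (Config.start K T) s m) t ∧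
          (run k (Config.start K T) s (m + 1)).mem.shared = p ∧
          ∀ i, m < i → i < n + 1 → (s i).thread = t →
            ¬ Returns (run k (Config.start K T) s i) t ∧
              ¬ AccessesShared (run k (Config.start K T) s i) t := by
      obtain ⟨m, hm, h₁, h₂, h₃, h₄⟩ := ih hp'
      refine ⟨m, by omega, h₁, h₂, h₃, fun i hi hi' => ?_⟩
      rcases Nat.lt_succ_iff_lt_or_eq.1 hi' with hi' | rfl
      · exact h₄ i hi hi'
      · exact hn
    by_cases ht : (s n).thread = t
    · have hnr : ¬ Returns (run k (Config.start K T) s n) t := by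
        rintro ⟨call, r, hr⟩
        subst ht
        have := (step_ret (k := k) (φ := phases k (Config.start K T) (fun _ => .free) s n) hr).2
        simp only [phases] at hp
        rw [this] at hp; cases hp
      -- Only an `insert` can step into phase `seen`: an invocation leads to `start` or `free`, and
      -- a `delete_min` stays in `free` until it returns.
      have hi : InInsert (run k (Config.start K T) s n) t := by
        have hok := (h.run (k := k) s n).thread t
        simp only [phases] at hp
        rcases hth : (run k (Config.start K T) s n).thread t with _ | ⟨_ | _, q⟩
        · subst ht
          rw [phaseStep, hth] at hp
          dsimp only at hp
          rw [Function.update_self] at hp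
          split at hp <;> cases hp
        · exact ⟨_, _, hth⟩
        · rw [hth] at hok
          have hf := hok.2.2 rfl
          subst ht
          dsimp only at hf
          rw [phaseStep, hth] at hp
          cases q with
          | ret a => exact (hnr ⟨_, _, hth⟩).elim
          | act o next =>
            dsimp only at hp
            rw [Function.update_self] at hp
            have := (Phase.next_eq_free (o := o) (v := (o.exec (s n).rnd (s n).victim
              (run k (Config.start K T) s n).mem).1)).2 hf
            rw [this] at hp; cases hp
          | loop body x next => dsimp only at hp; rw [hf] at hp; cases hp
      obtain ⟨-, h₂⟩ := (h.run s n).insert_step (k := k) ht hi hnr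
      simp only [phases] at hp
      rw [hp] at h₂
      rcases h₂ with ⟨h₂, -, h₃, h₄⟩ | ⟨_, _, _, _, _, h₂⟩ | ⟨_, _, _, _, _, h₂⟩ | ⟨h₂, h₃⟩
      · refine ⟨n, by omega, ht, h₂, ?_, fun i _ _ => by omega⟩
        rw [run, h₄]
        exact (Phase.seen.inj h₃).symm
      · cases h₂
      · cases h₂
      · exact extend h₃.symm fun _ => ⟨hnr, h₂⟩
    · refine extend ?_ fun h => (ht h).elim
      rw [← hp]
      exact (thread_step_other (k := k) (c := run k (Config.start K T) s n)
        (φ := phases k (Config.start K T) (fun _ => .free) s n) ht).2.symm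

theorem exists_update {i j : ℕ} (hij : i ≤ j)
    (h : (run k c s j).mem.shared ≠ (run k c s i).mem.shared) :
    ∃ m, i ≤ m ∧ m < j ∧ UpdatesShared (run k c s m) (s m).thread := by
  induction j, hij using Nat.le_induction with
  | base => exact (h rfl).elim
  | succ j hij ih =>
    by_cases hj : (run k c s (j + 1)).mem.shared = (run k c s j).mem.shared
    · obtain ⟨m, hm⟩ := ih (hj ▸ h)
      exact ⟨m, hm.1, by omega, hm.2.2⟩
    · exact ⟨j, hij, by omega, step_shared hj⟩

/-- The CAS takes place in phase `seen e`, so `shared` was `e` right after the last read and is not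
`e` now. An update lies in between, and it is not the thread's own, since the thread has not
accessed `shared` since that read. -/
theorem insertCasFailureNeedsUpdate : InsertCasFailureNeedsUpdate K T k := by
  intro s t n ht hi hf
  have h := Inv.start (K := K) (T := T)
  obtain ⟨e, new, ⟨call, next, hp⟩, hne⟩ := hf
  have hok := (h.run (k := k) s n).thread t
  have hnf := (h.run (k := k) s n).ne_free hi
  rw [hp] at hok
  have hs : phases k (Config.start K T) (fun _ => .free) s n t = .seen e :=
    (hok.1.unfold _ (Ext.refl _ _)).1.2.resolve_left fun h => hnf h.1
  obtain ⟨m, hm, h₁, h₂, h₃, h₄⟩ := exists_read_of_seen hs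
  obtain ⟨j, hj, hj', hu⟩ := exists_update (show m + 1 ≤ n by omega) (h₃.symm ▸ hne)
  exact ⟨m, hm, h₁, h₂, h₄, j, by omega, hj',
    fun htj => (h₄ j (by omega) hj' htj).2 (htj ▸ hu.accesses), hu⟩

theorem Reachable.inv (h : Reachable k c) : ∃ φ, Inv c φ := by
  obtain ⟨s, n, rfl⟩ := h
  exact ⟨_, Inv.start.run s n⟩

theorem localInsertWaitFree : LocalInsertWaitFree K T k := by
  intro c t key hc hidle
  obtain ⟨φ, h⟩ := hc.inv
  obtain ⟨B, hB⟩ := insertLocal_bnd t key (c.mem.dist t).size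
    (∑ i ∈ Finset.range (c.mem.dist t).size, match (c.mem.dist t).blocks i with
      | none => 0
      | some b => (c.mem.block b).items.length)
  -- Besides the `B` steps of the local part: one for the invocation, two for storing block and
  -- size, one for the return. The shared branch needs only two at the end, opening the loop and
  -- reading `shared`.
  refine ⟨B + 4, fun s hs hcall N hN => ?_⟩
  subst hs
  have h0 : (Finset.range N).filter (fun i => (s i).thread = (s 0).thread) =
      (Finset.Ico 0 N).filter (fun i => (s i).thread = (s 0).thread) := by
    rw [Finset.range_eq_Ico]
  rw [h0] at hN
  change B + 4 ≤ ownSteps s (s 0).thread 0 N at hN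
  obtain ⟨j, -, hj, -, hlt, hcnt⟩ := ownSteps_next (show 0 < ownSteps s (s 0).thread 0 N by omega)
  obtain rfl : j = 0 := by
    by_contra hj
    exact hlt 0 le_rfl (by omega) rfl
  rw [zero_add] at hcnt
  have hstep := step_idle (k := k) hidle
  rw [hcall] at hstep
  have hp : (run k c s 1).thread (s 0).thread = .running (.insert key)
      ((insertLocal (s 0).thread key).bind (insertStore k (s 0).thread)) :=
    hstep.1.trans (congrArg (ThreadState.running (.insert key)) (insert_eq k _ key))
  have hm : (run k c s 1).mem = c.mem := hstep.2
  have hb := hB (view k c φ s (s 0).thread 1) (show GI (run k c s 1).mem from hm ▸ h.mem)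
    (by rw [view, hm]) (fun i hi b hb => by
      simp only [view, hm] at hb ⊢
      refine le_trans (le_of_eq ?_) (Finset.single_le_sum (fun _ _ => Nat.zero_le _)
        (Finset.mem_range.2 hi))
      simp only [hb])
  obtain ⟨j, hj₁, hj₂, hj₃, x, hx, E, hlt⟩ := h.run_bnd (r := 3) hb hp hj (by omega)
  unfold insertStore at hx
  split at hx
  · change _ = ThreadState.running (.insert key)
      (.loop (fun _ => sharedInsertRound k (s 0).thread x.2.1) ()
        fun _ => (Op.setDistSize (s 0).thread x.1).call) at hx
    obtain ⟨j₁, h₁, h₂, h₃, h₄, h₅⟩ :=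
      ownSteps_next (show 0 < ownSteps s (s 0).thread j N by omega)
    have hx₁ := (h.run_other h₁ h₄ (k := k)).1.trans hx
    rw [← h₃] at hx₁
    have hx₂ := (step_loop (k := k) hx₁ (φ := phases k c φ s j₁)).1
    rw [h₃] at hx₂
    obtain ⟨j₂, h₆, h₇, h₈, h₉, -⟩ :=
      ownSteps_next (show 0 < ownSteps s (s 0).thread (j₁ + 1) N by omega)
    exact ⟨j₂, h₇, h₈, .inr (.inl ⟨_, _, (h.run_other h₆ h₉ (k := k)).1.trans hx₂⟩)⟩
  · rw [← Prog.bind_ret (_ >>= _)] at hx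
    obtain ⟨j₁, h₁, h₂, h₃, a, ha, -⟩ := h.run_bnd (r := 1) (storeLocal_bnd hlt) hx hj₂ hj₃
    obtain ⟨j₂, h₆, h₇, h₈, h₉, -⟩ :=
      ownSteps_next (show 0 < ownSteps s (s 0).thread j₁ N by omega)
    exact ⟨j₂, h₇, h₈, .inl ⟨_, _, (h.run_other h₆ h₉ (k := k)).1.trans ha⟩⟩

end Main

/-! ### Lock-freedom of `insert` -/

section LockFree

variable {K : Type} [LinearOrder K] {T k : ℕ} {c : Config K T} {φ : Fin T → Phase}
  {s : ℕ → Choice K T} {t : Fin T}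

/-- A step either leaves `shared` and the size of its array unchanged, or it is an update. If the
update belongs to a `delete_min` then it decreases the size. -/
theorem Inv.meas_step (h : Inv c φ) (ch : Choice K T)
    (hu : UpdatesShared c ch.thread → φ ch.thread = .free) :
    meas (KLSM.step k c ch).mem (KLSM.step k c ch).mem.shared ≤ meas c.mem c.mem.shared ∧
      (UpdatesShared c ch.thread →
        meas (KLSM.step k c ch).mem (KLSM.step k c ch).mem.shared < meas c.mem c.mem.shared) := by
  have hok := h.thread ch.thread
  rcases hp : c.thread ch.thread with _ | ⟨call, p⟩
  · rw [(step_idle hp).2]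
    refine ⟨le_rfl, ?_⟩
    rintro ⟨_, _, ⟨_, _, h⟩, -⟩
    rw [hp] at h; cases h
  rw [hp] at hok
  cases p with
  | ret a =>
    simp only [KLSM.step, hp]
    refine ⟨le_rfl, ?_⟩
    rintro ⟨_, _, ⟨_, _, h⟩, -⟩
    rw [hp] at h; cases h
  | loop body x next =>
    simp only [KLSM.step, hp]
    refine ⟨le_rfl, ?_⟩
    rintro ⟨_, _, ⟨_, _, h⟩, -⟩
    rw [hp] at h; cases h
  | act o next =>
    simp only [KLSM.step, hp]
    have hok' := (hok.1.unfold _ (Ext.refl _ _)).1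
    have hm := fun q => meas_after hok' ch.rnd ch.victim (q := q)
    by_cases hup : UpdatesShared c ch.thread
    · have hf := hu hup
      suffices hlt : meas (o.exec ch.rnd ch.victim c.mem).2
          (o.exec ch.rnd ch.victim c.mem).2.shared < meas c.mem c.mem.shared from
        ⟨hlt.le, fun _ => hlt⟩
      have hacc := hup.accesses.isAccess hp
      cases o
      case casShared e n =>
        have hn : ∀ p, n = some p → p < c.mem.nextArray := hok'.1
        -- In phase `free` the alternative `seen e` of `Ok` is excluded, which leaves the condition
        -- on `delete_min`.
        have hlt : n = e ∨ meas c.mem n < meas c.mem e := by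
          rcases hok'.2 with h | h
          · exact h.2
          · exact absurd (hf.symm.trans h) nofun
        obtain ⟨e', n', ⟨_, _, hp'⟩, he, hne⟩ := hup
        rw [hp] at hp'
        cases hp'
        have hsh : (Op.exec ch.rnd ch.victim c.mem (Op.casShared (T := T) (K := K) e n)).2.shared
            = n := by simp [Op.exec, he]
        rw [hsh, hm n hn, he]
        exact hlt.resolve_left hne
      case readShared =>
        obtain ⟨_, _, hcas, -⟩ := hup
        exact (casShared_ne ⟨_, _, hp⟩ hcas).elim
      all_goals exact hacc.elim
    · have hsh : (o.exec ch.rnd ch.victim c.mem).2.shared = c.mem.shared := by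
        by_contra hne
        refine hup (step_shared (k := k) ?_)
        simpa only [KLSM.step, hp] using hne
      rw [hsh, hm _ h.mem.shared]
      exact ⟨le_rfl, fun h => (hup h).elim⟩

theorem Inv.meas_shared_le (h : Inv c φ) {N : ℕ}
    (hu : ∀ n ≥ N, UpdatesShared (KLSM.run k c s n) (s n).thread →
      phases k c φ s n (s n).thread = .free) {i j : ℕ} (hi : N ≤ i) (hij : i ≤ j) :
    meas (KLSM.run k c s j).mem (KLSM.run k c s j).mem.shared ≤
      meas (KLSM.run k c s i).mem (KLSM.run k c s i).mem.shared := by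
  induction j, hij using Nat.le_induction with
  | base => exact le_rfl
  | succ j hij ih => exact ((h.run s j).meas_step (s j) (hu j (by omega))).1.trans ih

/-- If from some time on, only `delete_min` operations update `shared`, then `shared` eventually
does not change any more. -/
theorem Inv.shared_eventually_const (h : Inv c φ) {N : ℕ}
    (hu : ∀ n ≥ N, UpdatesShared (KLSM.run k c s n) (s n).thread →
      phases k c φ s n (s n).thread = .free) :
    ∃ M ≥ N, ∀ n ≥ M, (KLSM.run k c s n).mem.shared = (KLSM.run k c s M).mem.shared := by
  let μ n := meas (KLSM.run k c s n).mem (KLSM.run k c s n).mem.shared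
  -- Take a time after `N` at which the measure is minimal; any later change of `shared` would go
  -- below the minimum.
  obtain ⟨M, hM, hmin⟩ := WellFounded.has_min (measure μ).wf {n | N ≤ n} ⟨N, le_refl N⟩
  refine ⟨M, hM, fun n hn => ?_⟩
  by_contra hne
  obtain ⟨m, hm, -, hm'⟩ := exists_update hn hne
  have hNm : N ≤ m := le_trans hM hm
  refine hmin (m + 1) (show N ≤ m + 1 by omega) (show μ (m + 1) < μ M from ?_)
  exact (((h.run s m).meas_step (k := k) (s m) (hu m hNm)).2 hm').trans_le
    (h.meas_shared_le hu hM hm)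

/-- If no operation completes any more then eventually no `insert` updates `shared`. -/
theorem Inv.eventually_no_insert_update (h : Inv c φ) {N : ℕ}
    (hr : ∀ n ≥ N, ¬ Returns (KLSM.run k c s n) (s n).thread) :
    ∃ M ≥ N, ∀ n ≥ M, UpdatesShared (KLSM.run k c s n) (s n).thread →
      phases k c φ s n (s n).thread = .free := by
  have each : ∀ t, ∃ M, ∀ n ≥ M, N ≤ n → (s n).thread = t → UpdatesShared (KLSM.run k c s n) t →
      phases k c φ s n t = .free := by
    intro t
    by_cases hex : ∃ n ≥ N, (s n).thread = t ∧ UpdatesShared (KLSM.run k c s n) t ∧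
        phases k c φ s n t ≠ .free
    swap
    · push Not at hex
      exact ⟨N, fun n _ hn ht hu => hex n hn ht hu⟩
    obtain ⟨n, hn, ht, hu, hne⟩ := hex
    have insert_of (m : ℕ) (hu : UpdatesShared (KLSM.run k c s m) t)
        (hne : phases k c φ s m t ≠ .free) : InInsert (KLSM.run k c s m) t := by
      obtain ⟨e, n, ⟨call, next, hp⟩, -⟩ := hu
      have hok := (h.run (k := k) s m).thread t
      rw [hp] at hok
      cases call with
      | insert key => exact ⟨key, _, hp⟩
      | deleteMin => exact (hne (hok.2.2 rfl)).elim
    have done_of (m : ℕ) (hm : N ≤ m) (ht : (s m).thread = t)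
        (hu : UpdatesShared (KLSM.run k c s m) t) (hne : phases k c φ s m t ≠ .free) :
        InInsert (KLSM.run k c s (m + 1)) t ∧ phases k c φ s (m + 1) t = .done ∧
          phases k c φ s m t ≠ .done := by
      obtain ⟨h₁, h₂⟩ := (h.run s m).insert_step (k := k) ht (insert_of m hu hne) (ht ▸ hr m hm)
      refine ⟨h₁, ?_⟩
      obtain ⟨e, new, hcas, he, -⟩ := hu
      rcases h₂ with ⟨h₂, -⟩ | ⟨e', n', -, h₂, -, h₃⟩ | ⟨e', n', ⟨_, _, hp⟩, h₂, hne, -⟩ | ⟨h₂, -⟩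
      · exact (casShared_ne h₂ hcas).elim
      · exact ⟨h₃, by rw [h₂]; exact nofun⟩
      · obtain ⟨_, _, hp'⟩ := hcas
        rw [hp] at hp'
        cases hp'
        exact (hne he).elim
      · exact (h₂ (.inr ⟨_, _, hcas⟩)).elim
    obtain ⟨h₁, h₂, -⟩ := done_of n hn ht hu hne
    refine ⟨n + 1, fun m hm hNm ht' hu' => ?_⟩
    by_contra hne'
    -- After its successful update the `insert` is in phase `done`, which permits no further access
    -- to `shared`. As it never returns, the thread stays in that phase.
    have hd : ∀ j, n + 1 ≤ j →
        InInsert (KLSM.run k c s j) t ∧ phases k c φ s j t = .done := by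
      intro j hj
      induction j, hj using Nat.le_induction with
      | base => exact ⟨h₁, h₂⟩
      | succ j hj ih =>
        obtain ⟨h₃, h₄⟩ := ih
        by_cases htj : (s j).thread = t
        · obtain ⟨h₅, h₆⟩ := (h.run s j).insert_step (k := k) htj h₃ (htj ▸ hr j (by omega))
          refine ⟨h₅, ?_⟩
          rw [h₄] at h₆
          rcases h₆ with ⟨-, h₆, -⟩ | ⟨_, _, _, h₆, -⟩ | ⟨_, _, _, h₆, -⟩ | ⟨-, h₆⟩
          · simp at h₆
          · cases h₆
          · cases h₆
          · exact h₆
        · obtain ⟨h₅, h₆⟩ := thread_step_other (k := k) (c := KLSM.run k c s j)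
            (φ := phases k c φ s j) htj
          exact ⟨h₃.of_eq h₅, h₆.trans h₄⟩
    exact (done_of m hNm ht' hu' hne').2.2 (hd m hm).2
  choose M hM using each
  -- There are finitely many threads, so their individual times have a maximum.
  refine ⟨max N (Finset.univ.sup M), le_max_left _ _, fun n hn hu => ?_⟩
  exact hM (s n).thread n ((Finset.le_sup (Finset.mem_univ _)).trans
    ((le_max_right _ _).trans hn)) ((le_max_left _ _).trans hn) rfl hu

/-- The invocation of a running `insert`. -/
theorem exists_invocation {n : ℕ} (hi : InInsert (run k (Config.start K T) s n) t) :
    ∃ m ≤ n, ∃ key, (run k (Config.start K T) s m).thread t =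
        .running (.insert key) (insert k t key) ∧
      phases k (Config.start K T) (fun _ => .free) s m t = .start ∧
      ∀ i, m ≤ i → i < n → (s i).thread = t → ¬ Returns (run k (Config.start K T) s i) t := by
  have h := Inv.start (K := K) (T := T)
  induction n with
  | zero => obtain ⟨_, _, h⟩ := hi; cases h
  | succ n ih =>
    have extend (hi : InInsert (run k (Config.start K T) s n) t)
        (hr : (s n).thread = t → ¬ Returns (run k (Config.start K T) s n) t) :
        ∃ m ≤ n + 1, ∃ key, (run k (Config.start K T) s m).thread t =
            .running (.insert key) (insert k t key) ∧
          phases k (Config.start K T) (fun _ => .free) s m t = .start ∧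
          ∀ i, m ≤ i → i < n + 1 → (s i).thread = t →
            ¬ Returns (run k (Config.start K T) s i) t := by
      obtain ⟨m, hm, key, h₁, h₂, h₃⟩ := ih hi
      refine ⟨m, by omega, key, h₁, h₂, fun i hi hi' => ?_⟩
      rcases Nat.lt_succ_iff_lt_or_eq.1 hi' with hi' | rfl
      · exact h₃ i hi hi'
      · exact hr
    by_cases ht : (s n).thread = t
    · subst ht
      have hr : ¬ Returns (run k (Config.start K T) s n) (s n).thread := by
        rintro ⟨call, r, hr⟩
        obtain ⟨_, _, hp⟩ := hi
        rw [run, (step_ret (φ := fun _ => .free) hr).1] at hp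
        cases hp
      obtain ⟨key, p, hp⟩ := hi
      rcases hth : (run k (Config.start K T) s n).thread (s n).thread with _ | ⟨call, q⟩
      · have h₁ := (step_idle (k := k) hth).1
        rw [run, h₁] at hp
        obtain ⟨hc, -⟩ := ThreadState.running.inj hp
        rw [hc] at h₁
        refine ⟨n + 1, le_rfl, key, h₁, ?_, fun i hi hi' => by omega⟩
        simp only [phases, phaseStep, hth, Function.update_self, hc]
      · refine extend ?_ fun _ => hr
        cases q with
        | ret a => exact (hr ⟨_, _, hth⟩).elim
        | act o next =>
          rw [run, (step_act (φ := fun _ => .free) hth).1] at hp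
          obtain ⟨rfl, -⟩ := ThreadState.running.inj hp
          exact ⟨_, _, hth⟩
        | loop body x next =>
          rw [run, (step_loop (φ := fun _ => .free) hth).1] at hp
          obtain ⟨rfl, -⟩ := ThreadState.running.inj hp
          exact ⟨_, _, hth⟩
    · exact extend (hi.of_eq (thread_step_other (k := k) (c := run k (Config.start K T) s n)
        (φ := fun _ => .free) ht).1.symm) fun h => (ht h).elim

/-- Thread `t` is about to start a round of the loop of `SharedKLSM::insert`. -/
def AtRound (k : ℕ) (c : Config K T) (φ : Fin T → Phase) (s : ℕ → Choice K T) (t : Fin T) (key : K)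
    (i b n : ℕ) : Prop :=
  (run k c s n).thread t = .running (.insert key)
      (.loop (fun _ => sharedInsertRound k t b) () fun _ => (Op.setDistSize t i).call) ∧
    b < (run k c s n).mem.nextBlock ∧
    (phases k c φ s n t = .start ∨ phases k c φ s n t = .failed)

/-- An `insert` that never returns but takes infinitely many steps starts infinitely many rounds. -/
theorem Inv.exists_atRound (h : Inv c φ) (hs : ∀ N, ∃ n ≥ N, (s n).thread = t) {key : K} {m : ℕ}
    (hm : (KLSM.run k c s m).thread t = .running (.insert key) (insert k t key))
    (hp : phases k c φ s m t = .start)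
    (hr : ∀ n ≥ m, (s n).thread = t → ¬ Returns (KLSM.run k c s n) t) :
    ∃ i b, ∀ N, ∃ n ≥ N, AtRound k c φ s t key i b n := by
  have returns {Q : Unit → St K T → Prop} {p : Prog K T Unit} {n : ℕ} (hn : m ≤ n)
      (hb : Ter t Q p (view k c φ s t n))
      (hp : (KLSM.run k c s n).thread t = .running (.insert key) p) : False := by
    obtain ⟨j, hj, a, hp, -⟩ := h.run_ter (call := .insert key) (f := Prog.ret) hs hb
      (hp.trans (congrArg (ThreadState.running (.insert key)) (Prog.bind_ret p).symm))
    obtain ⟨j', hj', ht, hlt⟩ := exists_next hs j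
    exact hr j' (by omega) ht ⟨_, _, (h.run_other hj' hlt).1.trans hp⟩
  have hG n := (h.run (k := k) s n).mem
  obtain ⟨j, hj, ⟨i, b, l⟩, hx, E, hb⟩ := h.run_ter hs
    (insertLocal_ter (t := t) (key := key) (s := view k c φ s t m) (hG m)) (f := insertStore k t)
    (hm.trans (congrArg (ThreadState.running (.insert key)) (insert_eq k t key)))
  have hph : phases k c φ s j t = .start := E.ph.trans hp
  unfold insertStore at hx
  split at hx
  swap
  -- The local branch would terminate and return, so the `insert` must be in the shared branch.
  · exact (returns hj (storeLocal_bnd hb).ter hx).elim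
  suffices hN : ∀ N, ∃ n ≥ N, m ≤ n ∧ AtRound k c φ s t key i b n from
    ⟨i, b, fun N => let ⟨n, hn, _, h⟩ := hN N; ⟨n, hn, h⟩⟩
  intro N
  induction N with
  | zero => exact ⟨j, Nat.zero_le j, hj, hx, hb, .inl hph⟩
  | succ N ih =>
    obtain ⟨n, hn, hmn, hxn, hbn, hpn⟩ := ih
    obtain ⟨j₁, h₁, rfl, h₃⟩ := exists_next hs n
    obtain ⟨h₄, E₄⟩ := h.run_other h₁ h₃ (k := k)
    obtain ⟨h₅, h₆⟩ := step_loop (k := k) (φ := phases k c φ s j₁) (h₄.trans hxn)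
    have hv : view k c φ s (s j₁).thread (j₁ + 1) = view k c φ s (s j₁).thread j₁ := h₆
    have hter := (sharedInsertRound_ter (k := k) (b := b)
      (s := view k c φ s (s j₁).thread n) (hG n) hbn hpn).ext E₄
    rw [← hv] at hter E₄
    obtain ⟨j₂, h₇, r, h₈, h₉⟩ := h.run_ter (i := j₁ + 1) hs hter h₅
    -- A round ends either at the loop head in phase `failed`, which is the next round sought, or
    -- with a success, after which the `insert` would return.
    rcases r with _ | _
    · exact ⟨j₂, by omega, by omega, h₈, hbn.trans_le h₉.1.nb, .inr h₉.2⟩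
    · refine (returns (Q := fun _ _ => True) (by omega) ?_ h₈).elim
      rw [← bind_pure (Op.setDistSize (s j₁).thread i).call]
      exact Ter.fold (Step.setDistSize fun _ _ => Ter.pure fun _ _ => trivial)

/-- If nothing returns after `N`, some `insert` runs forever and starts infinitely many rounds,
while `shared` eventually stops changing. The first read in a late round sees the final value, so no
CAS based on it can fail and the phase stays `seen` or `done`. A later round, however, starts in
phase `start` or `failed`. -/
theorem insertLockFree : InsertLockFree K T k := by
  intro s hinf
  by_contra! hr
  obtain ⟨N, hr⟩ := hr
  have h := Inv.start (K := K) (T := T)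
  -- Pigeonhole over the finitely many threads.
  obtain ⟨t, ht⟩ : ∃ t, ∀ M, ∃ n ≥ M, (s n).thread = t ∧
      InInsert (run k (Config.start K T) s n) t := by
    by_contra! hc
    choose M hM using hc
    obtain ⟨n, hn, hi⟩ := hinf (Finset.univ.sup M)
    exact hM (s n).thread n ((Finset.le_sup (Finset.mem_univ _)).trans hn) rfl hi
  have hs : ∀ M, ∃ n ≥ M, (s n).thread = t := fun M => let ⟨n, hn, h, _⟩ := ht M; ⟨n, hn, h⟩
  obtain ⟨n₀, hn₀, -, hi₀⟩ := ht N
  obtain ⟨m, hm, key, hth, hph, hnr⟩ := exists_invocation hi₀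
  have hnr' : ∀ n ≥ m, (s n).thread = t → ¬ Returns (run k (Config.start K T) s n) t := by
    intro n hn ht
    by_cases hlt : n < n₀
    · exact hnr n hn hlt ht
    · exact ht ▸ hr n (by omega)
  obtain ⟨i, b, hround⟩ := h.exists_atRound hs hth hph hnr'
  obtain ⟨N₁, hN₁, hup⟩ := h.eventually_no_insert_update hr
  obtain ⟨N₂, hN₂, hconst⟩ := h.shared_eventually_const hup
  -- `N₂` makes `shared` constant from here on, and `n₀` places the round after the invocation of
  -- this `insert`.
  obtain ⟨j, hj, hx, hb, hp⟩ := hround (max N₂ n₀)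
  have hjN : N₂ ≤ j := (le_max_left _ _).trans hj
  have hjm : m ≤ j := hm.trans ((le_max_right _ _).trans hj)
  obtain ⟨j₁, h₁, htj₁, h₃⟩ := exists_next hs j
  obtain ⟨h₄, E₄⟩ := h.run_other h₁ h₃ (k := k)
  subst htj₁
  obtain ⟨h₅, -⟩ := step_loop (k := k) (φ := fun _ => .free) (h₄.trans hx)
  obtain ⟨j₂, h₆, htj₂, h₇⟩ := exists_next hs (j₁ + 1)
  obtain ⟨h₈, -⟩ := h.run_other h₆ h₇ (k := k)
  have hread : ReadsShared (run k (Config.start K T) s j₂) (s j₁).thread :=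
    ⟨_, _, h₈.trans h₅⟩
  have hins : InInsert (run k (Config.start K T) s j₂) (s j₁).thread := ⟨_, _, h₈.trans h₅⟩
  obtain ⟨h₉, hstep⟩ := (h.run s j₂).insert_step (k := k) htj₂ hins (hnr' j₂ (by omega) htj₂)
  have hseen : phases k (Config.start K T) (fun _ => .free) s (j₂ + 1) (s j₁).thread =
      .seen (run k (Config.start K T) s N₂).mem.shared := by
    rw [← hconst j₂ (by omega)]
    rcases hstep with ⟨-, -, h, -⟩ | ⟨_, _, h, -⟩ | ⟨_, _, h, -⟩ | ⟨h, -⟩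
    · exact h
    · exact (casShared_ne hread h).elim
    · exact (casShared_ne hread h).elim
    · exact (h (.inl hread)).elim
  obtain ⟨j₃, hj₃, -, -, hp₃⟩ := hround (j₂ + 1)
  obtain ⟨-, hfin, -⟩ := h.seen_or_done hj₃ h₉ (.inl hseen) (fun n hn _ => hnr' n (by omega))
    (by
      rintro n hn - - hsn ⟨e, new, ⟨call, next, hp⟩, hne⟩
      have hok := (h.run (k := k) s n).thread (s j₁).thread
      rw [hp, hsn] at hok
      rcases (hok.1.unfold _ (Ext.refl _ _)).1.2 with h | h
      · cases h.1
      · exact hne ((hconst n (by omega)).trans (Phase.seen.inj h)))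
  rcases hfin with h | h <;> rw [h] at hp₃ <;> simp at hp₃

end LockFree
end KLSM

theorem mainTheorem4 (K : Type) [LinearOrder K] (T k : ℕ) :
    KLSM.InsertLockFree K T k ∧
      KLSM.LocalInsertWaitFree K T k ∧
      KLSM.InsertRetriesOnlyOnCasFailure K T k ∧
      KLSM.InsertCasFailureNeedsUpdate K T k :=
  ⟨KLSM.insertLockFree, KLSM.localInsertWaitFree, KLSM.insertRetriesOnlyOnCasFailure,
    KLSM.insertCasFailureNeedsUpdate⟩
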